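/- Let $c>0$ and $L>0$. A real function on $\mathbb R$ is called piecewise smooth if each point has a one-sided neighbourhood on either side on which the function agrees with a function smooth up to and including that point, and its value at the point lies between the two one-sided limits. For each real $k_z$ let an eigenproblem with eigenvalue $\omega^2/c^2$ be given; its bands $0\le\omega_0(k_z)\le\omega_1(k_z)\le\cdots$ are the numbers for which $\omega_n(k_z)^2/c^2$ runs through all eigenvalues in nondecreasing order, repeated according to multiplicity. We say that all bands have asymptotic slope $v$ if the bands exist for every $k_z$ and, for every $n$, $$\lim_{k_z\to\infty}\frac{\omega_n(k_z)}{k_z}=\lim_{k_z\to\infty}\frac{d\omega_n}{dk_z}=v .$$ Since ordered bands may have kinks where they cross, the second limit means: $\omega_n$ has a left and a right derivative at every $k_z>0$, both tend to $v$, $\omega_n$ is differentiable on $(0,\infty)$ outside a countable set, and its derivative tends to $v$ along the points of differentiability. (1) Let $V$ be positive, $L$-periodic and piecewise smooth. Let $\hat K$ be either (a) any positive semidefinite self-adjoint operator with compact resolvent in $L^2(0,L)$ (its domain contains the boundary conditions), or (b) $\hat K=-w\frac{d}{dx}\,p\,\frac{d}{dx}\,w$ with $L$-periodic piecewise smooth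 functions $w,p$ bounded below by positive constants, acting on functions with the Bloch boundary condition $\psi(x)=e^{ik_xL}\psi(x+L)$ for $\psi$ and, likewise, for its derivative (in the form of the flux $p(w\psi)'$), where $k_x\in\mathbb R$ and $w\psi$ and $p(w\psi)'$ are continuous. Then all bands of $[\hat K+k_z^2V(x)]\psi=\frac{\omega^2}{c^2}\psi$ have asymptotic slope $c\sqrt{\inf V}$. (2) Let $\varepsilon(x)=\begin{pmatrix}\varepsilon_{xx}&0&\varepsilon_{xz}\\0&\varepsilon_{yy}&0\\\varepsilon_{xz}&0&\varepsilon_{zz}\end{pmatrix}$ be real, $L$-periodic and uniformly positive definite with piecewise smooth entries, let $\Delta=\varepsilon_{xx}\varepsilon_{zz}-\varepsilon_{xz}^2$ and $k_x\in\mathbb R$. Under the Bloch boundary condition with $k_x$, all bands of the odd-mode equation $$\Big[-\varepsilon_{yy}^{-1/2}\tfrac{d^2}{dx^2}\varepsilon_{yy}^{-1/2}+k_z^2\varepsilon_{yy}^{-1}\Big]\psi=\tfrac{\omega^2}{c^2}\psi\qquad(\psi=\sqrt{\varepsilon_{yy}}\,E_y;\ E_y,\ E_y'\ \text{continuous})$$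 have asymptotic slope $c/\sqrt{\sup\varepsilon_{yy}}$, and all bands of the even-mode equation $$\Big[-\tfrac{d}{dx}\tfrac{\varepsilon_{xx}}{\Delta}\tfrac{d}{dx}+k_z\Big\{-i\tfrac{d}{dx},\tfrac{\varepsilon_{xz}}{\Delta}\Big\}+k_z^2\tfrac{\varepsilon_{zz}}{\Delta}\Big]H_y=\tfrac{\omega^2}{c^2}H_y$$ have asymptotic slope $c/\sqrt{\sup\varepsilon_{xx}}$; here $\{A,B\}=AB+BA$, and $H_y$ and the flux $-i\frac{\varepsilon_{xx}}{\Delta}H_y'+k_z\frac{\varepsilon_{xz}}{\Delta}H_y$ are continuous and satisfy the Bloch condition. -/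

import Mathlib

open Filter Topology MeasureTheory Set

noncomputable section

namespace PhotonicBands

/-! ### Piecewise smooth functions -/

/-- `f : ℝ → ℝ` is piecewise smooth: immediately to the left and immediately to the right of every
point `a` it coincides with functions that are smooth up to and including `a`. At a jump the value
is only required to lie between the two one-sided limits. For a periodic function, compactness
of a period leaves finitely many break points in each period. -/
def PiecewiseSmooth (f : ℝ → ℝ) : Prop :=
  ∀ a : ℝ, ∃ g h : ℝ → ℝ, ContDiff ℝ (⊤ : ℕ∞) g ∧ ContDiff ℝ (⊤ : ℕ∞) h ∧
    (∀ᶠ x in 𝓝[<] a, f x = g x) ∧ (∀ᶠ x in 𝓝[>] a, f x = h x) ∧ f a ∈ uIcc (g a) (h a)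

/-- Piecewise smooth, `L`-periodic, and bounded below by a positive constant. -/
structure IsPositiveCoefficient (L : ℝ) (f : ℝ → ℝ) : Prop where
  piecewiseSmooth : PiecewiseSmooth f
  periodic : Function.Periodic f L
  bounded_below : ∃ m : ℝ, 0 < m ∧ ∀ x, m ≤ f x

/-! ### Bands of a family of eigenproblems -/

/-- `E k μ` is the eigenspace, at wave number `k`, for the eigenvalue `μ` of an eigenproblem whose
eigenvalues are written `μ = ω² / c²`. The functions `ω 0, ω 1, …` are its bands if, at each `k`,
`ω 0 k ≤ ω 1 k ≤ …` are nonnegative and list all eigenvalues, each one as often as its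
multiplicity says. -/
structure IsBands {M : Type} [AddCommGroup M] [Module ℂ M] (c : ℝ)
    (E : ℝ → ℝ → Submodule ℂ M) (ω : ℕ → ℝ → ℝ) : Prop where
  nonneg : ∀ n k, 0 ≤ ω n k
  mono : ∀ k, Monotone fun n => ω n k
  multiplicity : ∀ k μ : ℝ,
    Module.rank ℂ (E k μ) = Cardinal.mk {n : ℕ // (ω n k) ^ 2 / c ^ 2 = μ}

/-- `lim f(k)/k = lim f'(k) = v` as `k → ∞`. Ordered bands may have kinks where they cross, so the
second limit is stated for the derivative at the points of differentiability (all `k > 0` up to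
countably many) and for the two one-sided derivatives, which exist at every `k > 0`. -/
structure HasAsymptoticSlope (f : ℝ → ℝ) (v : ℝ) : Prop where
  phase : Tendsto (fun k => f k / k) atTop (𝓝 v)
  countable_kinks : {k : ℝ | 0 < k ∧ ¬ DifferentiableAt ℝ f k}.Countable
  group : Tendsto (deriv f) (atTop ⊓ 𝓟 {k | DifferentiableAt ℝ f k}) (𝓝 v)
  one_sided : ∃ r l : ℝ → ℝ,
    (∀ k, 0 < k → HasDerivWithinAt f (r k) (Ioi k) k ∧ HasDerivWithinAt f (l k) (Iio k) k) ∧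
    Tendsto r atTop (𝓝 v) ∧ Tendsto l atTop (𝓝 v)

/-- The bands of the eigenproblem exist, and every one of them has asymptotic slope `v`. -/
def AllBandsHaveSlope {M : Type} [AddCommGroup M] [Module ℂ M] (c : ℝ)
    (E : ℝ → ℝ → Submodule ℂ M) (v : ℝ) : Prop :=
  (∃ ω, IsBands c E ω) ∧ ∀ ω, IsBands c E ω → ∀ n, HasAsymptoticSlope (ω n) v

/-! ### General positive semidefinite operators on one period -/

/-- The Hilbert space `L²(0, L)` of complex functions on one period. -/
abbrev L2 (L : ℝ) : Type := Lp ℂ 2 (volume.restrict (Ioo 0 L))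

/-- A positive semidefinite self-adjoint operator with compact resolvent (i.e. with purely discrete
spectrum); its domain carries the boundary conditions. -/
structure IsPosSemidefDiscrete {L : ℝ} (K : L2 L →ₗ.[ℂ] L2 L) : Prop where
  selfAdjoint : IsSelfAdjoint K
  nonneg : ∀ u : K.domain, 0 ≤ (inner ℂ (u : L2 L) (K u)).re
  compactResolvent : ∃ (z : ℂ) (R : L2 L →L[ℂ] L2 L), IsCompactOperator R ∧
    (∀ f, ∃ h : R f ∈ K.domain, K ⟨R f, h⟩ - z • R f = f) ∧
    ∀ u : K.domain, R (K u - z • (u : L2 L)) = u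

/-- Solutions `ψ` of `(K + k² V) ψ = μ ψ` in `L²(0, L)`. -/
def operatorEigenspace {L : ℝ} (K : L2 L →ₗ.[ℂ] L2 L) (V : ℝ → ℝ) (k μ : ℝ) :
    Submodule ℂ (L2 L) where
  carrier := {ψ | ∃ h : ψ ∈ K.domain, ∀ᵐ x ∂(volume.restrict (Ioo 0 L)),
    K ⟨ψ, h⟩ x + (k : ℂ) ^ 2 * (V x : ℂ) * ψ x = (μ : ℂ) * ψ x}
  zero_mem' := by
    refine ⟨K.domain.zero_mem, ?_⟩
    have h0 : K ⟨0, K.domain.zero_mem⟩ = 0 := K.map_zero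
    rw [h0]
    filter_upwards [Lp.coeFn_zero ℂ 2 (volume.restrict (Ioo 0 L))] with x hx
    rw [hx]
    simp
  add_mem' := by
    rintro a b ⟨ha, ea⟩ ⟨hb, eb⟩
    refine ⟨K.domain.add_mem ha hb, ?_⟩
    have h0 : K ⟨a + b, K.domain.add_mem ha hb⟩ = K ⟨a, ha⟩ + K ⟨b, hb⟩ :=
      K.map_add ⟨a, ha⟩ ⟨b, hb⟩
    rw [h0]
    filter_upwards [ea, eb, Lp.coeFn_add a b, Lp.coeFn_add (K ⟨a, ha⟩) (K ⟨b, hb⟩)]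
      with x h1 h2 h3 h4
    rw [h3, h4]
    simp only [Pi.add_apply]
    linear_combination h1 + h2
  smul_mem' := by
    rintro r a ⟨ha, ea⟩
    refine ⟨K.domain.smul_mem r ha, ?_⟩
    have h0 : K ⟨r • a, K.domain.smul_mem r ha⟩ = r • K ⟨a, ha⟩ := K.map_smul r ⟨a, ha⟩
    rw [h0]
    filter_upwards [ea, Lp.coeFn_smul r a, Lp.coeFn_smul r (K ⟨a, ha⟩)] with x h1 h3 h4
    rw [h3, h4]
    simp only [Pi.smul_apply, smul_eq_mul]
    linear_combination r * h1

/-! ### Bloch eigenproblems for differential operators -/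

/-- The Bloch condition `f(x) = exp(i kx L) f(x + L)`. -/
def IsBloch (L kx : ℝ) (f : ℝ → ℂ) : Prop :=
  ∀ x, f x = Complex.exp (Complex.I * kx * L) * f (x + L)

/-- Bloch solutions of `- w d/dx (p d/dx (w ψ)) + k² V ψ = μ ψ`. As usual for discontinuous
coefficients, `w ψ` and the flux `v = p d/dx (w ψ)` are continuous and the equation holds
off a countable set (the break points). With `L`-periodic `w`, `p`, the Bloch condition on `v`
is the Bloch condition on the derivative. -/
def blochEigenspace (L kx : ℝ) (w p V : ℝ → ℝ) (k μ : ℝ) : Submodule ℂ (ℝ → ℂ) where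
  carrier := {ψ | IsBloch L kx ψ ∧ Continuous (fun x => (w x : ℂ) * ψ x) ∧
    ∃ v : ℝ → ℂ, IsBloch L kx v ∧ Continuous v ∧ ∃ S : Set ℝ, S.Countable ∧ ∀ x, x ∉ S →
      ∃ d₁ d₂ : ℂ, HasDerivAt (fun y => (w y : ℂ) * ψ y) d₁ x ∧ HasDerivAt v d₂ x ∧
        v x = (p x : ℂ) * d₁ ∧
        -(w x : ℂ) * d₂ + (k : ℂ) ^ 2 * (V x : ℂ) * ψ x = (μ : ℂ) * ψ x}
  zero_mem' := by
    refine ⟨fun x => by simp, by simpa using continuous_const, 0, fun x => by simp,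
      continuous_const, ∅, countable_empty, fun x _ => ⟨0, 0, ?_, ?_, by simp, by simp⟩⟩
    · simpa using hasDerivAt_const x (0 : ℂ)
    · exact hasDerivAt_const x (0 : ℂ)
  add_mem' := by
    rintro a b ⟨a1, a2, v, a3, a4, S, a5, a6⟩ ⟨b1, b2, v', b3, b4, S', b5, b6⟩
    refine ⟨fun x => ?_, ?_, v + v', fun x => ?_, a4.add b4, S ∪ S', a5.union b5, fun x hx => ?_⟩
    · simp only [Pi.add_apply]
      linear_combination a1 x + b1 x
    · exact (a2.add b2).congr fun x => (mul_add _ _ _).symm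
    · simp only [Pi.add_apply]
      linear_combination a3 x + b3 x
    · obtain ⟨d₁, d₂, h1, h2, h3, h4⟩ := a6 x fun h => hx (Or.inl h)
      obtain ⟨e₁, e₂, g1, g2, g3, g4⟩ := b6 x fun h => hx (Or.inr h)
      refine ⟨d₁ + e₁, d₂ + e₂, ?_, h2.add g2, ?_, ?_⟩
      · exact (h1.add g1).congr_of_eventuallyEq (Eventually.of_forall fun y => mul_add _ _ _)
      · simp only [Pi.add_apply]
        linear_combination h3 + g3
      · simp only [Pi.add_apply]
        linear_combination h4 + g4
  smul_mem' := by
    rintro r a ⟨a1, a2, v, a3, a4, S, a5, a6⟩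
    refine ⟨fun x => ?_, ?_, r • v, fun x => ?_, a4.const_smul r, S, a5, fun x hx => ?_⟩
    · simp only [Pi.smul_apply, smul_eq_mul]
      linear_combination r * a1 x
    · exact (a2.const_smul r).congr fun x => mul_left_comm _ _ _
    · simp only [Pi.smul_apply, smul_eq_mul]
      linear_combination r * a3 x
    · obtain ⟨d₁, d₂, h1, h2, h3, h4⟩ := a6 x hx
      refine ⟨r * d₁, r * d₂, ?_, h2.const_smul r, ?_, ?_⟩
      · exact (h1.const_mul r).congr_of_eventuallyEq
          (Eventually.of_forall fun y => mul_left_comm _ _ _)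
      · simp only [Pi.smul_apply, smul_eq_mul]
        linear_combination r * h3
      · simp only [Pi.smul_apply, smul_eq_mul]
        linear_combination r * h4

/-! ### Odd and even modes of a layered dielectric -/

/-- The relative permittivity tensor of a layered medium with mirror symmetry `y ↦ -y`. -/
def permittivity (εxx εyy εzz εxz : ℝ → ℝ) (x : ℝ) : Matrix (Fin 3) (Fin 3) ℝ :=
  !![εxx x, 0, εxz x; 0, εyy x, 0; εxz x, 0, εzz x]

/-- An `L`-periodic, piecewise smooth, (uniformly) positive definite permittivity. -/
structure IsLayeredDielectric (L : ℝ) (εxx εyy εzz εxz : ℝ → ℝ) : Prop where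
  smooth_xx : PiecewiseSmooth εxx
  smooth_yy : PiecewiseSmooth εyy
  smooth_zz : PiecewiseSmooth εzz
  smooth_xz : PiecewiseSmooth εxz
  periodic : Function.Periodic (permittivity εxx εyy εzz εxz) L
  posDef : ∃ m : ℝ, 0 < m ∧
    ∀ x, (permittivity εxx εyy εzz εxz x - m • (1 : Matrix (Fin 3) (Fin 3) ℝ)).PosSemidef

/-- Odd modes, in the unknown `ψ = √εyy E_y`:
`[-εyy^(-1/2) d²/dx² εyy^(-1/2) + k² εyy⁻¹] ψ = μ ψ`. -/
def oddEigenspace (L kx : ℝ) (εyy : ℝ → ℝ) (k μ : ℝ) : Submodule ℂ (ℝ → ℂ) :=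
  blochEigenspace L kx (fun x => (√(εyy x))⁻¹) (fun _ => 1) (fun x => (εyy x)⁻¹) k μ

/-- Even modes, in the unknown `H = H_y`: with `D = -i d/dx` and `Δ = εxx εzz - εxz²`,
`[D (εxx/Δ) D + k (D (εxz/Δ) + (εxz/Δ) D) + k² εzz/Δ] H = μ H`, under the Bloch condition.
Here `H` and the flux `v = (εxx/Δ) D H + k (εxz/Δ) H` are continuous, and the equation, which
reads `D v + k ((εxz/Δ) D H + k (εzz/Δ) H) = μ H`, holds off a countable set. -/
def evenEigenspace (L kx : ℝ) (εxx εzz εxz : ℝ → ℝ) (k μ : ℝ) : Submodule ℂ (ℝ → ℂ) where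
  carrier := {H | IsBloch L kx H ∧ Continuous H ∧
    ∃ v : ℝ → ℂ, IsBloch L kx v ∧ Continuous v ∧ ∃ S : Set ℝ, S.Countable ∧ ∀ x, x ∉ S →
      ∃ d₁ d₂ : ℂ, HasDerivAt H d₁ x ∧ HasDerivAt v d₂ x ∧
        v x = ((εxx x / (εxx x * εzz x - εxz x ^ 2) : ℝ) : ℂ) * (-Complex.I * d₁) +
          (k : ℂ) * ((εxz x / (εxx x * εzz x - εxz x ^ 2) : ℝ) : ℂ) * H x ∧
        -Complex.I * d₂ +
          (k : ℂ) * (((εxz x / (εxx x * εzz x - εxz x ^ 2) : ℝ) : ℂ) * (-Complex.I * d₁) +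
            (k : ℂ) * ((εzz x / (εxx x * εzz x - εxz x ^ 2) : ℝ) : ℂ) * H x) = (μ : ℂ) * H x}
  zero_mem' := by
    refine ⟨fun x => by simp, continuous_const, 0, fun x => by simp,
      continuous_const, ∅, countable_empty, fun x _ => ⟨0, 0, ?_, ?_, by simp, by simp⟩⟩
    · exact hasDerivAt_const x (0 : ℂ)
    · exact hasDerivAt_const x (0 : ℂ)
  add_mem' := by
    rintro a b ⟨a1, a2, v, a3, a4, S, a5, a6⟩ ⟨b1, b2, v', b3, b4, S', b5, b6⟩
    refine ⟨fun x => ?_, a2.add b2, v + v', fun x => ?_, a4.add b4, S ∪ S', a5.union b5,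
      fun x hx => ?_⟩
    · simp only [Pi.add_apply]
      linear_combination a1 x + b1 x
    · simp only [Pi.add_apply]
      linear_combination a3 x + b3 x
    · obtain ⟨d₁, d₂, h1, h2, h3, h4⟩ := a6 x fun h => hx (Or.inl h)
      obtain ⟨e₁, e₂, g1, g2, g3, g4⟩ := b6 x fun h => hx (Or.inr h)
      refine ⟨d₁ + e₁, d₂ + e₂, h1.add g1, h2.add g2, ?_, ?_⟩
      · simp only [Pi.add_apply]
        linear_combination h3 + g3
      · simp only [Pi.add_apply]
        linear_combination h4 + g4
  smul_mem' := by
    rintro r a ⟨a1, a2, v, a3, a4, S, a5, a6⟩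
    refine ⟨fun x => ?_, a2.const_smul r, r • v, fun x => ?_, a4.const_smul r, S, a5,
      fun x hx => ?_⟩
    · simp only [Pi.smul_apply, smul_eq_mul]
      linear_combination r * a1 x
    · simp only [Pi.smul_apply, smul_eq_mul]
      linear_combination r * a3 x
    · obtain ⟨d₁, d₂, h1, h2, h3, h4⟩ := a6 x hx
      refine ⟨r * d₁, r * d₂, h1.const_smul r, h2.const_smul r, ?_, ?_⟩
      · simp only [Pi.smul_apply, smul_eq_mul]
        linear_combination r * h3
      · simp only [Pi.smul_apply, smul_eq_mul]
        linear_combination r * h4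

end PhotonicBands

end

open PhotonicBands

open Filter Topology MeasureTheory Set

noncomputable section

namespace PhotonicBands

/-! ### Compact positive operators -/

section CompactPositive

variable {H : Type*} [NormedAddCommGroup H] [InnerProductSpace ℂ H]

/-! Every eigenproblem is brought to a weak form with hermitian forms `Q k` whose diagonal is p_k(x)
+ k² m(x). Here p_k = P₀ + k P₁ + k² d is nonnegative for every real k, d ≤ C m, and m(x) ≥ v₂ ‖x‖²,
where c √v₂ is the asserted slope (`IsQuadraticPencil`). Let λ_n(k) = ω_n(k)²/c² be the ordered
eigenvalues.

Phase slope: m ≥ v₂ gives λ_n ≥ k² v₂. Trial spaces of every dimension, concentrated where m is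
nearly v₂, have energy at most C + k² (v₂ + ε) with C independent of k. By min-max, λ_n / k² tends
to v₂.

Existence of one-sided derivatives: by Ky Fan's inequality (`sum_le_trace`) the sum of the lowest n
eigenvalues is a minimum over orthonormal systems of quadratic polynomials in k with bounded leading
coefficients. Up to a multiple of k² it is concave, so λ_n is a difference of concave functions plus
a smooth one. A function with one-sided derivatives everywhere has only countably many kinks.

Group slope: since k ↦ p_k(x) is a nonnegative quadratic polynomial, its derivative is at most (N/k)
p_k + (k/N) C m in absolute value (`abs_deriv_le`). This compares `Q l` with `Q k` on the whole
space, and min-max carries the comparison to ordered eigenvalues; no eigenvector is differentiated,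
so crossings do no harm. In the limit l → k, the derivative of √λ_n differs from √λ_n / k by at most
(1 + N) τ + (C/N) √λ_n / k, where τ → 0 because λ_n / k² → v₂. Letting k → ∞ and then N → ∞ gives
the slope.

Realizations: for an abstract K the form lives on the domain of K, and the Fredholm alternative
supplies the compact solution operator. The differential operators reduce, after multiplication by a
phase and by w, to D_k a D_k + k² β = μ r with D_k = -i d/dx + γ₀ + k γ on periodic functions. The
periodic Sobolev space is parametrized by L² of the circle through the compact inverse of -i d/dx +
π/L. The even modes fit after completing the square, which turns εzz/Δ into 1/εxx. Their trial
functions carry a phase that removes k γ on the support of a bump, so the bound on the remaining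
energy does not depend on k. -/

open Module.End in
/-- The norm of a nonzero compact positive operator is an eigenvalue. -/
theorem exists_norm_eigenvector [CompleteSpace H] {C : H →L[ℂ] H} (hC : IsCompactOperator C)
    (hsymm : C.IsSymmetric) (hpos : ∀ h, 0 ≤ (inner ℂ (C h) h).re) (h0 : C ≠ 0) :
    ∃ φ : H, ‖φ‖ = 1 ∧ C φ = (‖C‖ : ℂ) • φ := by
  have hn : 0 < ‖C‖ := norm_pos_iff.2 h0
  have hne : ((‖C‖ : ℝ) : ℂ) ≠ 0 := by exact_mod_cast hn.ne'
  have : Nontrivial H := by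
    by_contra h
    rw [not_nontrivial_iff_subsingleton] at h
    exact h0 (ContinuousLinearMap.ext fun x => Subsingleton.elim _ _)
  -- If the norm were in the resolvent set, all Rayleigh quotients would stay below `‖C‖ - ε`. By
  -- positivity the same holds for their absolute values, whose supremum is the norm.
  have hspec : ((‖C‖ : ℝ) : ℂ) ∈ spectrum ℂ C := by
    by_contra hcon
    have hcon' : algebraMap ℝ ℂ ‖C‖ ∈ resolventSet ℂ C := by
      simpa [spectrum] using hcon
    obtain ⟨ε, hε, h⟩ := C.rayleighQuotient_le_of_norm_mem_resolventSet hcon'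
    have h1 := C.norm_eq_iSup_rayleighQuotient hsymm
    have h2 : ∀ x, |C.rayleighQuotient x| ≤ ‖C‖ - ε := fun x => by
      rw [abs_of_nonneg]
      · exact h x
      · rw [ContinuousLinearMap.rayleighQuotient, ContinuousLinearMap.reApplyInnerSelf_apply]
        exact div_nonneg (hpos x) (by positivity)
    have h3 := ciSup_le h2
    linarith
  obtain ⟨v, hv⟩ := ((hC.hasEigenvalue_iff_mem_spectrum hne).2 hspec).exists_hasEigenvector
  have hv0 : ‖v‖ ≠ 0 := norm_ne_zero_iff.2 hv.2
  refine ⟨((‖v‖⁻¹ : ℝ) : ℂ) • v, ?_, ?_⟩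
  · rw [norm_smul]
    simp [hv0]
  · rw [map_smul, smul_comm]
    congr 1
    exact hv.apply_eq_smul

/-- On the orthogonal complement of an invariant subspace a compact positive operator attains the
maximum of its Rayleigh quotient at an eigenvector. -/
theorem exists_top_eigenvector_orthogonal [CompleteSpace H] {C : H →L[ℂ] H} (hC : IsCompactOperator C)
    (hsymm : C.IsSymmetric) (hpos : ∀ h, 0 ≤ (inner ℂ (C h) h).re) (F : Submodule ℂ H)
    (hinv : ∀ x ∈ F, C x ∈ F) (hne : ∃ h ∈ Fᗮ, C h ≠ 0) :
    ∃ (φ : H) (σ : ℝ), φ ∈ Fᗮ ∧ ‖φ‖ = 1 ∧ 0 < σ ∧ C φ = (σ : ℂ) • φ ∧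
      ∀ h ∈ Fᗮ, (inner ℂ (C h) h).re ≤ σ * ‖h‖ ^ 2 := by
  have hinv' : ∀ x ∈ Fᗮ, C x ∈ Fᗮ := fun x hx y hy => by
    rw [← ContinuousLinearMap.coe_coe C, ← hsymm]
    exact hx _ (hinv y hy)
  let S : Fᗮ →L[ℂ] Fᗮ := C.restrict hinv'
  have hSapp : ∀ x : Fᗮ, ((S x : Fᗮ) : H) = C x := fun x => rfl
  have hS : IsCompactOperator S := hC.restrict' hinv'
  have hSs : S.IsSymmetric := hsymm.restrict_invariant hinv'
  have hSp : ∀ h, 0 ≤ (inner ℂ (S h) h).re := fun h => hpos h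
  have hS0 : S ≠ 0 := by
    obtain ⟨h, hh, hh0⟩ := hne
    intro hz
    apply hh0
    have : S ⟨h, hh⟩ = 0 := by rw [hz]; rfl
    exact congrArg Subtype.val this
  have hSn : 0 < ‖S‖ := by
    rcases (norm_nonneg S).eq_or_lt with h | h
    · exact absurd (S.opNorm_zero_iff.1 h.symm) hS0
    · exact h
  obtain ⟨φ, h1, h2⟩ := exists_norm_eigenvector hS hSs hSp hS0
  refine ⟨φ, ‖S‖, φ.2, h1, hSn, ?_, fun h hh => ?_⟩
  · rw [← hSapp, h2]; rfl
  · have h3 : (inner ℂ (S ⟨h, hh⟩) (⟨h, hh⟩ : Fᗮ)).re ≤ ‖S ⟨h, hh⟩‖ * ‖(⟨h, hh⟩ : Fᗮ)‖ :=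
      (Complex.re_le_norm _).trans (norm_inner_le_norm _ _)
    have h4 := S.le_opNorm ⟨h, hh⟩
    have h5 : ‖(⟨h, hh⟩ : Fᗮ)‖ = ‖h‖ := rfl
    have h6 : (inner ℂ (C h) h).re = (inner ℂ (S ⟨h, hh⟩) (⟨h, hh⟩ : Fᗮ)).re := rfl
    rw [h6]
    rw [h5] at h3 h4
    nlinarith [norm_nonneg h]

/-- A compact operator cannot have infinitely many orthonormal eigenvectors with eigenvalues
bounded away from zero. -/
theorem tendsto_zero_of_orthonormal_eigenvectors {C : H →L[ℂ] H} (hC : IsCompactOperator C)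
    {φ : ℕ → H} {σ : ℕ → ℝ} (hφ : Orthonormal ℂ φ) (hσ : ∀ n, C (φ n) = (σ n : ℂ) • φ n)
    (hpos : ∀ n, 0 < σ n) (hanti : Antitone σ) : Tendsto σ atTop (𝓝 0) := by
  have hbdd : BddBelow (range σ) := ⟨0, by rintro _ ⟨n, rfl⟩; exact (hpos n).le⟩
  have hlim := tendsto_atTop_ciInf hanti hbdd
  set l := ⨅ n, σ n with hl
  have hl0 : 0 ≤ l := le_ciInf fun n => (hpos n).le
  rcases hl0.eq_or_lt with h | h
  · rwa [← h] at hlim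
  exfalso
  have hge : ∀ n, l ≤ σ n := fun n => ciInf_le hbdd n
  obtain ⟨K, hK, hK'⟩ := hC.image_closedBall_subset_compact 1
  obtain ⟨y, -, ψ, hψ, hψy⟩ := hK.tendsto_subseq
    (x := fun n => C (φ n)) (fun n => hK' ⟨φ n, by simp [hφ.1 n], rfl⟩)
  have hc := hψy.cauchySeq
  rw [Metric.cauchySeq_iff'] at hc
  obtain ⟨N, hN⟩ := hc l h
  have h1 := hN (N + 1) (Nat.le_succ N)
  have hne : ψ (N + 1) ≠ ψ N := (hψ (Nat.lt_succ_self N)).ne'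
  simp only [Function.comp, dist_eq_norm, hσ] at h1
  -- By orthogonality, images of distinct eigenvectors are at distance at least √2 `l`, so no
  -- subsequence is Cauchy at scale `l`.
  have h2 : ‖(σ (ψ (N + 1)) : ℂ) • φ (ψ (N + 1)) - (σ (ψ N) : ℂ) • φ (ψ N)‖ ^ 2 =
      σ (ψ (N + 1)) ^ 2 + σ (ψ N) ^ 2 := by
    rw [@norm_sub_sq ℂ, inner_smul_left, inner_smul_right, hφ.2 hne, norm_smul, norm_smul,
      hφ.1, hφ.1]
    simp
  have h3 := hge (ψ (N + 1))
  have h4 := norm_nonneg ((σ (ψ (N + 1)) : ℂ) • φ (ψ (N + 1)) - (σ (ψ N) : ℂ) • φ (ψ N))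
  nlinarith [sq_nonneg (σ (ψ N))]

/-- The eigenvalues of a compact positive operator of infinite rank, in decreasing order, with
their variational characterization. -/
theorem exists_antitone_eigensequence [CompleteSpace H] {C : H →L[ℂ] H} (hC : IsCompactOperator C)
    (hsymm : C.IsSymmetric) (hpos : ∀ h, 0 ≤ (inner ℂ (C h) h).re)
    (hinf : ∀ F : Submodule ℂ H, FiniteDimensional ℂ F → ∃ h ∈ Fᗮ, C h ≠ 0) :
    ∃ (φ : ℕ → H) (σ : ℕ → ℝ), Orthonormal ℂ φ ∧ (∀ n, 0 < σ n) ∧ Antitone σ ∧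
      (∀ n, C (φ n) = (σ n : ℂ) • φ n) ∧
      (∀ n h, (∀ m < n, inner ℂ (φ m) h = 0) → (inner ℂ (C h) h).re ≤ σ n * ‖h‖ ^ 2) ∧
      Tendsto σ atTop (𝓝 0) := by
  -- The hypotheses on `F` stand inside the existential so that `choose` yields total functions; the
  -- pair (0, 0) is a default for other subspaces.
  have hstep : ∀ F : Submodule ℂ H, ∃ (φ : H) (σ : ℝ), FiniteDimensional ℂ F →
      (∀ x ∈ F, C x ∈ F) → φ ∈ Fᗮ ∧ ‖φ‖ = 1 ∧ 0 < σ ∧ C φ = (σ : ℂ) • φ ∧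
      ∀ h ∈ Fᗮ, (inner ℂ (C h) h).re ≤ σ * ‖h‖ ^ 2 := fun F => by
    by_cases h : FiniteDimensional ℂ F ∧ ∀ x ∈ F, C x ∈ F
    · obtain ⟨φ, σ, h'⟩ := exists_top_eigenvector_orthogonal hC hsymm hpos F h.2 (hinf F h.1)
      exact ⟨φ, σ, fun _ _ => h'⟩
    · exact ⟨0, 0, fun h1 h2 => absurd ⟨h1, h2⟩ h⟩
  choose φ' σ' hstep using hstep
  -- `F n` is the span of the first `n` eigenvectors; the next one maximizes the Rayleigh quotient
  -- on its orthogonal complement.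
  let F : ℕ → Submodule ℂ H := fun n => Nat.rec ⊥ (fun _ G => G ⊔ Submodule.span ℂ {φ' G}) n
  have hFs : ∀ n, F (n + 1) = F n ⊔ Submodule.span ℂ {φ' (F n)} := fun n => rfl
  have hFg : ∀ n, (F n).FG := fun n => by
    induction n with
    | zero => exact Submodule.fg_bot
    | succ n ih => rw [hFs]; exact ih.sup (Submodule.fg_span_singleton _)
  have hFd := fun n => Module.Finite.iff_fg.2 (hFg n)
  have hFi : ∀ n, ∀ x ∈ F n, C x ∈ F n := fun n => by
    induction n with
    | zero =>
      intro x hx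
      have hx0 : x = 0 := (Submodule.mem_bot ℂ).1 hx
      rw [hx0, map_zero]
      exact Submodule.zero_mem _
    | succ n ih =>
      intro x hx
      rw [hFs, Submodule.mem_sup] at hx ⊢
      obtain ⟨y, hy, z, hz, rfl⟩ := hx
      obtain ⟨c, rfl⟩ := Submodule.mem_span_singleton.1 hz
      refine ⟨C y, ih y hy, C (c • φ' (F n)), ?_, (map_add _ _ _).symm⟩
      rw [map_smul, (hstep (F n) (hFd n) ih).2.2.2.1, smul_smul]
      exact Submodule.mem_span_singleton.2 ⟨_, rfl⟩
  have key := fun n => hstep (F n) (hFd n) (hFi n)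
  have hFm : Monotone F := monotone_nat_of_le_succ fun n => by rw [hFs]; exact le_sup_left
  have hmem : ∀ n, φ' (F n) ∈ F (n + 1) := fun n => by
    rw [hFs]
    exact Submodule.mem_sup_right (Submodule.mem_span_singleton_self _)
  have horth : ∀ m n, m < n → inner ℂ (φ' (F m)) (φ' (F n)) = 0 := fun m n hmn =>
    (key n).1 _ (hFm (Nat.succ_le_of_lt hmn) (hmem m))
  have hperp : ∀ n h, (∀ m < n, inner ℂ (φ' (F m)) h = 0) → h ∈ (F n)ᗮ := fun n => by
    induction n with
    | zero => intro h _ x hx; rw [(Submodule.mem_bot ℂ).1 hx, inner_zero_left]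
    | succ n ih =>
      intro h hh x hx
      rw [hFs, Submodule.mem_sup] at hx
      obtain ⟨y, hy, z, hz, rfl⟩ := hx
      obtain ⟨c, rfl⟩ := Submodule.mem_span_singleton.1 hz
      rw [inner_add_left, inner_smul_left, hh n (Nat.lt_succ_self n),
        ih h (fun m hm => hh m (hm.trans (Nat.lt_succ_self n))) y hy]
      simp
  have hon : Orthonormal ℂ fun n => φ' (F n) := by
    refine ⟨fun n => (key n).2.1, fun m n hmn => ?_⟩
    rcases lt_or_gt_of_ne hmn with h | h
    · exact horth m n h
    · rw [← inner_conj_symm, horth n m h, map_zero]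
  -- The eigenvector of step n + 1 is also a competitor in the maximization of step n.
  have hanti : Antitone fun n => σ' (F n) := antitone_nat_of_succ_le fun n => by
    have h1 := (key n).2.2.2.2 (φ' (F (n + 1)))
      (Submodule.orthogonal_le (hFm (Nat.le_succ n)) (key (n + 1)).1)
    rw [(key (n + 1)).2.2.2.1, inner_smul_left, inner_self_eq_norm_sq_to_K,
      (key (n + 1)).2.1] at h1
    simpa using h1
  exact ⟨fun n => φ' (F n), fun n => σ' (F n), hon, fun n => (key n).2.2.1, hanti,
    fun n => (key n).2.2.2.1, fun n h hh => (key n).2.2.2.2 h (hperp n h hh),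
    tendsto_zero_of_orthonormal_eigenvectors hC hon (fun n => (key n).2.2.2.1)
      (fun n => (key n).2.2.1) hanti⟩

end CompactPositive

/-! ### Spectral sequences of hermitian forms -/

section Forms

variable {H : Type*} [NormedAddCommGroup H] [InnerProductSpace ℂ H]
  {D : Type} [AddCommGroup D] [Module ℂ D]

/-- A nonnegative hermitian form `Q` on `D`, with `D` embedded by `ι` into a Hilbert space, such
that the equation `Q(u, y) + ⟨u, y⟩ = ⟨h, y⟩` is solved by a compact operator `h ↦ u`. -/
structure IsDiscreteForm (ι : D →ₗ[ℂ] H) (Q : D →ₗ⋆[ℂ] D →ₗ[ℂ] ℂ) : Prop where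
  injective : Function.Injective ι
  hermitian : ∀ x y, starRingEnd ℂ (Q x y) = Q y x
  nonneg : ∀ x, 0 ≤ (Q x x).re
  solvable : ∃ (C : H →L[ℂ] H) (G : H → D), IsCompactOperator C ∧ (∀ h, ι (G h) = C h) ∧
    ∀ h y, Q (G h) y + inner ℂ (ι (G h)) (ι y) = inner ℂ h (ι y)

/-- Solutions `x` of `Q(x, y) = μ ⟨x, y⟩` for all `y`. -/
def formEigenspace (ι : D →ₗ[ℂ] H) (Q : D →ₗ⋆[ℂ] D →ₗ[ℂ] ℂ) (μ : ℝ) : Submodule ℂ D where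
  carrier := {x | ∀ y, Q x y = μ * inner ℂ (ι x) (ι y)}
  zero_mem' := fun y => by simp
  add_mem' := fun {a b} ha hb y => by
    rw [map_add, LinearMap.add_apply, ha y, hb y, map_add, inner_add_left, mul_add]
  smul_mem' := fun c a ha y => by
    rw [LinearMap.map_smulₛₗ, LinearMap.smul_apply, ha y, map_smul, inner_smul_left, smul_eq_mul]
    ring

/-- Eigenvectors `e n` and eigenvalues `lam n`, in increasing order, of a hermitian form, with the
variational lower bound. -/
structure IsSpectralSequence (ι : D →ₗ[ℂ] H) (Q : D →ₗ⋆[ℂ] D →ₗ[ℂ] ℂ) (lam : ℕ → ℝ)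
    (e : ℕ → D) : Prop where
  mono : Monotone lam
  orthonormal : Orthonormal ℂ fun n => ι (e n)
  eigen : ∀ n y, Q (e n) y = lam n * inner ℂ (ι (e n)) (ι y)
  lower : ∀ n y, (∀ m < n, inner ℂ (ι (e m)) (ι y) = 0) → lam n * ‖ι y‖ ^ 2 ≤ (Q y y).re
  tendsto : Tendsto lam atTop atTop

/-- The solution operator `C` plays the role of (Q + 1)⁻¹: it is compact, symmetric and positive,
and its eigenvalue σ corresponds to the eigenvalue σ⁻¹ - 1 of the form. Since `D` need not be
complete, the variational lower bound is derived algebraically from that of `C`. -/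
theorem IsDiscreteForm.exists_spectralSequence [CompleteSpace H] {ι : D →ₗ[ℂ] H}
    {Q : D →ₗ⋆[ℂ] D →ₗ[ℂ] ℂ} (hQ : IsDiscreteForm ι Q) (hD : ¬ FiniteDimensional ℂ D) :
    ∃ lam e, IsSpectralSequence ι Q lam e := by
  obtain ⟨C, G, hC, hG, hsol⟩ := hQ.solvable
  have hconj : ∀ h h', inner ℂ (C h) h' = starRingEnd ℂ (inner ℂ h' (C h)) :=
    fun h h' => (inner_conj_symm _ _).symm
  have hCin : ∀ h h', inner ℂ h (C h') = Q (G h) (G h') + inner ℂ (C h) (C h') := fun h h' => by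
    rw [← hG h', ← hG h, hsol]
  have hsymm : C.IsSymmetric := fun h h' => by
    change inner ℂ (C h) h' = inner ℂ h (C h')
    rw [hconj, hCin h' h, hCin h h', map_add, hQ.hermitian, inner_conj_symm]
  have hpos : ∀ h, 0 ≤ (inner ℂ (C h) h).re := fun h => by
    rw [hconj, Complex.conj_re, hCin, Complex.add_re]
    exact add_nonneg (hQ.nonneg _) (inner_self_nonneg (𝕜 := ℂ))
  -- If `C` vanished on the complement of a finite-dimensional `F`, the range of `ι` would be
  -- orthogonal to `Fᗮ`, hence inside `F`, and `D` would be finite-dimensional.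
  have hinf : ∀ F : Submodule ℂ H, FiniteDimensional ℂ F → ∃ h ∈ Fᗮ, C h ≠ 0 := by
    intro F hF
    by_contra! hcon
    apply hD
    have hr : ∀ y, ι y ∈ F := fun y => by
      rw [← F.orthogonal_orthogonal]
      intro h hh
      have h0 : G h = 0 := hQ.injective (by rw [hG, hcon h hh, map_zero])
      rw [← hsol, h0]
      simp
    exact FiniteDimensional.of_injective (ι.codRestrict F hr)
      fun x y hxy => hQ.injective (congrArg Subtype.val hxy)
  obtain ⟨φ, σ, hφ, hσ, hanti, heig, hup, hlim⟩ := exists_antitone_eigensequence hC hsymm hpos hinf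
  have hσ' : ∀ n, (σ n : ℂ) ≠ 0 := fun n => by exact_mod_cast (hσ n).ne'
  let e : ℕ → D := fun n => ((σ n)⁻¹ : ℂ) • G (φ n)
  have he : ∀ n, ι (e n) = φ n := fun n => by
    simp only [e]
    rw [map_smul, hG, heig, smul_smul, inv_mul_cancel₀ (hσ' n), one_smul]
  refine ⟨fun n => (σ n)⁻¹ - 1, e, ?_, ?_, ?_, ?_, ?_⟩
  · intro m n hmn
    have := (inv_le_inv₀ (hσ m) (hσ n)).2 (hanti hmn)
    simpa using this
  · simpa only [he] using hφ
  · intro n y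
    have h1 := hsol (φ n) y
    rw [hG, heig, inner_smul_left, Complex.conj_ofReal] at h1
    rw [he]
    simp only [e]
    rw [LinearMap.map_smulₛₗ, LinearMap.smul_apply, smul_eq_mul, eq_sub_of_add_eq h1]
    have := hσ' n
    simp only [map_inv₀, Complex.conj_ofReal]
    push_cast
    field_simp
  · intro n y hy
    simp only [he] at hy
    set h := ι y with hh
    have h1 := hup n h hy
    set t : ℝ := (σ n)⁻¹ with ht
    -- The form Q + 1 is nonnegative at y - t G(ι y) with t = 1/σ_n. Expanding with the equation for
    -- `G` and inserting ⟨C h, h⟩ ≤ σ_n ‖h‖² leaves Q(y, y) ≥ (t - 1) ‖h‖². The summand ‖·‖² enters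
    -- through `h13`.
    have h2 := hQ.nonneg (y - (t : ℂ) • G h)
    have h3 : Q (G h) y = inner ℂ h h - inner ℂ (C h) h := by
      rw [← hG]; exact eq_sub_of_add_eq (hsol h y)
    have h4 : Q y (G h) = starRingEnd ℂ (inner ℂ h h - inner ℂ (C h) h) := by
      rw [← h3, hQ.hermitian]
    have h5 : Q (G h) (G h) = inner ℂ h (C h) - inner ℂ (C h) (C h) := by rw [hCin]; ring
    have h9 : (inner ℂ h (C h)).re = (inner ℂ (C h) h).re := by
      rw [← inner_conj_symm, Complex.conj_re]
    have h6 : ‖h - (t : ℂ) • C h‖ ^ 2 =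
        ‖h‖ ^ 2 - 2 * t * (inner ℂ (C h) h).re + t ^ 2 * ‖C h‖ ^ 2 := by
      rw [@norm_sub_sq ℂ, inner_smul_right, norm_smul, mul_pow, Complex.norm_real,
        Real.norm_eq_abs, sq_abs]
      simp [h9]
      ring
    have h7 : inner ℂ h h = ((‖h‖ ^ 2 : ℝ) : ℂ) := by
      rw [inner_self_eq_norm_sq_to_K]; norm_cast
    have h8 : inner ℂ (C h) (C h) = ((‖C h‖ ^ 2 : ℝ) : ℂ) := by
      rw [inner_self_eq_norm_sq_to_K]; norm_cast
    simp only [map_sub, LinearMap.sub_apply, LinearMap.map_smulₛₗ, LinearMap.smul_apply, map_smul,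
      smul_eq_mul, Complex.conj_ofReal, h3, h4, h5, h7, h8, Complex.sub_re, Complex.re_ofReal_mul,
      Complex.ofReal_re, Complex.conj_re, h9] at h2
    have h10 : σ n * t = 1 := mul_inv_cancel₀ (hσ n).ne'
    have h11 : 0 < t := inv_pos.2 (hσ n)
    have h12 : t ^ 2 * (inner ℂ (C h) h).re ≤ t * ‖h‖ ^ 2 := by
      calc t ^ 2 * (inner ℂ (C h) h).re ≤ t ^ 2 * (σ n * ‖h‖ ^ 2) := by gcongr
        _ = (σ n * t) * t * ‖h‖ ^ 2 := by ring
        _ = t * ‖h‖ ^ 2 := by rw [h10, one_mul]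
    have h13 := sq_nonneg ‖h - (t : ℂ) • C h‖
    nlinarith
  · refine tendsto_atTop_add_const_right _ _ ?_
    exact (tendsto_nhdsWithin_iff.2 ⟨hlim, Eventually.of_forall hσ⟩).inv_tendsto_nhdsGT_zero

end Forms

theorem inner_self_eq_ofReal_norm_sq {H : Type*} [NormedAddCommGroup H] [InnerProductSpace ℂ H]
    (x : H) : inner ℂ x x = ((‖x‖ ^ 2 : ℝ) : ℂ) := by
  rw [inner_self_eq_norm_sq_to_K]
  norm_cast

/-! ### Eigenspaces, min-max and trace inequalities for a spectral sequence -/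

section Forms

variable {H : Type*} [NormedAddCommGroup H] [InnerProductSpace ℂ H]
  {D : Type} [AddCommGroup D] [Module ℂ D]

namespace IsSpectralSequence

variable {ι : D →ₗ[ℂ] H} {Q : D →ₗ⋆[ℂ] D →ₗ[ℂ] ℂ} {lam : ℕ → ℝ} {e : ℕ → D}

theorem linearIndependent (hS : IsSpectralSequence ι Q lam e) : LinearIndependent ℂ e :=
  LinearIndependent.of_comp ι hS.orthonormal.linearIndependent

theorem inner_eq_zero_of_mem_formEigenspace (hS : IsSpectralSequence ι Q lam e)
    (hQ : IsDiscreteForm ι Q) {μ : ℝ} {x : D} (hx : x ∈ formEigenspace ι Q μ) {n : ℕ}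
    (hn : lam n ≠ μ) : inner ℂ (ι (e n)) (ι x) = 0 := by
  have h1 := hS.eigen n x
  have h2 := hx (e n)
  rw [← hQ.hermitian, h2, map_mul, Complex.conj_ofReal, inner_conj_symm] at h1
  have h3 : ((lam n : ℂ) - μ) * inner ℂ (ι (e n)) (ι x) = 0 := by linear_combination -h1
  refine (mul_eq_zero.1 h3).resolve_left fun h => hn ?_
  exact_mod_cast sub_eq_zero.1 h

/-- Only finitely many `lam n` equal `μ`. Subtracting the projection onto their eigenvectors leaves
an element of the eigenspace orthogonal to every `e n`. The variational bound at an index with `lam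
N > μ` forces it to vanish, which gives completeness without an expansion theorem. -/
theorem formEigenspace_eq_span (hS : IsSpectralSequence ι Q lam e) (hQ : IsDiscreteForm ι Q)
    (μ : ℝ) :
    formEigenspace ι Q μ = Submodule.span ℂ (range fun n : {n : ℕ // lam n = μ} => e n) := by
  have hmem : ∀ n, lam n = μ → e n ∈ formEigenspace ι Q μ := fun n hn y => by
    rw [hS.eigen, hn]
  apply le_antisymm
  · intro x hx
    obtain ⟨N, hN⟩ := (hS.tendsto.eventually_gt_atTop μ).exists_forall_of_atTop
    classical
    let s : Finset ℕ := (Finset.range N).filter fun n => lam n = μ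
    have hs : ∀ n, lam n = μ → n ∈ s := fun n hn => by
      rw [Finset.mem_filter, Finset.mem_range]
      refine ⟨?_, hn⟩
      by_contra h
      exact (hN n (not_lt.1 h)).ne' hn
    let p : D := ∑ n ∈ s, inner ℂ (ι (e n)) (ι x) • e n
    have hp : p ∈ Submodule.span ℂ (range fun n : {n : ℕ // lam n = μ} => e n) :=
      Submodule.sum_mem _ fun n hn => Submodule.smul_mem _ _
        (Submodule.subset_span ⟨⟨n, (Finset.mem_filter.1 hn).2⟩, rfl⟩)
    have hz : x - p ∈ formEigenspace ι Q μ := Submodule.sub_mem _ hx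
      (Submodule.sum_mem _ fun n hn => Submodule.smul_mem _ _
        (hmem n (Finset.mem_filter.1 hn).2))
    have horth : ∀ n, inner ℂ (ι (e n)) (ι (x - p)) = 0 := fun n => by
      by_cases hn : lam n = μ
      · have h1 : ι p = ∑ m ∈ s, inner ℂ (ι (e m)) (ι x) • ι (e m) := by
          simp only [p, map_sum, map_smul]
        rw [map_sub, inner_sub_right, h1, hS.orthonormal.inner_right_sum _ (hs n hn), sub_self]
      · exact hS.inner_eq_zero_of_mem_formEigenspace hQ hz hn
    have h0 : x - p = 0 := by
      by_contra hne
      have h1 : 0 < ‖ι (x - p)‖ ^ 2 := by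
        have : ι (x - p) ≠ 0 := fun h => hne (hQ.injective (by rw [h, map_zero]))
        positivity
      have h2 := hS.lower N (x - p) fun m _ => horth m
      rw [hz, inner_self_eq_norm_sq_to_K] at h2
      have h3 : ((μ : ℂ) * ((‖ι (x - p)‖ : ℝ) : ℂ) ^ 2).re = μ * ‖ι (x - p)‖ ^ 2 := by
        norm_cast
      have h4 := hN N le_rfl
      have h5 : lam N * ‖ι (x - p)‖ ^ 2 ≤ μ * ‖ι (x - p)‖ ^ 2 := h2.trans_eq h3
      nlinarith
    rw [sub_eq_zero.1 h0]
    exact hp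
  · rw [Submodule.span_le]
    rintro _ ⟨n, rfl⟩
    exact hmem n n.2

theorem rank_formEigenspace (hS : IsSpectralSequence ι Q lam e) (hQ : IsDiscreteForm ι Q)
    (μ : ℝ) : Module.rank ℂ (formEigenspace ι Q μ) = Cardinal.mk {n : ℕ // lam n = μ} := by
  have hli : LinearIndependent ℂ fun n : {n : ℕ // lam n = μ} => e n :=
    hS.linearIndependent.comp _ Subtype.val_injective
  rw [hS.formEigenspace_eq_span hQ, rank_span hli, Cardinal.mk_range_eq _ hli.injective]

/-- The upper half of the min-max principle. -/
theorem le_of_trial (hS : IsSpectralSequence ι Q lam e) (hι : Function.Injective ι) {n : ℕ}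
    (J : (Fin (n + 1) → ℂ) →ₗ[ℂ] D) (hJ : Function.Injective J) {B : ℝ}
    (hB : ∀ c, (Q (J c) (J c)).re ≤ B * ‖ι (J c)‖ ^ 2) : lam n ≤ B := by
  let Φ : (Fin (n + 1) → ℂ) →ₗ[ℂ] (Fin n → ℂ) :=
    LinearMap.pi fun m => (innerₛₗ ℂ (ι (e m))).comp (ι.comp J)
  -- The n orthogonality conditions on an (n + 1)-dimensional space leave a nonzero trial vector.
  have hker : Φ.ker ≠ ⊥ := LinearMap.ker_ne_bot_of_finrank_lt (by simp)
  obtain ⟨c, hc, hc0⟩ := Submodule.exists_mem_ne_zero_of_ne_bot hker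
  have h1 : ∀ m < n, inner ℂ (ι (e m)) (ι (J c)) = 0 := fun m hm =>
    congrFun (LinearMap.mem_ker.1 hc) ⟨m, hm⟩
  have h2 := (hS.lower n _ h1).trans (hB c)
  have h3 : 0 < ‖ι (J c)‖ ^ 2 := by
    have : ι (J c) ≠ 0 := fun h => hc0 (hJ (hι (by rw [h, map_zero, map_zero])))
    positivity
  exact le_of_mul_le_mul_right h2 h3

theorem re_form_sum_le (hS : IsSpectralSequence ι Q lam e) (n : ℕ) (c : Fin (n + 1) → ℂ) :
    (Q (∑ i, c i • e i) (∑ i, c i • e i)).re ≤ lam n * ‖ι (∑ i, c i • e i)‖ ^ 2 := by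
  have hon : Orthonormal ℂ fun i : Fin (n + 1) => ι (e i) :=
    hS.orthonormal.comp _ Fin.val_injective
  have hι : ι (∑ i, c i • e i) = ∑ i, c i • ι (e i) := by simp only [map_sum, map_smul]
  have h1 : Q (∑ i, c i • e i) (∑ i, c i • e i) =
      ((∑ i : Fin (n + 1), lam i * ‖c i‖ ^ 2 : ℝ) : ℂ) := by
    rw [map_sum Q, LinearMap.sum_apply]
    push_cast
    refine Finset.sum_congr rfl fun i _ => ?_
    rw [LinearMap.map_smulₛₗ, LinearMap.smul_apply, hS.eigen, hι, hon.inner_right_fintype,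
      smul_eq_mul, ← Complex.conj_mul']
    ring
  have h2 : ‖ι (∑ i, c i • e i)‖ ^ 2 = ∑ i, ‖c i‖ ^ 2 := by
    have h3 : inner ℂ (∑ i, c i • ι (e i)) (∑ i, c i • ι (e i)) =
        ((∑ i, ‖c i‖ ^ 2 : ℝ) : ℂ) := by
      rw [hon.inner_sum]
      push_cast
      exact Finset.sum_congr rfl fun i _ => Complex.conj_mul' _
    rw [inner_self_eq_ofReal_norm_sq] at h3
    rw [hι]
    exact Complex.ofReal_injective h3
  rw [h1, Complex.ofReal_re, h2, Finset.mul_sum]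
  refine Finset.sum_le_sum fun i _ => ?_
  have := hS.mono (Nat.lt_succ_iff.1 i.2)
  gcongr

/-- Monotonicity of eigenvalues under affine comparison of forms. -/
theorem le_of_form_le {Q' : D →ₗ⋆[ℂ] D →ₗ[ℂ] ℂ} {lam' : ℕ → ℝ} {e' : ℕ → D}
    (hS : IsSpectralSequence ι Q lam e) (hS' : IsSpectralSequence ι Q' lam' e')
    (hι : Function.Injective ι) {α β : ℝ} (hα : 0 ≤ α)
    (h : ∀ x, (Q' x x).re ≤ α * (Q x x).re + β * ‖ι x‖ ^ 2) (n : ℕ) :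
    lam' n ≤ α * lam n + β := by
  let J : (Fin (n + 1) → ℂ) →ₗ[ℂ] D := Fintype.linearCombination ℂ fun i : Fin (n + 1) => e i
  have hJ : ∀ c, J c = ∑ i, c i • e i := fun c => Fintype.linearCombination_apply ℂ _ _
  refine hS'.le_of_trial hι J ?_ fun c => ?_
  · exact linearIndependent_iff_injective_fintypeLinearCombination.1
      (hS.linearIndependent.comp _ Fin.val_injective)
  · have h1 := h (J c)
    have h2 := hS.re_form_sum_le n c
    rw [← hJ] at h2
    nlinarith [mul_le_mul_of_nonneg_left h2 hα]

theorem le_of_le_form (hS : IsSpectralSequence ι Q lam e) {B : ℝ}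
    (h : ∀ x, B * ‖ι x‖ ^ 2 ≤ (Q x x).re) (n : ℕ) : B ≤ lam n := by
  have h1 := h (e n)
  rw [hS.eigen, inner_self_eq_norm_sq_to_K, hS.orthonormal.1 n] at h1
  simpa using h1

theorem form_self (hS : IsSpectralSequence ι Q lam e) (n : ℕ) :
    (Q (e n) (e n)).re = lam n := by
  rw [hS.eigen, inner_self_eq_norm_sq_to_K, hS.orthonormal.1 n]
  simp

/-- The component of `y` along the first n eigenvectors is orthogonal for the form as well as for
the inner product, so the variational bound applies to the rest. The weights `lam n - lam j` are
nonnegative, as needed for Ky Fan's inequality. -/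
theorem lower_of_projection (hS : IsSpectralSequence ι Q lam e)
    (hherm : ∀ x y, starRingEnd ℂ (Q x y) = Q y x) (n : ℕ) (y : D) :
    lam n * ‖ι y‖ ^ 2 - ∑ j ∈ Finset.range n, (lam n - lam j) * ‖inner ℂ (ι (e j)) (ι y)‖ ^ 2 ≤
      (Q y y).re := by
  set c : ℕ → ℂ := fun j => inner ℂ (ι (e j)) (ι y) with hc
  let p : D := ∑ j ∈ Finset.range n, c j • e j
  have hp : ι p = ∑ j ∈ Finset.range n, c j • ι (e j) := by simp only [p, map_sum, map_smul]
  have horth : ∀ m < n, inner ℂ (ι (e m)) (ι (y - p)) = 0 := fun m hm => by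
    rw [map_sub, inner_sub_right, hp,
      hS.orthonormal.inner_right_sum _ (Finset.mem_range.2 hm), sub_self]
  have horth' : ∀ m < n, inner ℂ (ι (y - p)) (ι (e m)) = 0 := fun m hm => by
    rw [← inner_conj_symm, horth m hm, map_zero]
  have hQe : ∀ m < n, Q (y - p) (e m) = 0 := fun m hm => by
    rw [← hherm, hS.eigen, horth m hm, mul_zero, map_zero]
  have h1 : Q (y - p) (y - p) =
      Q y y - ((∑ j ∈ Finset.range n, lam j * ‖c j‖ ^ 2 : ℝ) : ℂ) := by
    have h2 : Q (y - p) p = 0 := by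
      simp only [p, map_sum, map_smul]
      refine Finset.sum_eq_zero fun j hj => ?_
      rw [hQe j (Finset.mem_range.1 hj), smul_zero]
    rw [map_sub (Q (y - p)), h2, sub_zero, map_sub, LinearMap.sub_apply]
    congr 1
    simp only [p]
    rw [map_sum, LinearMap.sum_apply]
    push_cast
    refine Finset.sum_congr rfl fun j _ => ?_
    rw [LinearMap.map_smulₛₗ, LinearMap.smul_apply, hS.eigen, smul_eq_mul, ← Complex.conj_mul']
    simp only [hc]
    ring
  have h3 : ‖ι (y - p)‖ ^ 2 = ‖ι y‖ ^ 2 - ∑ j ∈ Finset.range n, ‖c j‖ ^ 2 := by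
    have h4 : inner ℂ (ι (y - p)) (ι p) = 0 := by
      rw [hp, inner_sum]
      refine Finset.sum_eq_zero fun j hj => ?_
      rw [inner_smul_right, horth' j (Finset.mem_range.1 hj), mul_zero]
    have h5 : inner ℂ (ι (y - p)) (ι (y - p)) =
        ((‖ι y‖ ^ 2 - ∑ j ∈ Finset.range n, ‖c j‖ ^ 2 : ℝ) : ℂ) := by
      conv_lhs => rw [map_sub ι y p, inner_sub_right, ← map_sub ι y p, h4, sub_zero,
        map_sub, inner_sub_left, inner_self_eq_norm_sq_to_K, hp, sum_inner]
      push_cast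
      congr 1
      refine Finset.sum_congr rfl fun j _ => ?_
      rw [inner_smul_left, ← Complex.conj_mul']
    rw [inner_self_eq_ofReal_norm_sq] at h5
    exact Complex.ofReal_injective h5
  have h6 := hS.lower n _ horth
  rw [h1, h3, Complex.sub_re, Complex.ofReal_re] at h6
  have h7 : ∑ j ∈ Finset.range n, (lam n - lam j) * ‖c j‖ ^ 2 =
      lam n * ∑ j ∈ Finset.range n, ‖c j‖ ^ 2 - ∑ j ∈ Finset.range n, lam j * ‖c j‖ ^ 2 := by
    rw [Finset.mul_sum, ← Finset.sum_sub_distrib]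
    exact Finset.sum_congr rfl fun j _ => by ring
  rw [h7]
  linarith

/-- Ky Fan's inequality: the sum of the lowest eigenvalues is a lower bound for the trace of the
form over orthonormal systems. -/
theorem sum_le_trace (hS : IsSpectralSequence ι Q lam e)
    (hherm : ∀ x y, starRingEnd ℂ (Q x y) = Q y x) {y : ℕ → D}
    (hy : Orthonormal ℂ fun i => ι (y i)) (n : ℕ) :
    ∑ j ∈ Finset.range n, lam j ≤ ∑ i ∈ Finset.range n, (Q (y i) (y i)).re := by
  have h1 : ∀ i, lam n - ∑ j ∈ Finset.range n, (lam n - lam j) *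
      ‖inner ℂ (ι (e j)) (ι (y i))‖ ^ 2 ≤ (Q (y i) (y i)).re := fun i => by
    have := hS.lower_of_projection hherm n (y i)
    rwa [hy.1 i, one_pow, mul_one] at this
  refine le_trans ?_ (Finset.sum_le_sum fun i _ => h1 i)
  rw [Finset.sum_sub_distrib, Finset.sum_comm, Finset.sum_const, Finset.card_range]
  -- Bessel's inequality for the system `y`, applied to the unit vector `ι (e j)`.
  have h2 : ∀ j ∈ Finset.range n, ∑ i ∈ Finset.range n, (lam n - lam j) *
      ‖inner ℂ (ι (e j)) (ι (y i))‖ ^ 2 ≤ lam n - lam j := fun j hj => by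
    rw [← Finset.mul_sum]
    have h3 := hy.sum_inner_products_le (ι (e j)) (s := Finset.range n)
    have h4 : ∑ i ∈ Finset.range n, ‖inner ℂ (ι (e j)) (ι (y i))‖ ^ 2 ≤ 1 := by
      simpa only [hS.orthonormal.1 j, one_pow, norm_inner_symm (ι (e j))] using h3
    have h5 : lam j ≤ lam n := hS.mono (Finset.mem_range.1 hj).le
    nlinarith
  have h6 := Finset.sum_le_sum h2
  rw [Finset.sum_sub_distrib, Finset.sum_const, Finset.card_range] at h6
  linarith

end IsSpectralSequence

end Forms

/-- A monotone real sequence is determined by the number of times it takes each value. -/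
theorem monotone_eq_of_multiplicity_eq {f g : ℕ → ℝ} (hf : Monotone f) (hg : Monotone g)
    (h : ∀ μ, Cardinal.mk {n : ℕ // f n = μ} = Cardinal.mk {n : ℕ // g n = μ}) : f = g := by
  -- At a first index n with f n < g n, monotonicity of g puts every index where g takes the value f
  -- n below n, where f and g agree. Then f takes this value at least once more, namely at n itself;
  -- finiteness makes the count contradictory.
  have key : ∀ {f g : ℕ → ℝ}, Monotone g →
      (∀ μ, Cardinal.mk {n : ℕ // f n = μ} = Cardinal.mk {n : ℕ // g n = μ}) →
      ∀ n, (∀ m < n, f m = g m) → ¬ f n < g n := by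
    intro f g hg h n ih hlt
    have hsub : {m | g m = f n} ⊆ {m | f m = f n ∧ m < n} := fun m hm => by
      have hmn : m < n := by
        by_contra hge
        have h1 := hg (not_lt.1 hge)
        rw [mem_ofPred_eq] at hm
        linarith
      exact ⟨(ih m hmn).trans hm, hmn⟩
    have hfin : {m | f m = f n ∧ m < n}.Finite := (finite_lt_nat n).subset fun m hm => hm.2
    have hgfin : {m | g m = f n}.Finite := hfin.subset hsub
    have hffin : {m | f m = f n}.Finite := by
      have h2 : Cardinal.mk {m : ℕ // f m = f n} < Cardinal.aleph0 := by
        rw [h]; exact Cardinal.lt_aleph0_iff_set_finite.2 hgfin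
      exact Cardinal.lt_aleph0_iff_set_finite.1 h2
    have hss : {m | g m = f n} ⊂ {m | f m = f n} :=
      ⟨fun m hm => (hsub hm).1, fun hcon => lt_irrefl n (hsub (hcon rfl)).2⟩
    have h3 := Set.ncard_lt_ncard hss hffin
    have h4 : Set.ncard {m | f m = f n} = Set.ncard {m | g m = f n} := congrArg Cardinal.toNat (h _)
    omega
  funext n
  induction n using Nat.strong_induction_on with
  | _ n ih =>
    exact le_antisymm (not_lt.1 (key hf (fun μ => (h μ).symm) n fun m hm => (ih m hm).symm))
      (not_lt.1 (key hg h n ih))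

/-! ### One-sided derivatives -/

/-- Each strict local minimum lies in an interval with rational endpoints on which it is the only
strict minimizer, and two such points cannot share an interval. -/
theorem countable_setOf_strictLocalMin (f : ℝ → ℝ) :
    {x : ℝ | ∀ᶠ y in 𝓝[≠] x, f x < f y}.Countable := by
  have h : ∀ x ∈ {x : ℝ | ∀ᶠ y in 𝓝[≠] x, f x < f y}, ∃ p : ℚ × ℚ, (p.1 : ℝ) < x ∧ x < p.2 ∧
      ∀ y : ℝ, p.1 < y → y < p.2 → y ≠ x → f x < f y := fun x hx => by
    obtain ⟨a, b, hab, hI⟩ := mem_nhds_iff_exists_Ioo_subset.1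
      (eventually_nhdsWithin_iff.1 hx : ∀ᶠ y in 𝓝 x, y ∈ ({x}ᶜ : Set ℝ) → f x < f y)
    obtain ⟨p, hp, hp'⟩ := exists_rat_btwn hab.1
    obtain ⟨q, hq, hq'⟩ := exists_rat_btwn hab.2
    exact ⟨(p, q), hp', hq, fun y h1 h2 h3 => hI ⟨hp.trans h1, h2.trans hq'⟩ h3⟩
  choose! g hg using h
  refine Set.MapsTo.countable_of_injOn (f := g) (mapsTo_univ _ _) ?_ countable_univ
  intro x hx y hy hxy
  by_contra hne
  have h1 := (hg x hx).2.2 y (by rw [hxy]; exact (hg y hy).1) (by rw [hxy]; exact (hg y hy).2.1)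
    (Ne.symm hne)
  have h2 := (hg y hy).2.2 x (by rw [← hxy]; exact (hg x hx).1)
    (by rw [← hxy]; exact (hg x hx).2.1) hne
  exact lt_asymm h1 h2

/-- For a rational p strictly between the two one-sided derivatives, the point is a strict local
minimum of f(x) - p x; there are countably many p. -/
theorem countable_setOf_leftDeriv_lt_rightDeriv {f r l : ℝ → ℝ} {s : Set ℝ}
    (h : ∀ k ∈ s, HasDerivWithinAt f (r k) (Ioi k) k ∧ HasDerivWithinAt f (l k) (Iio k) k) :
    {k | k ∈ s ∧ l k < r k}.Countable := by
  refine (countable_iUnion fun p : ℚ =>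
    countable_setOf_strictLocalMin fun x => f x - p * x).mono ?_
  rintro k ⟨hk, hlr⟩
  obtain ⟨p, hp1, hp2⟩ := exists_rat_btwn hlr
  refine mem_iUnion.2 ⟨p, ?_⟩
  have h1 := ((hasDerivWithinAt_iff_tendsto_slope' (by simp)).1 (h k hk).1).eventually
    (lt_mem_nhds hp2)
  have h2 := ((hasDerivWithinAt_iff_tendsto_slope' (by simp)).1 (h k hk).2).eventually
    (gt_mem_nhds hp1)
  change ∀ᶠ y in 𝓝[≠] k, f k - p * k < f y - p * y
  rw [← Iio_union_Ioi, nhdsWithin_union, eventually_sup]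
  constructor
  · filter_upwards [h2, self_mem_nhdsWithin] with y hy hyk
    rw [slope_def_field, div_lt_iff_of_neg (sub_neg.2 hyk)] at hy
    linarith
  · filter_upwards [h1, self_mem_nhdsWithin] with y hy hyk
    rw [slope_def_field, lt_div_iff₀ (sub_pos.2 hyk)] at hy
    linarith

theorem countable_setOf_not_differentiableAt {f r l : ℝ → ℝ} {s : Set ℝ}
    (h : ∀ k ∈ s, HasDerivWithinAt f (r k) (Ioi k) k ∧ HasDerivWithinAt f (l k) (Iio k) k) :
    {k | k ∈ s ∧ ¬ DifferentiableAt ℝ f k}.Countable := by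
  have h1 := countable_setOf_leftDeriv_lt_rightDeriv h
  have h2 := countable_setOf_leftDeriv_lt_rightDeriv (f := fun x => -f x) (r := fun x => -r x)
    (l := fun x => -l x) (s := s) fun k hk => ⟨(h k hk).1.neg, (h k hk).2.neg⟩
  refine (h1.union h2).mono ?_
  rintro k ⟨hk, hd⟩
  rcases lt_trichotomy (l k) (r k) with hlt | heq | hgt
  · exact Or.inl ⟨hk, hlt⟩
  · refine absurd ?_ hd
    have h3 := (h k hk).1
    have h4 := (h k hk).2
    rw [hasDerivWithinAt_iff_tendsto_slope' (by simp)] at h3 h4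
    rw [heq] at h4
    exact (hasDerivAt_iff_tendsto_slope_left_right.2 ⟨h4, h3⟩).differentiableAt
  · exact Or.inr ⟨hk, neg_lt_neg hgt⟩

theorem HasAsymptoticSlope.of_one_sided {f r l : ℝ → ℝ} {v : ℝ}
    (phase : Tendsto (fun k => f k / k) atTop (𝓝 v))
    (h : ∀ k, 0 < k → HasDerivWithinAt f (r k) (Ioi k) k ∧ HasDerivWithinAt f (l k) (Iio k) k)
    (hr : Tendsto r atTop (𝓝 v)) (hl : Tendsto l atTop (𝓝 v)) : HasAsymptoticSlope f v where
  phase := phase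
  countable_kinks := countable_setOf_not_differentiableAt (s := Ioi 0) h
  group := by
    refine (hr.mono_left inf_le_left).congr' ?_
    rw [EventuallyEq, eventually_inf_principal]
    filter_upwards [eventually_gt_atTop 0] with k hk hd
    exact (uniqueDiffWithinAt_Ioi k).eq_deriv _ (h k hk).1 hd.hasDerivAt.hasDerivWithinAt
  one_sided := ⟨r, l, h, hr, hl⟩

/-- `Λ` is a difference of concave functions, up to a smooth function. -/
theorem exists_one_sided_deriv_of_concave {S₁ S₂ g Λ : ℝ → ℝ} (h₁ : ConcaveOn ℝ univ S₁)
    (h₂ : ConcaveOn ℝ univ S₂) (hg : Differentiable ℝ g) (hΛ : ∀ k, Λ k = S₁ k - S₂ k + g k)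
    (k : ℝ) : (∃ r, HasDerivWithinAt Λ r (Ioi k) k) ∧ ∃ l, HasDerivWithinAt Λ l (Iio k) k := by
  have hΛ' : Λ = fun k => S₁ k - S₂ k + g k := funext hΛ
  have hint : k ∈ interior (univ : Set ℝ) := by simp
  rw [hΛ']
  have c₁ := h₁.neg
  have c₂ := h₂.neg
  refine ⟨⟨_, (((c₁.hasDerivWithinAt_rightDeriv_of_mem_interior hint).neg.sub
    (c₂.hasDerivWithinAt_rightDeriv_of_mem_interior hint).neg).add
    (hg k).hasDerivAt.hasDerivWithinAt).congr (fun x _ => ?_) ?_⟩,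
    ⟨_, (((c₁.hasDerivWithinAt_leftDeriv_of_mem_interior hint).neg.sub
    (c₂.hasDerivWithinAt_leftDeriv_of_mem_interior hint).neg).add
    (hg k).hasDerivAt.hasDerivWithinAt).congr (fun x _ => ?_) ?_⟩⟩ <;> simp

/-- Bounds for difference quotients pass to one-sided derivatives. -/
theorem one_sided_deriv_le {Λ : ℝ → ℝ} {U : ℝ × ℝ × ℝ → ℝ} {k r l : ℝ}
    (hU : ContinuousAt U (k, k, Λ k))
    (h : ∀ᶠ p : ℝ × ℝ in 𝓝 (k, k), p.1 < p.2 →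
      Λ p.2 - Λ p.1 ≤ (p.2 - p.1) * U (p.1, p.2, Λ p.1))
    (hr : HasDerivWithinAt Λ r (Ioi k) k) (hl : HasDerivWithinAt Λ l (Iio k) k) :
    r ≤ U (k, k, Λ k) ∧ l ≤ U (k, k, Λ k) := by
  have hidr : Tendsto (fun y : ℝ => y) (𝓝[>] k) (𝓝 k) := tendsto_id.mono_left nhdsWithin_le_nhds
  have hidl : Tendsto (fun y : ℝ => y) (𝓝[<] k) (𝓝 k) := tendsto_id.mono_left nhdsWithin_le_nhds
  constructor
  · refine le_of_tendsto_of_tendsto ((hasDerivWithinAt_iff_tendsto_slope' (by simp)).1 hr)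
      (hU.tendsto.comp (tendsto_const_nhds.prodMk_nhds (hidr.prodMk_nhds tendsto_const_nhds))) ?_
    filter_upwards [(tendsto_const_nhds.prodMk_nhds hidr).eventually h, self_mem_nhdsWithin]
      with y hy hyk
    rw [slope_def_field, div_le_iff₀ (sub_pos.2 hyk), mul_comm]
    exact hy hyk
  -- From the left the base point of the difference quotient moves, so the value Λ y must converge
  -- to Λ k; left differentiability supplies this.
  · refine le_of_tendsto_of_tendsto ((hasDerivWithinAt_iff_tendsto_slope' (by simp)).1 hl)
      (hU.tendsto.comp (hidl.prodMk_nhds (tendsto_const_nhds.prodMk_nhds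
        hl.continuousWithinAt.tendsto))) ?_
    filter_upwards [(hidl.prodMk_nhds tendsto_const_nhds).eventually h, self_mem_nhdsWithin]
      with y hy hyk
    rw [slope_comm, slope_def_field, div_le_iff₀ (sub_pos.2 hyk), mul_comm]
    exact hy hyk

/-- For fixed N the bound tends to (C/N) v as k → ∞, and N is free to be taken large. The order of
the two limits is what makes the factor 1 + N in front of τ harmless. -/
theorem tendsto_of_forall_approx {g ρ τ : ℝ → ℝ} {C v : ℝ} (hC : 0 ≤ C)
    (hρ : Tendsto ρ atTop (𝓝 v)) (hτ : Tendsto τ atTop (𝓝 0))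
    (h : ∀ N > 0, ∀ k > 0, |g k - ρ k| ≤ (1 + N) * τ k + C / N * ρ k) :
    Tendsto g atTop (𝓝 v) := by
  have hdiff : Tendsto (fun k => g k - ρ k) atTop (𝓝 0) := by
    rw [Metric.tendsto_nhds]
    intro ε hε
    obtain ⟨N, hN, hNε⟩ : ∃ N > 0, C / N * v < ε := by
      refine ⟨C * |v| / ε * 2 + 1, by positivity, ?_⟩
      rw [div_mul_eq_mul_div, div_lt_iff₀ (by positivity)]
      have h1 : C * v ≤ C * |v| := mul_le_mul_of_nonneg_left (le_abs_self v) hC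
      have h2 : ε * (C * |v| / ε * 2 + 1) = 2 * (C * |v|) + ε := by field_simp
      rw [h2]
      have := mul_nonneg hC (abs_nonneg v)
      linarith
    have h3 : Tendsto (fun k => (1 + N) * τ k + C / N * ρ k) atTop (𝓝 ((1 + N) * 0 + C / N * v)) :=
      (hτ.const_mul _).add (hρ.const_mul _)
    rw [mul_zero, zero_add] at h3
    filter_upwards [h3.eventually (gt_mem_nhds hNε), eventually_gt_atTop 0] with k hk hk0
    rw [Real.dist_eq, sub_zero]
    exact (h N hN k hk0).trans_lt hk
  simpa using hdiff.add hρ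

/-! ### Quadratic pencils of forms -/

section Pencil

variable {H : Type*} [NormedAddCommGroup H] [InnerProductSpace ℂ H]
  {D : Type} [AddCommGroup D] [Module ℂ D]

/-- A family of hermitian forms `Q k`, whose diagonal is the sum of a nonnegative quadratic
polynomial `P₀ + k P₁ + k² d` and of `k² m`. The constant `v₂` is the infimum of `m`, and is
approached on subspaces of every dimension along which the form grows like `k² v₂`. -/
structure IsQuadraticPencil (ι : D →ₗ[ℂ] H) (Q : ℝ → D →ₗ⋆[ℂ] D →ₗ[ℂ] ℂ)
    (P₀ P₁ d m : D → ℝ) (v₂ : ℝ) : Prop where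
  discrete : ∀ k, IsDiscreteForm ι (Q k)
  re_eq : ∀ k x, (Q k x x).re = P₀ x + k * P₁ x + k ^ 2 * d x + k ^ 2 * m x
  nonneg : ∀ k x, 0 ≤ P₀ x + k * P₁ x + k ^ 2 * d x
  d_nonneg : ∀ x, 0 ≤ d x
  d_le : ∃ C, 0 ≤ C ∧ ∀ x, d x ≤ C * m x
  v_nonneg : 0 ≤ v₂
  le_m : ∀ x, v₂ * ‖ι x‖ ^ 2 ≤ m x
  m_pos : ∀ x, x ≠ 0 → 0 < m x
  bounded : ∃ C, ∀ x, d x + m x ≤ C * ‖ι x‖ ^ 2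
  trial : ∀ ε > 0, ∀ n : ℕ, ∃ C : ℝ, ∀ k > 0, ∃ J : (Fin (n + 1) → ℂ) →ₗ[ℂ] D,
    Function.Injective J ∧
      ∀ c, (Q k (J c) (J c)).re ≤ (C + k ^ 2 * (v₂ + ε)) * ‖ι (J c)‖ ^ 2

namespace IsQuadraticPencil

variable {ι : D →ₗ[ℂ] H} {Q : ℝ → D →ₗ⋆[ℂ] D →ₗ[ℂ] ℂ} {P₀ P₁ d m : D → ℝ} {v₂ : ℝ}
  {lam : ℝ → ℕ → ℝ} {e : ℝ → ℕ → D}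

theorem not_finiteDimensional (hP : IsQuadraticPencil ι Q P₀ P₁ d m v₂) :
    ¬ FiniteDimensional ℂ D := fun hfin => by
  obtain ⟨C, hC⟩ := hP.trial 1 one_pos (Module.finrank ℂ D)
  obtain ⟨J, hJ, -⟩ := hC 1 one_pos
  have := LinearMap.finrank_le_finrank_of_injective hJ
  rw [Module.finrank_fin_fun] at this
  omega

theorem exists_spectralSequence [CompleteSpace H] (hP : IsQuadraticPencil ι Q P₀ P₁ d m v₂) :
    ∃ (lam : ℝ → ℕ → ℝ) (e : ℝ → ℕ → D), ∀ k, IsSpectralSequence ι (Q k) (lam k) (e k) := by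
  choose lam e h using fun k => (hP.discrete k).exists_spectralSequence hP.not_finiteDimensional
  exact ⟨lam, e, h⟩

/-- For a fixed orthonormal system the trace of `Q k` minus n C k² is a quadratic polynomial in k
with nonpositive leading coefficient. By Ky Fan the sum of eigenvalues is the minimum of such
traces, and a minimum of concave functions is concave. The system used for the test consists of the
eigenvectors at the intermediate point. -/
theorem concaveOn_sum (hP : IsQuadraticPencil ι Q P₀ P₁ d m v₂)
    (hS : ∀ k, IsSpectralSequence ι (Q k) (lam k) (e k)) {C : ℝ}
    (hC : ∀ x, d x + m x ≤ C * ‖ι x‖ ^ 2) (n : ℕ) :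
    ConcaveOn ℝ univ fun k => ∑ j ∈ Finset.range n, lam k j - n * C * k ^ 2 := by
  refine ⟨convex_univ, fun k _ l _ a b ha hb hab => ?_⟩
  simp only [smul_eq_mul]
  set t := a * k + b * l with ht
  have hk := (hS k).sum_le_trace (hP.discrete k).hermitian (hS t).orthonormal n
  have hl := (hS l).sum_le_trace (hP.discrete l).hermitian (hS t).orthonormal n
  have hself : ∑ j ∈ Finset.range n, lam t j =
      ∑ j ∈ Finset.range n, (Q t (e t j) (e t j)).re :=
    Finset.sum_congr rfl fun j _ => ((hS t).form_self j).symm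
  have hconst : ∀ q : ℝ, (n : ℝ) * C * q ^ 2 = ∑ j ∈ Finset.range n, C * q ^ 2 := fun q => by
    rw [Finset.sum_const, Finset.card_range, nsmul_eq_mul, mul_assoc]
  have hpt : ∀ j, a * ((Q k (e t j) (e t j)).re - C * k ^ 2) +
      b * ((Q l (e t j) (e t j)).re - C * l ^ 2) ≤ (Q t (e t j) (e t j)).re - C * t ^ 2 := by
    intro j
    have h1 := hC (e t j)
    rw [(hS t).orthonormal.1 j, one_pow, mul_one] at h1
    rw [hP.re_eq, hP.re_eq, hP.re_eq, ht]
    obtain rfl : b = 1 - a := by linarith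
    nlinarith [mul_nonneg (mul_nonneg (mul_nonneg ha hb) (sq_nonneg (k - l))) (sub_nonneg.2 h1)]
  have hsum := Finset.sum_le_sum fun j (_ : j ∈ Finset.range n) => hpt j
  rw [Finset.sum_add_distrib, ← Finset.mul_sum, ← Finset.mul_sum, Finset.sum_sub_distrib,
    Finset.sum_sub_distrib, Finset.sum_sub_distrib, ← hconst, ← hconst, ← hconst, ← hself] at hsum
  have h1 := mul_le_mul_of_nonneg_left hk ha
  have h2 := mul_le_mul_of_nonneg_left hl hb
  linarith

theorem exists_one_sided_deriv (hP : IsQuadraticPencil ι Q P₀ P₁ d m v₂)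
    (hS : ∀ k, IsSpectralSequence ι (Q k) (lam k) (e k)) (n : ℕ) (k : ℝ) :
    (∃ r, HasDerivWithinAt (fun k => lam k n) r (Ioi k) k) ∧
      ∃ l, HasDerivWithinAt (fun k => lam k n) l (Iio k) k := by
  obtain ⟨C, hC⟩ := hP.bounded
  refine exists_one_sided_deriv_of_concave (hP.concaveOn_sum hS hC (n + 1))
    (hP.concaveOn_sum hS hC n) (g := fun k => C * k ^ 2) (by fun_prop) (fun k => ?_) k
  rw [Finset.sum_range_succ]
  push_cast
  ring

/-- The quadratic polynomial q ↦ P₀ + q P₁ + q² d is nonnegative at q = k ± k/N. Expanding about k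
bounds its derivative there, on both sides, by its value and its leading coefficient. Large N puts
little weight on m. -/
theorem abs_deriv_le (hP : IsQuadraticPencil ι Q P₀ P₁ d m v₂) {C : ℝ}
    (hC : ∀ x, d x ≤ C * m x) {N k : ℝ} (hN : 0 < N) (hk : 0 < k) (x : D) :
    |P₁ x + 2 * k * d x| ≤ N / k * (P₀ x + k * P₁ x + k ^ 2 * d x) + k / N * (C * m x) := by
  set η := N / k with hη
  have hη0 : 0 < η := div_pos hN hk
  have hkN : k / N = η⁻¹ := by rw [hη, inv_div]
  have h1 := hP.nonneg (k - η⁻¹) x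
  have h2 := hP.nonneg (k + η⁻¹) x
  have h3 : η * η⁻¹ = 1 := mul_inv_cancel₀ hη0.ne'
  have h4 : η⁻¹ * d x ≤ η⁻¹ * (C * m x) := by
    have := hC x
    gcongr
  rw [hkN]
  have e1 : η * (P₀ x + (k - η⁻¹) * P₁ x + (k - η⁻¹) ^ 2 * d x) =
      η * (P₀ x + k * P₁ x + k ^ 2 * d x) - (P₁ x + 2 * k * d x) + η⁻¹ * d x := by
    linear_combination (-(P₁ x) - 2 * k * d x + η⁻¹ * d x) * h3
  have e2 : η * (P₀ x + (k + η⁻¹) * P₁ x + (k + η⁻¹) ^ 2 * d x) =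
      η * (P₀ x + k * P₁ x + k ^ 2 * d x) + (P₁ x + 2 * k * d x) + η⁻¹ * d x := by
    linear_combination (P₁ x + 2 * k * d x + η⁻¹ * d x) * h3
  have h5 := mul_nonneg hη0.le h1
  have h6 := mul_nonneg hη0.le h2
  rw [abs_le]
  constructor <;> linarith

end IsQuadraticPencil
end Pencil

/-! ### Difference quotients of the eigenvalues and the asymptotic slope -/

section Pencil

variable {H : Type*} [NormedAddCommGroup H] [InnerProductSpace ℂ H]
  {D : Type} [AddCommGroup D] [Module ℂ D]

namespace IsQuadraticPencil

variable {ι : D →ₗ[ℂ] H} {Q : ℝ → D →ₗ⋆[ℂ] D →ₗ[ℂ] ℂ} {P₀ P₁ d m : D → ℝ} {v₂ : ℝ}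
  {lam : ℝ → ℕ → ℝ} {e : ℝ → ℕ → D}

/-- The inequality holds already between the forms. The decisive term is N/k times p_k: written as
(N/k) Q_k - N k m and combined with m ≥ v₂ ‖x‖², it produces -N k v₂. The other terms involve m only
and are absorbed by k² m ≤ Q_k. -/
theorem eigenvalue_sub_le (hP : IsQuadraticPencil ι Q P₀ P₁ d m v₂)
    (hS : ∀ k, IsSpectralSequence ι (Q k) (lam k) (e k)) {C : ℝ} (hC0 : 0 ≤ C)
    (hC : ∀ x, d x ≤ C * m x) (n : ℕ) {N k l : ℝ} (hN : 0 < N) (hk : 0 < k) (hkl : k < l) :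
    lam l n - lam k n ≤ (l - k) * ((N / k + C / (N * k) + C * (l - k) / k ^ 2 + (l + k) / k ^ 2) *
      lam k n - N * k * v₂) := by
  set s := l - k with hs
  have hs0 : 0 < s := sub_pos.2 hkl
  have hl : l = k + s := by rw [hs]; ring
  have hcmp : ∀ x, (Q l x x).re ≤
      (1 + s * (N / k + C / (N * k) + C * s / k ^ 2 + (l + k) / k ^ 2)) * (Q k x x).re +
        (-(s * (N * k * v₂))) * ‖ι x‖ ^ 2 := fun x => by
    have h1 := (abs_le.1 (hP.abs_deriv_le hC hN hk x)).2
    have h2 := hP.nonneg k x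
    have h3 := hP.le_m x
    have h4 := hC x
    rw [hP.re_eq, hP.re_eq]
    set p := P₀ x + k * P₁ x + k ^ 2 * d x with hp
    have e1 : P₀ x + l * P₁ x + l ^ 2 * d x + l ^ 2 * m x =
        p + s * (P₁ x + 2 * k * d x) + s ^ 2 * d x + (k ^ 2 + s * (l + k)) * m x := by
      rw [hp, hl]; ring
    have h5 : s * (P₁ x + 2 * k * d x) ≤ s * (N / k * p + k / N * (C * m x)) := by gcongr
    have h6 : s ^ 2 * d x ≤ s ^ 2 * (C * m x) := by gcongr
    have e2 : (1 + s * (N / k + C / (N * k) + C * s / k ^ 2 + (l + k) / k ^ 2)) *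
        (p + k ^ 2 * m x) + -(s * (N * k * v₂)) * ‖ι x‖ ^ 2 =
        p + s * (N / k * p + k / N * (C * m x)) + s ^ 2 * (C * m x) +
          (k ^ 2 + s * (l + k)) * m x + (s * (N * k)) * (m x - v₂ * ‖ι x‖ ^ 2) +
          s * (C / (N * k) + C * s / k ^ 2 + (l + k) / k ^ 2) * p := by
      field_simp
      ring
    have h7 : 0 ≤ (s * (N * k)) * (m x - v₂ * ‖ι x‖ ^ 2) :=
      mul_nonneg (by positivity) (sub_nonneg.2 h3)
    have hl0 : 0 < l := hk.trans hkl
    have h8 : 0 ≤ s * (C / (N * k) + C * s / k ^ 2 + (l + k) / k ^ 2) * p := by positivity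
    rw [e1, e2]
    linarith
  have hl0 : 0 < l := hk.trans hkl
  have := (hS k).le_of_form_le (hS l) (hP.discrete k).injective (by positivity) hcmp n
  linarith

/-- The reverse comparison bounds `Q l` below by a multiple κ of `Q k` plus a multiple of the norm.
The smallness assumption keeps κ positive, so that the inequality can be divided by κ and read as an
upper bound for `Q k`. -/
theorem le_eigenvalue_sub (hP : IsQuadraticPencil ι Q P₀ P₁ d m v₂)
    (hS : ∀ k, IsSpectralSequence ι (Q k) (lam k) (e k)) {C : ℝ} (hC0 : 0 ≤ C)
    (hC : ∀ x, d x ≤ C * m x) (n : ℕ) {N k l : ℝ} (hN : 0 < N) (hk : 0 < k) (hkl : k < l)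
    (hsmall : (l - k) * (N / k + C / (N * k)) < 1) :
    (l - k) * ((N * k + (l + k)) * v₂ - (N / k + C / (N * k)) * lam k n) ≤
      lam l n - lam k n := by
  set s := l - k with hs
  have hs0 : 0 < s := sub_pos.2 hkl
  have hl : l = k + s := by rw [hs]; ring
  have hl0 : 0 < l := hk.trans hkl
  set κ := 1 - s * (N / k + C / (N * k)) with hκ
  have hκ0 : 0 < κ := by linarith
  have hcmp : ∀ x, κ * (Q k x x).re + s * (N * k + (l + k)) * v₂ * ‖ι x‖ ^ 2 ≤ (Q l x x).re := by
    intro x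
    have h1 := (abs_le.1 (hP.abs_deriv_le hC hN hk x)).1
    have h2 := hP.nonneg k x
    have h3 := hP.le_m x
    have h4 := hP.d_nonneg x
    rw [hP.re_eq, hP.re_eq]
    set p := P₀ x + k * P₁ x + k ^ 2 * d x with hp
    have e1 : P₀ x + l * P₁ x + l ^ 2 * d x + l ^ 2 * m x =
        p + s * (P₁ x + 2 * k * d x) + s ^ 2 * d x + (k ^ 2 + s * (l + k)) * m x := by
      rw [hp, hl]; ring
    have h5 : s * -(N / k * p + k / N * (C * m x)) ≤ s * (P₁ x + 2 * k * d x) := by gcongr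
    have h6 : 0 ≤ s ^ 2 * d x := by positivity
    have e2 : κ * (p + k ^ 2 * m x) + s * (N * k + (l + k)) * v₂ * ‖ι x‖ ^ 2 =
        p + s * -(N / k * p + k / N * (C * m x)) + (k ^ 2 + s * (l + k)) * m x -
          (s * (N * k + (l + k))) * (m x - v₂ * ‖ι x‖ ^ 2) - s * (C / (N * k)) * p := by
      rw [hκ]
      field_simp
      ring
    have h7 : 0 ≤ (s * (N * k + (l + k))) * (m x - v₂ * ‖ι x‖ ^ 2) :=
      mul_nonneg (by positivity) (sub_nonneg.2 h3)
    have h8 : 0 ≤ s * (C / (N * k)) * p := by positivity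
    rw [e1, e2]
    linarith
  have hcmp' : ∀ x, (Q k x x).re ≤ κ⁻¹ * (Q l x x).re +
      (-(κ⁻¹ * (s * (N * k + (l + k)) * v₂))) * ‖ι x‖ ^ 2 := fun x => by
    have h1 := mul_le_mul_of_nonneg_left (hcmp x) (inv_nonneg.2 hκ0.le)
    rw [mul_add, ← mul_assoc, inv_mul_cancel₀ hκ0.ne', one_mul] at h1
    linarith
  have h9 := (hS l).le_of_form_le (hS k) (hP.discrete k).injective (inv_nonneg.2 hκ0.le) hcmp' n
  have h10 := mul_le_mul_of_nonneg_left h9 hκ0.le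
  have e3 : κ * (κ⁻¹ * lam l n + -(κ⁻¹ * (s * (N * k + (l + k)) * v₂))) =
      lam l n - s * (N * k + (l + k)) * v₂ := by
    field_simp
    ring
  rw [e3, hκ] at h10
  linarith

/-- This is the limit l → k of the two difference bounds. If the eigenvalue is close to k² v₂ and N
is large, both bounds are close to 2 k v₂. -/
theorem one_sided_deriv_bounds (hP : IsQuadraticPencil ι Q P₀ P₁ d m v₂)
    (hS : ∀ k, IsSpectralSequence ι (Q k) (lam k) (e k)) {C : ℝ} (hC0 : 0 ≤ C)
    (hC : ∀ x, d x ≤ C * m x) (n : ℕ) {N k r l : ℝ} (hN : 0 < N) (hk : 0 < k)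
    (hr : HasDerivWithinAt (fun k => lam k n) r (Ioi k) k)
    (hl : HasDerivWithinAt (fun k => lam k n) l (Iio k) k) :
    (r ≤ (N / k + C / (N * k) + 2 / k) * lam k n - N * k * v₂ ∧
      l ≤ (N / k + C / (N * k) + 2 / k) * lam k n - N * k * v₂) ∧
    ((N * k + 2 * k) * v₂ - (N / k + C / (N * k)) * lam k n ≤ r ∧
      (N * k + 2 * k) * v₂ - (N / k + C / (N * k)) * lam k n ≤ l) := by
  have hpos : ∀ᶠ p : ℝ × ℝ in 𝓝 (k, k), 0 < p.1 := continuousAt_fst.eventually (lt_mem_nhds hk)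
  have hNk : N * k ≠ 0 := by positivity
  have hsmall : ∀ᶠ p : ℝ × ℝ in 𝓝 (k, k), (p.2 - p.1) * (N / p.1 + C / (N * p.1)) < 1 := by
    have hcont : ContinuousAt (fun p : ℝ × ℝ => (p.2 - p.1) * (N / p.1 + C / (N * p.1))) (k, k) := by
      fun_prop (disch := simp [hk.ne'])
    exact hcont.eventually (gt_mem_nhds (by simp))
  constructor
  · have h1 := one_sided_deriv_le (Λ := fun k => lam k n)
      (U := fun p : ℝ × ℝ × ℝ => (N / p.1 + C / (N * p.1) + C * (p.2.1 - p.1) / p.1 ^ 2 +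
        (p.2.1 + p.1) / p.1 ^ 2) * p.2.2 - N * p.1 * v₂) (k := k)
      (by fun_prop (disch := simp [hk.ne']))
      (by
        filter_upwards [hpos] with p hp hpp
        exact hP.eigenvalue_sub_le hS hC0 hC n hN hp hpp) hr hl
    have e1 : (N / k + C / (N * k) + C * (k - k) / k ^ 2 + (k + k) / k ^ 2) * lam k n -
        N * k * v₂ = (N / k + C / (N * k) + 2 / k) * lam k n - N * k * v₂ := by
      field_simp
      ring
    simp only [e1] at h1
    exact h1
  -- The lower bound is an upper bound for the negative of the eigenvalue.
  · have h1 := one_sided_deriv_le (Λ := fun k => -lam k n)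
      (U := fun p : ℝ × ℝ × ℝ => -((N * p.1 + (p.2.1 + p.1)) * v₂ -
        (N / p.1 + C / (N * p.1)) * -p.2.2)) (k := k)
      (by fun_prop (disch := simp [hk.ne']))
      (by
        filter_upwards [hpos, hsmall] with p hp hp' hpp
        have := hP.le_eigenvalue_sub hS hC0 hC n hN hp hpp hp'
        simp only [neg_neg]
        linarith) hr.neg hl.neg
    have e1 : -((N * k + (k + k)) * v₂ - (N / k + C / (N * k)) * - -lam k n) =
        -((N * k + 2 * k) * v₂ - (N / k + C / (N * k)) * lam k n) := by ring
    simp only [e1, neg_le_neg_iff] at h1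
    exact h1

theorem eigenvalue_pos (hP : IsQuadraticPencil ι Q P₀ P₁ d m v₂)
    (hS : ∀ k, IsSpectralSequence ι (Q k) (lam k) (e k)) (n : ℕ) {k : ℝ} (hk : 0 < k) :
    0 < lam k n := by
  rw [← (hS k).form_self, hP.re_eq]
  have h1 := hP.nonneg k (e k n)
  have h2 := hP.m_pos (e k n) fun h => by
    have : ‖ι (e k n)‖ = 1 := (hS k).orthonormal.1 n
    rw [h, map_zero, norm_zero] at this
    exact zero_ne_one this
  have : 0 < k ^ 2 * m (e k n) := by positivity
  linarith

theorem eigenvalue_nonneg (hP : IsQuadraticPencil ι Q P₀ P₁ d m v₂)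
    (hS : ∀ k, IsSpectralSequence ι (Q k) (lam k) (e k)) (n : ℕ) (k : ℝ) : 0 ≤ lam k n := by
  rw [← (hS k).form_self]
  exact (hP.discrete k).nonneg _

theorem le_eigenvalue (hP : IsQuadraticPencil ι Q P₀ P₁ d m v₂)
    (hS : ∀ k, IsSpectralSequence ι (Q k) (lam k) (e k)) (n : ℕ) (k : ℝ) :
    k ^ 2 * v₂ ≤ lam k n := by
  refine (hS k).le_of_le_form (fun x => ?_) n
  rw [hP.re_eq]
  have h1 := hP.nonneg k x
  have h2 := mul_le_mul_of_nonneg_left (hP.le_m x) (sq_nonneg k)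
  linarith

theorem tendsto_eigenvalue_div_sq (hP : IsQuadraticPencil ι Q P₀ P₁ d m v₂)
    (hS : ∀ k, IsSpectralSequence ι (Q k) (lam k) (e k)) (n : ℕ) :
    Tendsto (fun k => lam k n / k ^ 2) atTop (𝓝 v₂) := by
  rw [tendsto_order]
  constructor
  · intro a ha
    filter_upwards [eventually_gt_atTop 0] with k hk
    rw [lt_div_iff₀ (by positivity)]
    have h1 := hP.le_eigenvalue hS n k
    have h2 : 0 < k ^ 2 := by positivity
    nlinarith
  · intro a ha
    -- Half of the gap a - v₂ is spent on the trial space; the other half absorbs C / k² for large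
    -- k.
    obtain ⟨C, hC⟩ := hP.trial ((a - v₂) / 2) (by linarith) n
    have h1 : Tendsto (fun k : ℝ => C / k ^ 2 + (v₂ + (a - v₂) / 2)) atTop
        (𝓝 (0 + (v₂ + (a - v₂) / 2))) :=
      (tendsto_const_nhds.div_atTop (tendsto_pow_atTop two_ne_zero)).add tendsto_const_nhds
    have h0 : 0 + (v₂ + (a - v₂) / 2) < a := by linarith
    filter_upwards [h1.eventually (gt_mem_nhds h0), eventually_gt_atTop 0] with k hka hk
    obtain ⟨J, hJ, hJB⟩ := hC k hk
    have h2 := (hS k).le_of_trial (hP.discrete k).injective J hJ hJB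
    refine lt_of_le_of_lt ?_ hka
    rw [div_le_iff₀ (by positivity), add_mul, div_mul_cancel₀ _ (by positivity)]
    linarith

theorem tendsto_sqrt_eigenvalue_div (hP : IsQuadraticPencil ι Q P₀ P₁ d m v₂)
    (hS : ∀ k, IsSpectralSequence ι (Q k) (lam k) (e k)) (n : ℕ) :
    Tendsto (fun k => √(lam k n) / k) atTop (𝓝 √v₂) := by
  refine ((hP.tendsto_eigenvalue_div_sq hS n).sqrt).congr' ?_
  filter_upwards [eventually_gt_atTop 0] with k hk
  rw [Real.sqrt_div (hP.eigenvalue_nonneg hS n k), Real.sqrt_sq hk.le]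

/-- With ρ = √λ/k and τ = (ρ² - v₂)/ρ one has k v₂/√λ = ρ - τ. The derivative bounds divided by 2√λ
therefore stay within (1 + N/2) τ + (C/(2N)) ρ of ρ, and `tendsto_of_forall_approx` finishes. -/
theorem hasAsymptoticSlope (hP : IsQuadraticPencil ι Q P₀ P₁ d m v₂)
    (hS : ∀ k, IsSpectralSequence ι (Q k) (lam k) (e k)) (c : ℝ) (n : ℕ) :
    HasAsymptoticSlope (fun k => c * √(lam k n)) (c * √v₂) := by
  choose r hr using fun k => (hP.exists_one_sided_deriv hS n k).1
  choose l hl using fun k => (hP.exists_one_sided_deriv hS n k).2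
  obtain ⟨C, hC0, hC⟩ := hP.d_le
  have hρ := hP.tendsto_sqrt_eigenvalue_div hS n
  set ρ : ℝ → ℝ := fun k => √(lam k n) / k with hρdef
  have hsq : ∀ k > 0, ρ k ^ 2 = lam k n / k ^ 2 := fun k _ => by
    simp only [hρdef]
    rw [div_pow, Real.sq_sqrt (hP.eigenvalue_nonneg hS n k)]
  set τ : ℝ → ℝ := fun k => (ρ k ^ 2 - v₂) / ρ k with hτdef
  have hτ : Tendsto τ atTop (𝓝 0) := by
    -- The infimum may be zero even though the coefficient is positive, by a vanishing one-sided
    -- limit at a jump. Then ρ tends to 0 and the quotient cannot be treated by division of limits,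
    -- but τ equals ρ.
    rcases hP.v_nonneg.eq_or_lt with h0 | h0
    · have h1 : τ = ρ := by
        funext k
        simp only [hτdef, ← h0, sub_zero, sq]
        exact mul_self_div_self _
      rw [h1]
      simpa [← h0] using hρ
    · have h1 : Tendsto τ atTop (𝓝 ((√v₂ ^ 2 - v₂) / √v₂)) :=
        ((hρ.pow 2).sub_const _).div hρ (Real.sqrt_pos.2 h0).ne'
      rwa [Real.sq_sqrt h0.le, sub_self, zero_div] at h1
  have hbound : ∀ g : ℝ → ℝ, (∀ N k : ℝ, 0 < N → 0 < k →
      g k ≤ (N / k + C / (N * k) + 2 / k) * lam k n - N * k * v₂ ∧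
      (N * k + 2 * k) * v₂ - (N / k + C / (N * k)) * lam k n ≤ g k) →
      Tendsto (fun k => g k / (2 * √(lam k n))) atTop (𝓝 √v₂) := by
    intro g hg
    refine tendsto_of_forall_approx hC0 hρ hτ fun N hN k hk => ?_
    obtain ⟨h1, h2⟩ := hg N k hN hk
    have hlam := hP.eigenvalue_pos hS n hk
    set y := √(lam k n) with hy
    have hy0 : 0 < y := Real.sqrt_pos.2 hlam
    have hyy : lam k n = y ^ 2 := (Real.sq_sqrt hlam.le).symm
    have hρk : ρ k = y / k := rfl
    have hτk : τ k = (y ^ 2 - k ^ 2 * v₂) / (k * y) := by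
      simp only [hτdef, hρk]
      field_simp
    have hτ0 : 0 ≤ τ k := by
      rw [hτk, ← hyy]
      exact div_nonneg (sub_nonneg.2 (hP.le_eigenvalue hS n k)) (by positivity)
    have hρ0 : 0 < ρ k := by rw [hρk]; positivity
    rw [hyy] at h1 h2
    have h3 : g k / (2 * y) ≤ ρ k + N / 2 * τ k + C / (2 * N) * ρ k := by
      rw [div_le_iff₀ (by positivity)]
      refine h1.trans_eq ?_
      rw [hτk, hρk]
      field_simp
      ring
    have h4 : ρ k - τ k - N / 2 * τ k - C / (2 * N) * ρ k ≤ g k / (2 * y) := by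
      rw [le_div_iff₀ (by positivity)]
      refine (le_of_eq ?_).trans h2
      rw [hτk, hρk]
      field_simp
      ring
    have h5 : C / (2 * N) * ρ k ≤ C / N * ρ k := by
      gcongr
      linarith
    have h6 : 0 ≤ N * τ k := by positivity
    rw [abs_le]
    constructor <;> linarith
  have key := fun N k hN hk => hP.one_sided_deriv_bounds hS hC0 hC n (N := N) (k := k) hN hk
    (hr k) (hl k)
  refine HasAsymptoticSlope.of_one_sided (r := fun k => c * (r k / (2 * √(lam k n))))
    (l := fun k => c * (l k / (2 * √(lam k n)))) ?_ (fun k hk => ?_) ?_ ?_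
  · refine (hρ.const_mul c).congr fun k => ?_
    rw [mul_div_assoc]
  · have hne := (hP.eigenvalue_pos hS n hk).ne'
    exact ⟨((hr k).sqrt hne).const_mul c, ((hl k).sqrt hne).const_mul c⟩
  · exact (hbound r fun N k hN hk => ⟨(key N k hN hk).1.1, (key N k hN hk).2.1⟩).const_mul c
  · exact (hbound l fun N k hN hk => ⟨(key N k hN hk).1.2, (key N k hN hk).2.2⟩).const_mul c

/-- The bands of a quadratic pencil of forms have asymptotic slope `c √v₂`. -/
theorem allBandsHaveSlope [CompleteSpace H] (hP : IsQuadraticPencil ι Q P₀ P₁ d m v₂)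
    {M : Type} [AddCommGroup M] [Module ℂ M] {c : ℝ} (hc : 0 < c) {E : ℝ → ℝ → Submodule ℂ M}
    (hE : ∀ k μ, Module.rank ℂ (E k μ) = Module.rank ℂ (formEigenspace ι (Q k) μ)) :
    AllBandsHaveSlope c E (c * √v₂) := by
  obtain ⟨lam, e, hS⟩ := hP.exists_spectralSequence
  have hsq : ∀ n k, (c * √(lam k n)) ^ 2 / c ^ 2 = lam k n := fun n k => by
    rw [mul_pow, Real.sq_sqrt (hP.eigenvalue_nonneg hS n k)]
    field_simp
  constructor
  · refine ⟨fun n k => c * √(lam k n), fun n k => by positivity, fun k i j hij => ?_,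
      fun k μ => ?_⟩
    · have := (hS k).mono hij
      dsimp only
      gcongr
    · simp only [hsq]
      rw [hE, (hS k).rank_formEigenspace (hP.discrete k)]
  · intro ω hω n
    -- Any other list of bands is nondecreasing with the same multiplicities, hence is the same
    -- list.
    have hlam : ∀ k, (fun n => ω n k ^ 2 / c ^ 2) = lam k := fun k => by
      refine monotone_eq_of_multiplicity_eq (fun i j hij => ?_) (hS k).mono fun μ => ?_
      · have h1 := hω.mono k hij
        have h2 := hω.nonneg i k
        dsimp only at h1 ⊢
        gcongr
      · rw [← hω.multiplicity, hE, (hS k).rank_formEigenspace (hP.discrete k)]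
    have hωeq : ω n = fun k => c * √(lam k n) := by
      funext k
      rw [← hlam k]
      dsimp only
      rw [← div_pow, Real.sqrt_sq (div_nonneg (hω.nonneg n k) hc.le)]
      field_simp
    rw [hωeq]
    exact hP.hasAsymptoticSlope hS c n

end IsQuadraticPencil
end Pencil

/-! ### Bounded perturbations of operators with compact resolvent -/

section Operator

variable {H : Type} [NormedAddCommGroup H] [InnerProductSpace ℂ H]

theorem inner_apply_symm_of_isSelfAdjoint [CompleteSpace H] {K : H →ₗ.[ℂ] H} (hK : IsSelfAdjoint K)
    (x y : K.domain) : inner ℂ (K x) (y : H) = inner ℂ (x : H) (K y) := by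
  have h := LinearPMap.adjoint_isFormalAdjoint hK.dense_domain
  rw [LinearPMap.isSelfAdjoint_def.1 hK] at h
  exact h x y

/-- The form `⟨(K + k² B) x, y⟩` on the domain of `K`. -/
def operatorForm (K : H →ₗ.[ℂ] H) (B : H →L[ℂ] H) (k : ℝ) :
    K.domain →ₗ⋆[ℂ] K.domain →ₗ[ℂ] ℂ :=
  LinearMap.mk₂'ₛₗ (starRingEnd ℂ) (RingHom.id ℂ)
    (fun x y => inner ℂ (K x + ((k ^ 2 : ℝ) : ℂ) • B x) (y : H))
    (fun x x' y => by
      rw [K.map_add, Submodule.coe_add, map_add, smul_add, add_add_add_comm, inner_add_left])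
    (fun c x y => by
      rw [K.map_smul, Submodule.coe_smul, map_smul, smul_comm, ← smul_add, inner_smul_left,
        smul_eq_mul])
    (fun x y y' => by rw [Submodule.coe_add, inner_add_right])
    (fun c x y => by rw [Submodule.coe_smul, inner_smul_right]; rfl)

theorem operatorForm_apply (K : H →ₗ.[ℂ] H) (B : H →L[ℂ] H) (k : ℝ) (x y : K.domain) :
    operatorForm K B k x y = inner ℂ (K x + ((k ^ 2 : ℝ) : ℂ) • B x) (y : H) := rfl

theorem re_operatorForm_self (K : H →ₗ.[ℂ] H) (B : H →L[ℂ] H) (k : ℝ) (x : K.domain) :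
    (operatorForm K B k x x).re =
      (inner ℂ (K x) (x : H)).re + k ^ 2 * (inner ℂ (B x) (x : H)).re := by
  rw [operatorForm_apply, inner_add_left, inner_smul_left, Complex.conj_ofReal, Complex.add_re,
    Complex.re_ofReal_mul]

/-- The ansatz u = R f turns (K + k² B + 1) u = h into (1 - T) f = h with T compact. If T f = f,
then (K + k² B) R f = -R f, and nonnegativity of the form forces R f = 0, hence f = 0. The Fredholm
alternative then inverts 1 - T, and R (1 - T)⁻¹ is the compact solution operator. -/
theorem isDiscreteForm_operatorForm [CompleteSpace H] {K : H →ₗ.[ℂ] H} (hK : IsSelfAdjoint K)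
    (hK0 : ∀ u : K.domain, 0 ≤ (inner ℂ (u : H) (K u)).re)
    (hR : ∃ (z : ℂ) (R : H →L[ℂ] H), IsCompactOperator R ∧
      (∀ f, ∃ h : R f ∈ K.domain, K ⟨R f, h⟩ - z • R f = f) ∧
      ∀ u : K.domain, R (K u - z • (u : H)) = u)
    {B : H →L[ℂ] H} (hB : B.IsSymmetric) (hB0 : ∀ x, 0 ≤ (inner ℂ (B x) x).re) (k : ℝ) :
    IsDiscreteForm K.domain.subtype (operatorForm K B k) := by
  have hK0' : ∀ u : K.domain, 0 ≤ (inner ℂ (K u) (u : H)).re := fun u => by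
    rw [inner_apply_symm_of_isSelfAdjoint hK]; exact hK0 u
  have hnn : ∀ x, 0 ≤ (operatorForm K B k x x).re := fun x => by
    rw [re_operatorForm_self]
    exact add_nonneg (hK0' x) (mul_nonneg (sq_nonneg k) (hB0 x))
  refine ⟨Subtype.val_injective, fun x y => ?_, hnn, ?_⟩
  · rw [operatorForm_apply, operatorForm_apply, inner_conj_symm, inner_add_right, inner_add_left,
      inner_smul_left, inner_smul_right, Complex.conj_ofReal, inner_apply_symm_of_isSelfAdjoint hK]
    congr 2
    exact (hB y x).symm
  · obtain ⟨z, R, hRc, hR1, hR2⟩ := hR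
    let T : H →L[ℂ] H := -((((k ^ 2 : ℝ) : ℂ) • B + (1 + z) • ContinuousLinearMap.id ℂ H) ∘L R)
    have hTc : IsCompactOperator T := 
    (hRc.clm_comp (((k ^ 2 : ℝ) : ℂ) • B + (1 + z) • ContinuousLinearMap.id ℂ H)).neg
    have hA : ∀ f, ∃ h : R f ∈ K.domain,
        K ⟨R f, h⟩ + ((k ^ 2 : ℝ) : ℂ) • B (R f) + R f = f - T f := fun f => by
      obtain ⟨h, hf⟩ := hR1 f
      refine ⟨h, ?_⟩
      have h1 : K ⟨R f, h⟩ = f + z • R f := by rw [← sub_eq_iff_eq_add]; exact hf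
      rw [h1]
      simp only [T, neg_apply, ContinuousLinearMap.comp_apply,
        add_apply, smul_apply, ContinuousLinearMap.id_apply]
      module
    have hne : ¬ Module.End.HasEigenvalue (T : Module.End ℂ H) 1 := fun hev => by
      obtain ⟨f, hf⟩ := hev.exists_hasEigenvector
      have hTf : T f = f := by simpa using hf.apply_eq_smul
      obtain ⟨h, hAf⟩ := hA f
      rw [hTf, sub_self] at hAf
      have h1 := hnn ⟨R f, h⟩
      rw [operatorForm_apply, eq_neg_of_add_eq_zero_left hAf, inner_neg_left, Complex.neg_re,
        inner_self_eq_ofReal_norm_sq, Complex.ofReal_re] at h1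
      have h2 : R f = 0 := by
        have : ‖R f‖ ^ 2 = 0 := le_antisymm (by linarith) (sq_nonneg _)
        simpa using this
      obtain ⟨h', hf'⟩ := hR1 f
      apply hf.2
      rw [← hf']
      have h3 : (⟨R f, h'⟩ : K.domain) = 0 := Subtype.ext h2
      rw [h3, K.map_zero, h2, smul_zero, sub_zero]
    have hres := (hTc.hasEigenvalue_or_mem_resolventSet one_ne_zero).resolve_left hne
    rw [spectrum.mem_resolventSet_iff, map_one] at hres
    obtain ⟨W, hW⟩ := hres
    have hinv : ∀ h, (↑W⁻¹ : H →L[ℂ] H) h - T ((↑W⁻¹ : H →L[ℂ] H) h) = h := fun h => by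
      have h1 : ((W : H →L[ℂ] H) * (↑W⁻¹ : H →L[ℂ] H)) h = h := by rw [Units.mul_inv]; rfl
      rw [hW] at h1
      exact h1
    refine ⟨R ∘L (↑W⁻¹ : H →L[ℂ] H), fun h => ⟨R ((↑W⁻¹ : H →L[ℂ] H) h), (hA _).1⟩,
      hRc.comp_clm _, fun h => rfl, fun h y => ?_⟩
    obtain ⟨h1, h2⟩ := hA ((↑W⁻¹ : H →L[ℂ] H) h)
    rw [hinv] at h2
    rw [operatorForm_apply]
    change inner ℂ _ _ + inner ℂ (R ((↑W⁻¹ : H →L[ℂ] H) h)) (y : H) = inner ℂ h (y : H)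
    rw [← inner_add_left]
    exact congrArg (fun u => inner ℂ u (y : H)) h2

/-- Trial vectors in the domain, close to given orthonormal vectors. -/
theorem exists_trial_in_domain {K : H →ₗ.[ℂ] H} (hK : Dense (K.domain : Set H))
    {B : H →L[ℂ] H} {v₂ ε : ℝ} (hv : 0 ≤ v₂) (hε : 0 < ε) {n : ℕ} {g : Fin (n + 1) → H}
    (hg : Orthonormal ℂ g)
    (hgB : ∀ c : Fin (n + 1) → ℂ, (inner ℂ (B (∑ i, c i • g i)) (∑ i, c i • g i)).re ≤
      (v₂ + ε) * ‖∑ i, c i • g i‖ ^ 2) :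
    ∃ C : ℝ, ∃ J : (Fin (n + 1) → ℂ) →ₗ[ℂ] K.domain, Function.Injective J ∧
      ∀ c k, (operatorForm K B k (J c) (J c)).re ≤
        (C + k ^ 2 * (v₂ + 2 * ε)) * ‖(J c : H)‖ ^ 2 := by
  -- The number κ measures the relative error of the approximation. It is chosen so that κ (‖B‖ + v₂
  -- + 2ε) ≤ ε, which makes v₂ + ε + ‖B‖ κ at most (v₂ + 2ε)(1 - κ).
  set κ : ℝ := ε / (2 * (‖B‖ + v₂ + 2 * ε)) with hκ
  have hden : 0 < ‖B‖ + v₂ + 2 * ε := by positivity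
  have hκ0 : 0 < κ := by positivity
  have hκ2 : κ ≤ 1 / 2 := by
    rw [hκ, div_le_iff₀ (by positivity)]
    have := norm_nonneg B
    linarith
  have hκM : κ * (‖B‖ + v₂ + 2 * ε) ≤ ε := by
    rw [hκ, div_mul_eq_mul_div, div_le_iff₀ (by positivity)]
    nlinarith
  -- The factor n + 1 accounts for the number of vectors. The factor 3 makes the two cross terms of
  -- the form, bounded by 2κ/3 and κ/3 times ‖B‖ ‖G c‖², add up to κ times it.
  have happ : ∀ i, ∃ u : K.domain, ‖(u : H) - g i‖ ≤ κ / (3 * (n + 1)) := fun i => by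
    obtain ⟨u, hu, hu'⟩ := Metric.dense_iff.1 hK (g i) (κ / (3 * (n + 1))) (by positivity)
    exact ⟨⟨u, hu'⟩, by rw [← dist_eq_norm]; exact (Metric.mem_ball.1 hu).le⟩
  choose u hu using happ
  let J : (Fin (n + 1) → ℂ) →ₗ[ℂ] K.domain := Fintype.linearCombination ℂ u
  have hJ : ∀ c, (J c : H) = ∑ i, c i • (u i : H) := fun c => by
    simp only [J, Fintype.linearCombination_apply, Submodule.coe_sum, Submodule.coe_smul]
  have hKJ : ∀ c, K (J c) = ∑ i, c i • K (u i) := fun c => by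
    simp only [J, Fintype.linearCombination_apply]
    change K.toFun _ = ∑ i, c i • K.toFun (u i)
    rw [map_sum]
    simp only [map_smul]
  set G : (Fin (n + 1) → ℂ) → H := fun c => ∑ i, c i • g i with hGdef
  have hGn : ∀ c, ‖G c‖ ^ 2 = ∑ i, ‖c i‖ ^ 2 := fun c => by
    have h3 : inner ℂ (G c) (G c) = ((∑ i, ‖c i‖ ^ 2 : ℝ) : ℂ) := by
      rw [hGdef, hg.inner_sum]
      push_cast
      exact Finset.sum_congr rfl fun i _ => Complex.conj_mul' _
    rw [inner_self_eq_ofReal_norm_sq] at h3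
    exact Complex.ofReal_injective h3
  have hcG : ∀ c i, ‖c i‖ ≤ ‖G c‖ := fun c i => by
    refine le_of_sq_le_sq ?_ (norm_nonneg _)
    rw [hGn]
    exact Finset.single_le_sum (f := fun i => ‖c i‖ ^ 2) (fun j _ => sq_nonneg _)
      (Finset.mem_univ i)
  have hdiff : ∀ c, ‖(J c : H) - G c‖ ≤ κ / 3 * ‖G c‖ := fun c => by
    rw [hJ, hGdef, ← Finset.sum_sub_distrib]
    refine (norm_sum_le _ _).trans ?_
    have : ∀ i ∈ Finset.univ, ‖c i • (u i : H) - c i • g i‖ ≤ ‖G c‖ * (κ / (3 * (n + 1))) := by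
      intro i _
      rw [← smul_sub, norm_smul]
      exact mul_le_mul (hcG c i) (hu i) (norm_nonneg _) (norm_nonneg _)
    refine (Finset.sum_le_sum this).trans_eq ?_
    rw [Finset.sum_const, Finset.card_univ, Fintype.card_fin, nsmul_eq_mul]
    push_cast
    field_simp
    rfl
  have hJG : ∀ c, ‖(J c : H)‖ ≤ 2 * ‖G c‖ := fun c => by
    have h1 := norm_le_insert' (J c : H) (G c)
    have h2 := hdiff c
    have h3 := norm_nonneg (G c)
    nlinarith
  have hGJ : ∀ c, ‖G c‖ ≤ 2 * ‖(J c : H)‖ := fun c => by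
    have h1 := norm_le_insert' (G c) (J c : H)
    rw [norm_sub_rev] at h1
    have h2 := hdiff c
    have h3 := norm_nonneg (G c)
    nlinarith
  have hsq : ∀ c, (1 - κ) * ‖G c‖ ^ 2 ≤ ‖(J c : H)‖ ^ 2 := fun c => by
    have h1 := norm_le_insert' (G c) (J c : H)
    rw [norm_sub_rev] at h1
    have h2 := hdiff c
    have h3 := norm_nonneg (G c)
    have h4 : (1 - κ / 3) * ‖G c‖ ≤ ‖(J c : H)‖ := by linarith
    have h5 : 0 ≤ (1 - κ / 3) * ‖G c‖ := mul_nonneg (by linarith) h3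
    have h6 := mul_self_le_mul_self h5 h4
    nlinarith [sq_nonneg ‖G c‖, mul_nonneg (mul_nonneg hκ0.le hκ0.le) (sq_nonneg ‖G c‖),
      mul_nonneg hκ0.le (sq_nonneg ‖G c‖)]
  have hBb : ∀ c, (inner ℂ (B (J c)) (J c : H)).re ≤ (v₂ + 2 * ε) * ‖(J c : H)‖ ^ 2 := fun c => by
    have h1 : inner ℂ (B (J c)) (J c : H) = inner ℂ (B (G c)) (G c) +
        inner ℂ (B ((J c : H) - G c)) (J c : H) + inner ℂ (B (G c)) ((J c : H) - G c) := by
      rw [map_sub, inner_sub_left, inner_sub_right]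
      ring
    have h2 : (inner ℂ (B ((J c : H) - G c)) (J c : H)).re ≤
        ‖B‖ * (κ / 3 * ‖G c‖) * (2 * ‖G c‖) := by
      refine (Complex.re_le_norm _).trans ((norm_inner_le_norm _ _).trans ?_)
      refine mul_le_mul ((B.le_opNorm _).trans ?_) (hJG c) (norm_nonneg _) (by positivity)
      exact mul_le_mul_of_nonneg_left (hdiff c) (norm_nonneg _)
    have h3 : (inner ℂ (B (G c)) ((J c : H) - G c)).re ≤ ‖B‖ * ‖G c‖ * (κ / 3 * ‖G c‖) := by
      refine (Complex.re_le_norm _).trans ((norm_inner_le_norm _ _).trans ?_)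
      exact mul_le_mul (B.le_opNorm _) (hdiff c) (norm_nonneg _) (by positivity)
    have h4 := hgB c
    have h5 := hsq c
    rw [h1, Complex.add_re, Complex.add_re]
    have h6 : (v₂ + ε + ‖B‖ * κ) * ‖G c‖ ^ 2 ≤ (v₂ + 2 * ε) * ((1 - κ) * ‖G c‖ ^ 2) := by
      rw [← mul_assoc]
      refine mul_le_mul_of_nonneg_right ?_ (sq_nonneg _)
      nlinarith
    have h7 : (v₂ + 2 * ε) * ((1 - κ) * ‖G c‖ ^ 2) ≤ (v₂ + 2 * ε) * ‖(J c : H)‖ ^ 2 := by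
      gcongr
    have h8 : (inner ℂ (B (G c)) (G c)).re ≤ (v₂ + ε) * ‖G c‖ ^ 2 := h4
    nlinarith
  refine ⟨2 * ∑ i, ‖K (u i)‖, J, ?_, fun c k => ?_⟩
  · rw [injective_iff_map_eq_zero]
    intro c hc
    have h1 := hGJ c
    rw [hc, Submodule.coe_zero, norm_zero, mul_zero] at h1
    funext i
    exact norm_le_zero_iff.1 ((hcG c i).trans h1)
  · rw [re_operatorForm_self]
    have h1 : (inner ℂ (K (J c)) (J c : H)).re ≤ 2 * (∑ i, ‖K (u i)‖) * ‖(J c : H)‖ ^ 2 := by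
      refine (Complex.re_le_norm _).trans ((norm_inner_le_norm _ _).trans ?_)
      have h2 : ‖K (J c)‖ ≤ (∑ i, ‖K (u i)‖) * ‖G c‖ := by
        rw [hKJ, Finset.sum_mul]
        refine (norm_sum_le _ _).trans (Finset.sum_le_sum fun i _ => ?_)
        rw [norm_smul, mul_comm]
        exact mul_le_mul_of_nonneg_left (hcG c i) (norm_nonneg _)
      have h3 : 0 ≤ ∑ i, ‖K (u i)‖ := Finset.sum_nonneg fun i _ => norm_nonneg _
      calc ‖K (J c)‖ * ‖(J c : H)‖ ≤ ((∑ i, ‖K (u i)‖) * (2 * ‖(J c : H)‖)) * ‖(J c : H)‖ := by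
            refine mul_le_mul_of_nonneg_right (h2.trans ?_) (norm_nonneg _)
            exact mul_le_mul_of_nonneg_left (hGJ c) h3
        _ = 2 * (∑ i, ‖K (u i)‖) * ‖(J c : H)‖ ^ 2 := by ring
    have h2 := mul_le_mul_of_nonneg_left (hBb c) (sq_nonneg k)
    nlinarith

theorem isQuadraticPencil_operatorForm [CompleteSpace H] {K : H →ₗ.[ℂ] H} (hK : IsSelfAdjoint K)
    (hK0 : ∀ u : K.domain, 0 ≤ (inner ℂ (u : H) (K u)).re)
    (hR : ∃ (z : ℂ) (R : H →L[ℂ] H), IsCompactOperator R ∧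
      (∀ f, ∃ h : R f ∈ K.domain, K ⟨R f, h⟩ - z • R f = f) ∧
      ∀ u : K.domain, R (K u - z • (u : H)) = u)
    {B : H →L[ℂ] H} {v₂ : ℝ} (hB : B.IsSymmetric) (hv : 0 ≤ v₂)
    (hBv : ∀ x, v₂ * ‖x‖ ^ 2 ≤ (inner ℂ (B x) x).re)
    (hB0 : ∀ x, x ≠ 0 → 0 < (inner ℂ (B x) x).re)
    (htrial : ∀ ε > 0, ∀ n : ℕ, ∃ g : Fin (n + 1) → H, Orthonormal ℂ g ∧
      ∀ c : Fin (n + 1) → ℂ, (inner ℂ (B (∑ i, c i • g i)) (∑ i, c i • g i)).re ≤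
        (v₂ + ε) * ‖∑ i, c i • g i‖ ^ 2) :
    IsQuadraticPencil K.domain.subtype (operatorForm K B)
      (fun x => (inner ℂ (K x) (x : H)).re) (fun _ => 0) (fun _ => 0)
      (fun x => (inner ℂ (B x) (x : H)).re) v₂ where
  discrete := isDiscreteForm_operatorForm hK hK0 hR hB fun x =>
    (mul_nonneg hv (sq_nonneg _)).trans (hBv x)
  re_eq k x := by
    rw [re_operatorForm_self]
    ring
  nonneg k x := by
    rw [mul_zero, mul_zero, add_zero, add_zero, inner_apply_symm_of_isSelfAdjoint hK]
    exact hK0 x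
  d_nonneg _ := le_rfl
  d_le := ⟨0, le_rfl, fun _ => by simp⟩
  v_nonneg := hv
  le_m x := hBv x
  m_pos x hx := hB0 x fun h => hx (Subtype.ext h)
  bounded := ⟨‖B‖, fun x => by
    rw [zero_add]
    refine (Complex.re_le_norm _).trans ((norm_inner_le_norm _ _).trans ?_)
    calc ‖B x‖ * ‖(x : H)‖ ≤ ‖B‖ * ‖(x : H)‖ * ‖(x : H)‖ :=
          mul_le_mul_of_nonneg_right (B.le_opNorm _) (norm_nonneg _)
      _ = ‖B‖ * ‖(x : H)‖ ^ 2 := by ring⟩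
  trial ε hε n := by
    obtain ⟨g, hg, hgB⟩ := htrial (ε / 2) (half_pos hε) n
    obtain ⟨C, J, hJ, hJB⟩ := exists_trial_in_domain hK.dense_domain hv (half_pos hε) hg hgB
    refine ⟨C, fun k _ => ⟨J, hJ, fun c => ?_⟩⟩
    have := hJB c k
    rwa [mul_div_cancel₀ ε two_ne_zero] at this

end Operator

/-! ### Bounded functions with countably many discontinuities -/

/-- A bounded function that is continuous off a countable set. -/
structure IsTame (f : ℝ → ℝ) : Prop where
  bounded : ∃ C, ∀ x, |f x| ≤ C
  continuousAt : ∃ S : Set ℝ, S.Countable ∧ ∀ x, x ∉ S → ContinuousAt f x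

theorem measurable_of_continuousAt_off_countable {E : Type*} [TopologicalSpace E]
    [MeasurableSpace E] [BorelSpace E] {f : ℝ → E} {S : Set ℝ} (hS : S.Countable)
    (h : ∀ x, x ∉ S → ContinuousAt f x) : Measurable f := by
  have hc : ContinuousOn f Sᶜ := fun x hx => (h x hx).continuousWithinAt
  have : Countable S := hS.to_subtype
  refine measurable_of_restrict_of_restrict_compl hS.measurableSet (measurable_of_countable _) ?_
  exact (continuousOn_iff_continuous_domRestrict.1 hc).measurable

theorem IsTame.measurable {f : ℝ → ℝ} (hf : IsTame f) : Measurable f := by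
  obtain ⟨S, hS, h⟩ := hf.continuousAt
  exact measurable_of_continuousAt_off_countable hS h

theorem IsTame.const (c : ℝ) : IsTame fun _ => c :=
  ⟨⟨|c|, fun _ => le_rfl⟩, ∅, countable_empty, fun _ _ => continuousAt_const⟩

theorem IsTame.mul {f g : ℝ → ℝ} (hf : IsTame f) (hg : IsTame g) : IsTame fun x => f x * g x := by
  obtain ⟨⟨C, hC⟩, S, hS, h⟩ := hf
  obtain ⟨⟨C', hC'⟩, S', hS', h'⟩ := hg
  refine ⟨⟨C * C', fun x => ?_⟩, S ∪ S', hS.union hS', fun x hx => ?_⟩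
  · rw [abs_mul]
    exact mul_le_mul (hC x) (hC' x) (abs_nonneg _) ((abs_nonneg _).trans (hC x))
  · rw [mem_union, not_or] at hx
    exact (h x hx.1).mul (h' x hx.2)

theorem IsTame.sub {f g : ℝ → ℝ} (hf : IsTame f) (hg : IsTame g) : IsTame fun x => f x - g x := by
  obtain ⟨⟨C, hC⟩, S, hS, h⟩ := hf
  obtain ⟨⟨C', hC'⟩, S', hS', h'⟩ := hg
  refine ⟨⟨C + C', fun x => (abs_sub _ _).trans (add_le_add (hC x) (hC' x))⟩, S ∪ S',
    hS.union hS', fun x hx => ?_⟩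
  rw [mem_union, not_or] at hx
  exact (h x hx.1).sub (h' x hx.2)

theorem IsTame.sqrt {f : ℝ → ℝ} (hf : IsTame f) : IsTame fun x => √(f x) := by
  obtain ⟨⟨C, hC⟩, S, hS, h⟩ := hf
  refine ⟨⟨√C, fun x => ?_⟩, S, hS, fun x hx => (h x hx).sqrt⟩
  rw [abs_of_nonneg (Real.sqrt_nonneg _)]
  exact Real.sqrt_le_sqrt ((le_abs_self _).trans (hC x))

theorem IsTame.inv {f : ℝ → ℝ} (hf : IsTame f) {m : ℝ} (hm : 0 < m) (hfm : ∀ x, m ≤ f x) :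
    IsTame fun x => (f x)⁻¹ := by
  obtain ⟨-, S, hS, h⟩ := hf
  refine ⟨⟨m⁻¹, fun x => ?_⟩, S, hS, fun x hx => (h x hx).inv₀ (hm.trans_le (hfm x)).ne'⟩
  have h1 := hm.trans_le (hfm x)
  rw [abs_of_pos (inv_pos.2 h1)]
  exact (inv_le_inv₀ h1 hm).2 (hfm x)

theorem PiecewiseSmooth.eventually_continuousAt {f : ℝ → ℝ} (hf : PiecewiseSmooth f) (a : ℝ) :
    ∀ᶠ x in 𝓝[≠] a, ContinuousAt f x := by
  obtain ⟨g, h, hg, hh, hfg, hfh, -⟩ := hf a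
  rw [← Iio_union_Ioi, nhdsWithin_union, eventually_sup]
  constructor
  · have h1 := eventually_eventually_nhdsWithin.2 hfg
    filter_upwards [h1, self_mem_nhdsWithin] with x hx hxa
    rw [(isOpen_Iio.nhdsWithin_eq hxa)] at hx
    exact hg.continuous.continuousAt.congr_of_eventuallyEq hx
  · have h1 := eventually_eventually_nhdsWithin.2 hfh
    filter_upwards [h1, self_mem_nhdsWithin] with x hx hxa
    rw [(isOpen_Ioi.nhdsWithin_eq hxa)] at hx
    exact hh.continuous.continuousAt.congr_of_eventuallyEq hx

/-- Every point has a neighbourhood in which it is the only possible discontinuity, and countably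
many of these cover the line. -/
theorem PiecewiseSmooth.countable_discontinuities {f : ℝ → ℝ} (hf : PiecewiseSmooth f) :
    {x | ¬ ContinuousAt f x}.Countable := by
  have h1 : ∀ a, {x | ContinuousAt f x} ∪ {a} ∈ 𝓝 a := fun a => by
    have := eventually_nhdsWithin_iff.1 (hf.eventually_continuousAt a)
    filter_upwards [this] with x hx
    by_cases hxa : x = a
    · exact Or.inr hxa
    · exact Or.inl (hx hxa)
  obtain ⟨s, hs, hs'⟩ := TopologicalSpace.countable_cover_nhds h1
  refine hs.mono fun x hx => ?_
  have h2 : x ∈ ⋃ a ∈ s, ({x | ContinuousAt f x} ∪ {a} : Set ℝ) := by rw [hs']; exact mem_univ x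
  obtain ⟨a, ha, hxa⟩ := mem_iUnion₂.1 h2
  rcases hxa with h | h
  · exact absurd h hx
  · rw [mem_singleton_iff.1 h]
    exact ha

/-- Near each point the values are controlled by the two smooth extensions and the value at the
point; compactness of a period makes the bound global. -/
theorem PiecewiseSmooth.isTame {f : ℝ → ℝ} (hf : PiecewiseSmooth f) {L : ℝ} (hL : 0 < L)
    (hp : Function.Periodic f L) : IsTame f := by
  refine ⟨?_, _, hf.countable_discontinuities, fun x hx => not_not.1 hx⟩
  have hloc : ∀ a ∈ Icc 0 L, ∃ t ∈ 𝓝[Icc 0 L] a, ∃ C, ∀ x ∈ t, |f x| ≤ C := fun a _ => by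
    obtain ⟨g, h, hg, hh, hfg, hfh, -⟩ := hf a
    have hg' : ∀ᶠ x in 𝓝 a, |g x| < |g a| + 1 :=
      hg.continuous.abs.continuousAt.eventually (gt_mem_nhds (lt_add_one _))
    have hh' : ∀ᶠ x in 𝓝 a, |h x| < |h a| + 1 :=
      hh.continuous.abs.continuousAt.eventually (gt_mem_nhds (lt_add_one _))
    refine ⟨{x | |f x| ≤ (|g a| + 1) + (|h a| + 1) + |f a|}, mem_nhdsWithin_of_mem_nhds ?_, _,
      fun x hx => hx⟩
    filter_upwards [hg', hh', eventually_nhdsWithin_iff.1 hfg, eventually_nhdsWithin_iff.1 hfh]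
      with x h1 h2 h3 h4
    have p1 := abs_nonneg (g a)
    have p2 := abs_nonneg (h a)
    have p3 := abs_nonneg (f a)
    rcases lt_trichotomy x a with hx | hx | hx
    · rw [h3 hx]; linarith
    · rw [hx]; linarith
    · rw [h4 hx]; linarith
  obtain ⟨C, hC⟩ : ∃ C, ∀ x ∈ Icc 0 L, |f x| ≤ C := by
    refine isCompact_Icc.induction_on (p := fun s => ∃ C, ∀ x ∈ s, |f x| ≤ C)
      ⟨0, fun x hx => absurd hx (notMem_empty x)⟩ (fun s t hst ⟨C, hC⟩ => ⟨C, fun x hx => hC x (hst hx)⟩)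
      (fun s t ⟨C, hC⟩ ⟨C', hC'⟩ => ⟨max C C', fun x hx => ?_⟩) hloc
    rcases hx with hx | hx
    · exact (hC x hx).trans (le_max_left _ _)
    · exact (hC' x hx).trans (le_max_right _ _)
  refine ⟨C, fun x => ?_⟩
  obtain ⟨y, hy, hxy⟩ := hp.exists_mem_Ico₀ hL x
  rw [hxy]
  exact hC y ⟨hy.1, hy.2.le⟩

/-- Values of a piecewise smooth function are approached on intervals. -/
theorem PiecewiseSmooth.exists_Ioo_lt {f : ℝ → ℝ} (hf : PiecewiseSmooth f) {a q : ℝ}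
    (h : f a < q) : ∃ u v, u < v ∧ ∀ x ∈ Ioo u v, f x < q := by
  obtain ⟨g, h', hg, hh, hfg, hfh, hmem⟩ := hf a
  -- Since the value lies between the one-sided limits, one of these is also below `q`, and an
  -- interval on that side works.
  have hmin : min (g a) (h' a) < q := lt_of_le_of_lt hmem.1 h
  rcases min_lt_iff.1 hmin with hlt | hlt
  · have h1 : ∀ᶠ x in 𝓝[<] a, f x < q := by
      filter_upwards [hfg, nhdsWithin_le_nhds (hg.continuous.continuousAt.eventually
        (gt_mem_nhds hlt))] with x hx hx'
      rwa [hx]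
    obtain ⟨l, hl, hI⟩ := mem_nhdsLT_iff_exists_Ioo_subset.1 h1
    exact ⟨l, a, hl, hI⟩
  · have h1 : ∀ᶠ x in 𝓝[>] a, f x < q := by
      filter_upwards [hfh, nhdsWithin_le_nhds (hh.continuous.continuousAt.eventually
        (gt_mem_nhds hlt))] with x hx hx'
      rwa [hx]
    obtain ⟨l, hl, hI⟩ := mem_nhdsGT_iff_exists_Ioo_subset.1 h1
    exact ⟨a, l, hl, hI⟩

theorem PiecewiseSmooth.neg {f : ℝ → ℝ} (hf : PiecewiseSmooth f) :
    PiecewiseSmooth fun x => -f x := fun a => by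
  obtain ⟨g, h, hg, hh, hfg, hfh, hmem⟩ := hf a
  refine ⟨fun x => -g x, fun x => -h x, hg.neg, hh.neg, ?_, ?_, ?_⟩
  · filter_upwards [hfg] with x hx
    rw [hx]
  · filter_upwards [hfh] with x hx
    rw [hx]
  · rw [uIcc_comm, mem_uIcc] at hmem ⊢
    rcases hmem with h | h
    · exact Or.inr ⟨neg_le_neg h.2, neg_le_neg h.1⟩
    · exact Or.inl ⟨neg_le_neg h.2, neg_le_neg h.1⟩

/-! ### Multiplication operators -/

/-- Bounded measurable real functions. -/
structure BddMeas (α : Type*) [MeasurableSpace α] where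
  toFun : α → ℝ
  measurable : Measurable toFun
  bounded : ∃ C, ∀ x, |toFun x| ≤ C

section Multiplication

variable {α : Type*} [MeasurableSpace α] (μ : Measure α)

theorem BddMeas.memLp_mul (a : BddMeas α) (x : Lp ℂ 2 μ) :
    MemLp (fun t => (a.toFun t : ℂ) * x t) 2 μ := by
  obtain ⟨C, hC⟩ := a.bounded
  refine (Lp.memLp x).of_le_mul (c := C)
    ((Complex.measurable_ofReal.comp a.measurable).aestronglyMeasurable.mul
      (Lp.aestronglyMeasurable x)) (Eventually.of_forall fun t => ?_)
  rw [norm_mul, Complex.norm_real, Real.norm_eq_abs]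
  exact mul_le_mul_of_nonneg_right (hC t) (norm_nonneg _)

/-- Multiplication by a bounded measurable real function, as an operator in `L²`. -/
def mulOp (a : BddMeas α) : Lp ℂ 2 μ →L[ℂ] Lp ℂ 2 μ :=
  LinearMap.mkContinuousOfExistsBound
    { toFun := fun x => (a.memLp_mul μ x).toLp
      map_add' := fun x y => by
        rw [← MemLp.toLp_add]
        refine MemLp.toLp_congr _ _ ?_
        filter_upwards [Lp.coeFn_add x y] with t ht
        rw [ht, Pi.add_apply, Pi.add_apply, mul_add]
      map_smul' := fun c x => by
        rw [RingHom.id_apply, ← MemLp.toLp_const_smul]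
        refine MemLp.toLp_congr _ _ ?_
        filter_upwards [Lp.coeFn_smul c x] with t ht
        rw [ht, Pi.smul_apply, Pi.smul_apply, smul_eq_mul, smul_eq_mul]
        ring }
    (by
      obtain ⟨C, hC⟩ := a.bounded
      refine ⟨C, fun x => Lp.norm_le_mul_norm_of_ae_le_mul ?_⟩
      filter_upwards [(a.memLp_mul μ x).coeFn_toLp] with t ht
      change ‖(a.memLp_mul μ x).toLp _ t‖ ≤ _
      rw [ht, norm_mul, Complex.norm_real, Real.norm_eq_abs]
      exact mul_le_mul_of_nonneg_right (hC t) (norm_nonneg _))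

variable {μ}

theorem coeFn_mulOp (a : BddMeas α) (x : Lp ℂ 2 μ) :
    mulOp μ a x =ᵐ[μ] fun t => (a.toFun t : ℂ) * x t :=
  (a.memLp_mul μ x).coeFn_toLp

theorem norm_mulOp_le {a b : BddMeas α} {c : ℝ} (h : ∀ t, |a.toFun t| ≤ c * |b.toFun t|)
    (x : Lp ℂ 2 μ) : ‖mulOp μ a x‖ ≤ c * ‖mulOp μ b x‖ := by
  refine Lp.norm_le_mul_norm_of_ae_le_mul ?_
  filter_upwards [coeFn_mulOp a x, coeFn_mulOp b x] with t h1 h2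
  rw [h1, h2, norm_mul, norm_mul, Complex.norm_real, Complex.norm_real, Real.norm_eq_abs,
    Real.norm_eq_abs, ← mul_assoc]
  exact mul_le_mul_of_nonneg_right (h t) (norm_nonneg _)

theorem mulOp_mulOp {a b c : BddMeas α} (h : ∀ t, a.toFun t * b.toFun t = c.toFun t)
    (x : Lp ℂ 2 μ) : mulOp μ a (mulOp μ b x) = mulOp μ c x := by
  refine Lp.ext ?_
  filter_upwards [coeFn_mulOp a (mulOp μ b x), coeFn_mulOp b x, coeFn_mulOp c x] with t h1 h2 h3
  rw [h1, h2, h3, ← h t]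
  push_cast
  ring

theorem mulOp_eq_smul {a : BddMeas α} {c : ℝ} (h : ∀ t, a.toFun t = c) (x : Lp ℂ 2 μ) :
    mulOp μ a x = (c : ℂ) • x := by
  refine Lp.ext ?_
  filter_upwards [coeFn_mulOp a x, Lp.coeFn_smul (c : ℂ) x] with t h1 h2
  rw [h1, h2, h t]
  rfl

theorem inner_mulOp_left (a : BddMeas α) (x y : Lp ℂ 2 μ) :
    inner ℂ (mulOp μ a x) y = inner ℂ x (mulOp μ a y) := by
  rw [L2.inner_def, L2.inner_def]
  refine integral_congr_ae ?_
  filter_upwards [coeFn_mulOp a x, coeFn_mulOp a y] with t h1 h2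
  rw [h1, h2, ← smul_eq_mul, ← smul_eq_mul, inner_smul_left, inner_smul_right, Complex.conj_ofReal]

theorem mulOp_eq_zero {a : BddMeas α} (ha : ∀ t, a.toFun t ≠ 0) {x : Lp ℂ 2 μ}
    (h : mulOp μ a x = 0) : x = 0 := by
  rw [Lp.eq_zero_iff_ae_eq_zero] at h ⊢
  filter_upwards [h, coeFn_mulOp a x] with t h1 h2
  rw [h2] at h1
  exact (mul_eq_zero.1 h1).resolve_left (Complex.ofReal_ne_zero.2 (ha t))

/-- The square root of a bounded measurable function. -/
def BddMeas.sqrt (a : BddMeas α) : BddMeas α where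
  toFun t := √(a.toFun t)
  measurable := a.measurable.sqrt
  bounded := by
    obtain ⟨C, hC⟩ := a.bounded
    refine ⟨√C, fun x => ?_⟩
    rw [abs_of_nonneg (Real.sqrt_nonneg _)]
    exact Real.sqrt_le_sqrt ((le_abs_self _).trans (hC x))

theorem inner_mulOp_sqrt {a : BddMeas α} (ha : ∀ t, 0 ≤ a.toFun t) (x y : Lp ℂ 2 μ) :
    inner ℂ (mulOp μ a.sqrt x) (mulOp μ a.sqrt y) = inner ℂ (mulOp μ a x) y := by
  rw [← inner_mulOp_left]
  congr 1
  exact mulOp_mulOp (fun t => Real.mul_self_sqrt (ha t)) x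

theorem norm_sq_mulOp_sqrt {a : BddMeas α} (ha : ∀ t, 0 ≤ a.toFun t) (x : Lp ℂ 2 μ) :
    ‖mulOp μ a.sqrt x‖ ^ 2 = (inner ℂ (mulOp μ a x) x).re := by
  rw [← inner_mulOp_sqrt ha, inner_self_eq_ofReal_norm_sq, Complex.ofReal_re]

end Multiplication

/-! ### Operators in `L²(0, L)` -/

/-- The vectors are the normalized indicators of n + 1 adjacent subintervals of equal length. -/
theorem exists_orthonormal_supported {L u v : ℝ} (hu : 0 ≤ u) (huv : u < v) (hv : v ≤ L) (n : ℕ) :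
    ∃ g : Fin (n + 1) → L2 L, Orthonormal ℂ g ∧
      ∀ i, ∀ᵐ x ∂(volume.restrict (Ioo 0 L)), x ∉ Ioo u v → g i x = 0 := by
  set h : ℝ := (v - u) / (n + 1) with hh
  have hh0 : 0 < h := div_pos (sub_pos.2 huv) (by positivity)
  have hend : u + (n + 1) * h = v := by rw [hh]; field_simp; ring
  let I : Fin (n + 1) → Set ℝ := fun i => Ioo (u + i * h) (u + (i + 1) * h)
  have hI : ∀ i, I i ⊆ Ioo u v := fun i x hx => by
    have h1 : (i : ℝ) ≤ n := by exact_mod_cast Nat.lt_succ_iff.1 i.2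
    have h2 : (0 : ℝ) ≤ i := Nat.cast_nonneg _
    refine ⟨lt_of_le_of_lt ?_ hx.1, lt_of_lt_of_le hx.2 ?_⟩
    · nlinarith
    · rw [← hend]; gcongr
  have hIm : ∀ i, MeasurableSet (I i) := fun i => measurableSet_Ioo
  have hIf : ∀ i, volume.restrict (Ioo 0 L) (I i) ≠ ⊤ := fun i => measure_ne_top _ _
  have hIr : ∀ i, (volume.restrict (Ioo 0 L)).real (I i) = h := fun i => by
    have : I i ⊆ Ioo 0 L := (hI i).trans (Ioo_subset_Ioo hu hv)
    rw [measureReal_restrict_apply (hIm i), inter_eq_left.2 this, Real.volume_real_Ioo_of_le]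
    · ring
    · nlinarith
  have hdisj : ∀ i j : Fin (n + 1), i < j → I i ∩ I j = ∅ := fun i j hij => by
    rw [Ioo_inter_Ioo, Ioo_eq_empty]
    have h1 : (i : ℝ) + 1 ≤ j := by exact_mod_cast hij
    rw [not_lt]
    refine (min_le_left _ _).trans (le_trans ?_ (le_max_right _ _))
    gcongr
  let f : Fin (n + 1) → L2 L := fun i => indicatorConstLp 2 (hIm i) (hIf i) (1 : ℂ)
  have hf : ∀ i j, inner ℂ (f i) (f j) = ((volume.restrict (Ioo 0 L)).real (I i ∩ I j) : ℂ) :=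
    fun i j => L2.inner_indicatorConstLp_one_indicatorConstLp_one (hIm i) (hIm j) (hIf i) (hIf j)
  have hsq : ((√h : ℝ) : ℂ) ≠ 0 := Complex.ofReal_ne_zero.2 (Real.sqrt_pos.2 hh0).ne'
  refine ⟨fun i => ((√h : ℝ) : ℂ)⁻¹ • f i, ?_, fun i => ?_⟩
  · rw [orthonormal_iff_ite]
    intro i j
    rw [inner_smul_left, inner_smul_right, hf, map_inv₀, Complex.conj_ofReal]
    split_ifs with hij
    · subst hij
      rw [inter_self, hIr]
      have : ((√h : ℝ) : ℂ) * ((√h : ℝ) : ℂ) = h := by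
        rw [← Complex.ofReal_mul, Real.mul_self_sqrt hh0.le]
      field_simp
      rw [sq, this]
    · have : I i ∩ I j = ∅ := by
        rcases lt_or_gt_of_ne hij with h1 | h1
        · exact hdisj i j h1
        · rw [inter_comm]; exact hdisj j i h1
      rw [this, measureReal_empty]
      simp
  · filter_upwards [Lp.coeFn_smul ((√h : ℝ) : ℂ)⁻¹ (f i),
      indicatorConstLp_coeFn_notMem (p := 2) (hs := hIm i) (hμs := hIf i) (c := (1 : ℂ))]
      with x h1 h2 hx
    rw [h1, Pi.smul_apply, h2 fun hxI => hx (hI i hxI), smul_zero]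

/-- An element of the domain that solves the equation tested against the domain solves it in L²,
because the domain is dense. Hence the two eigenspaces correspond under the inclusion. -/
theorem rank_operatorEigenspace {L : ℝ} {K : L2 L →ₗ.[ℂ] L2 L} (hK : Dense (K.domain : Set (L2 L)))
    (V : BddMeas ℝ) (k μ : ℝ) :
    Module.rank ℂ (operatorEigenspace K V.toFun k μ) =
      Module.rank ℂ (formEigenspace K.domain.subtype
        (operatorForm K (mulOp (volume.restrict (Ioo 0 L)) V) k) μ) := by
  have hae : ∀ ψ : K.domain, (∀ᵐ x ∂(volume.restrict (Ioo 0 L)),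
      K ψ x + (k : ℂ) ^ 2 * (V.toFun x : ℂ) * (ψ : L2 L) x = (μ : ℂ) * (ψ : L2 L) x) ↔
      K ψ + ((k ^ 2 : ℝ) : ℂ) • mulOp (volume.restrict (Ioo 0 L)) V ψ = (μ : ℂ) • (ψ : L2 L) := by
    intro ψ
    rw [Lp.ext_iff]
    have h1 := Lp.coeFn_add (K ψ) (((k ^ 2 : ℝ) : ℂ) • mulOp (volume.restrict (Ioo 0 L)) V ψ)
    have h2 := Lp.coeFn_smul (((k ^ 2 : ℝ) : ℂ)) (mulOp (volume.restrict (Ioo 0 L)) V ψ)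
    have h3 := coeFn_mulOp V (ψ : L2 L)
    have h4 := Lp.coeFn_smul (μ : ℂ) (ψ : L2 L)
    constructor
    · intro h
      filter_upwards [h, h1, h2, h3, h4] with x g g1 g2 g3 g4
      rw [g1, g4, Pi.add_apply, g2, Pi.smul_apply, Pi.smul_apply, g3, smul_eq_mul, smul_eq_mul,
        ← g]
      push_cast
      ring
    · intro h
      filter_upwards [h, h1, h2, h3, h4] with x g g1 g2 g3 g4
      rw [g1, g4, Pi.add_apply, g2, Pi.smul_apply, Pi.smul_apply, g3, smul_eq_mul,
        smul_eq_mul] at g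
      rw [← g]
      push_cast
      ring
  have hmap : operatorEigenspace K V.toFun k μ = (formEigenspace K.domain.subtype
      (operatorForm K (mulOp (volume.restrict (Ioo 0 L)) V) k) μ).map K.domain.subtype := by
    ext ψ
    rw [Submodule.mem_map]
    constructor
    · rintro ⟨h, hψ⟩
      refine ⟨⟨ψ, h⟩, fun y => ?_, rfl⟩
      rw [operatorForm_apply, (hae ⟨ψ, h⟩).1 hψ, inner_smul_left, Complex.conj_ofReal]
      rfl
    · rintro ⟨ψ, hψ, rfl⟩
      refine ⟨ψ.2, (hae ψ).2 ?_⟩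
      refine hK.eq_of_inner_left (𝕜 := ℂ) fun y hy => ?_
      have := hψ ⟨y, hy⟩
      rw [operatorForm_apply] at this
      rw [this, inner_smul_left, Complex.conj_ofReal]
      rfl
  rw [hmap]
  exact LinearEquiv.rank_eq (Submodule.equivMapOfInjective _ Subtype.val_injective _).symm

theorem allBandsHaveSlope_operatorEigenspace {c L : ℝ} (hc : 0 < c) (hL : 0 < L)
    {K : L2 L →ₗ.[ℂ] L2 L} {V : ℝ → ℝ} (hK : IsPosSemidefDiscrete K) (hV : PiecewiseSmooth V)
    (hVp : Function.Periodic V L) (hV0 : ∀ x, 0 < V x) :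
    AllBandsHaveSlope c (operatorEigenspace K V) (c * √(⨅ x, V x)) := by
  have htame := hV.isTame hL hVp
  let W : BddMeas ℝ := ⟨V, htame.measurable, htame.bounded⟩
  have hbdd : BddBelow (range V) := ⟨0, by rintro _ ⟨x, rfl⟩; exact (hV0 x).le⟩
  set v₂ := ⨅ x, V x with hv₂
  have hv0 : 0 ≤ v₂ := Real.iInf_nonneg fun x => (hV0 x).le
  have hvle : ∀ x, v₂ ≤ V x := fun x => ciInf_le hbdd x
  have hW0 : ∀ x, 0 ≤ W.toFun x := fun x => (hV0 x).le
  refine (isQuadraticPencil_operatorForm hK.selfAdjoint hK.nonneg hK.compactResolvent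
    (B := mulOp (volume.restrict (Ioo 0 L)) W) (v₂ := v₂) (fun x y => inner_mulOp_left W x y)
    hv0 (fun x => ?_) (fun x hx => ?_) fun ε hε n => ?_).allBandsHaveSlope hc fun k μ =>
      rank_operatorEigenspace hK.selfAdjoint.dense_domain W k μ
  · rw [← norm_sq_mulOp_sqrt hW0]
    have h2 := norm_mulOp_le (μ := volume.restrict (Ioo 0 L))
      (a := ⟨fun _ => √v₂, measurable_const, |√v₂|, fun _ => le_rfl⟩) (b := W.sqrt) (c := 1)
      (fun t => by
        rw [one_mul]
        exact abs_le_abs_of_nonneg (Real.sqrt_nonneg _) (Real.sqrt_le_sqrt (hvle t))) x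
    rw [mulOp_eq_smul (c := √v₂) fun _ => rfl, norm_smul, one_mul, Complex.norm_real,
      Real.norm_of_nonneg (Real.sqrt_nonneg _)] at h2
    calc v₂ * ‖x‖ ^ 2 = (√v₂ * ‖x‖) ^ 2 := by rw [mul_pow, Real.sq_sqrt hv0]
      _ ≤ _ := by gcongr
  · rw [← norm_sq_mulOp_sqrt hW0]
    have h1 : mulOp (volume.restrict (Ioo 0 L)) W.sqrt x ≠ 0 := fun h =>
      hx (mulOp_eq_zero (fun t => (Real.sqrt_pos.2 (hV0 t)).ne') h)
    positivity
  · obtain ⟨a, ha⟩ := exists_lt_of_ciInf_lt (show ⨅ x, V x < v₂ + ε by rw [← hv₂]; linarith)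
    obtain ⟨u, v, huv, hI⟩ := hV.exists_Ioo_lt ha
    -- The interval where V is nearly minimal is translated by whole periods until its left end lies
    -- in [0, L), and is then cut off at L.
    set j := ⌊u / L⌋ with hj
    have hj1 : 0 ≤ u - j * L := by
      have := Int.floor_le (u / L)
      rw [le_div_iff₀ hL] at this
      linarith
    have hj2 : u - j * L < L := by
      have := Int.lt_floor_add_one (u / L)
      rw [div_lt_iff₀ hL] at this
      linarith
    obtain ⟨g, hg, hg0⟩ := exists_orthonormal_supported hj1
      (lt_min (sub_lt_sub_right huv (j * L)) hj2) (min_le_right (v - j * L) L) n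
    refine ⟨g, hg, fun b => ?_⟩
    rw [← norm_sq_mulOp_sqrt hW0]
    have hlt : ∀ x ∈ Ioo (u - j * L) (min (v - j * L) L), V x < v₂ + ε := fun x hx => by
      have h1 := hI (x + j * L) ⟨by linarith [hx.1], by linarith [hx.2.trans_le (min_le_left _ _)]⟩
      rwa [hVp.int_mul j x] at h1
    have hsupp : ∀ᵐ x ∂(volume.restrict (Ioo 0 L)),
        x ∉ Ioo (u - j * L) (min (v - j * L) L) → (∑ i, b i • g i : L2 L) x = 0 := by
      have h1 := Lp.coeFn_finsetSum Finset.univ fun i => b i • g i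
      have h2 : ∀ᵐ x ∂(volume.restrict (Ioo 0 L)), ∀ i, (b i • g i : L2 L) x = b i • g i x :=
        ae_all_iff.2 fun i => Lp.coeFn_smul (b i) (g i)
      filter_upwards [h1, h2, ae_all_iff.2 hg0] with x g1 g2 g3 hx
      rw [g1, Finset.sum_apply]
      refine Finset.sum_eq_zero fun i _ => ?_
      rw [g2, g3 i hx, smul_zero]
    have hbound : ‖mulOp (volume.restrict (Ioo 0 L)) W.sqrt (∑ i, b i • g i)‖ ≤
        √(v₂ + ε) * ‖∑ i, b i • g i‖ := by
      refine Lp.norm_le_mul_norm_of_ae_le_mul ?_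
      filter_upwards [hsupp, coeFn_mulOp W.sqrt (∑ i, b i • g i : L2 L)] with x h1 h2
      rw [h2, norm_mul, Complex.norm_real, Real.norm_eq_abs]
      by_cases hx : x ∈ Ioo (u - j * L) (min (v - j * L) L)
      · refine mul_le_mul_of_nonneg_right ?_ (norm_nonneg _)
        rw [show W.sqrt.toFun x = √(V x) from rfl, abs_of_nonneg (Real.sqrt_nonneg _)]
        exact Real.sqrt_le_sqrt (hlt x hx).le
      · rw [h1 hx]
        simp
    calc _ ≤ (√(v₂ + ε) * ‖∑ i, b i • g i‖) ^ 2 := by gcongr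
      _ = _ := by rw [mul_pow, Real.sq_sqrt (by linarith)]

/-! ### Fourier multipliers with square summable symbol -/

section FourierMultiplier

variable {L : ℝ} [hL : Fact (0 < L)]

/-- The Hilbert space of square integrable functions on the circle of length `L`. -/
abbrev CircleL2 (L : ℝ) [Fact (0 < L)] : Type := Lp ℂ 2 (AddCircle.haarAddCircle (T := L))

/-- The Fourier coefficients of a square integrable function on the circle. -/
abbrev coeff (x : CircleL2 L) (n : ℤ) : ℂ := inner ℂ (fourierLp (T := L) 2 n) x

theorem hasSum_coeff (x : CircleL2 L) :
    HasSum (fun n => coeff x n • fourierLp (T := L) 2 n) x := by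
  have h := (fourierBasis (T := L)).hasSum_repr x
  simpa only [HilbertBasis.repr_apply_apply, coe_fourierBasis] using h

theorem hasSum_norm_sq_coeff (x : CircleL2 L) :
    HasSum (fun n => ‖coeff x n‖ ^ 2) (‖x‖ ^ 2) := by
  have h := ((fourierBasis (T := L)).hasSum_inner_mul_inner x x).mapL Complex.reCLM
  simp only [coe_fourierBasis, Complex.reCLM_apply] at h
  rw [inner_self_eq_ofReal_norm_sq, Complex.ofReal_re] at h
  refine h.congr_fun fun n => ?_
  rw [← inner_conj_symm, Complex.conj_mul', ← Complex.ofReal_pow, Complex.ofReal_re]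

theorem eq_zero_of_coeff_eq_zero {x : CircleL2 L} (h : ∀ n, coeff x n = 0) : x = 0 := by
  have h1 := hasSum_coeff x
  simp only [h, zero_smul] at h1
  exact h1.unique hasSum_zero

/-- By the Cauchy-Schwarz inequality a square summable symbol makes the Fourier series converge
absolutely in the sup norm, which yields continuous representatives. -/
theorem summable_mul_coeff {τ : ℤ → ℝ} (hτ : Summable fun n => τ n ^ 2) (x : CircleL2 L) :
    Summable (fun n => ‖((τ n : ℂ) * coeff x n) • fourier (T := L) n‖) ∧
      ∑' n, ‖((τ n : ℂ) * coeff x n) • fourier (T := L) n‖ ≤ √(∑' n, τ n ^ 2) * ‖x‖ := by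
  have h := Real.summable_and_inner_le_Lp_mul_Lq_tsum_of_nonneg (f := fun n => |τ n|)
    (g := fun n => ‖coeff x n‖) Real.HolderConjugate.two_two (fun _ => abs_nonneg _)
    (fun _ => norm_nonneg _) (by simpa using hτ)
    (by simpa using (hasSum_norm_sq_coeff x).summable)
  simp only [Real.rpow_two, sq_abs, (hasSum_norm_sq_coeff x).tsum_eq, ← Real.sqrt_eq_rpow,
    Real.sqrt_sq (norm_nonneg x)] at h
  have e : ∀ n, ‖((τ n : ℂ) * coeff x n) • fourier (T := L) n‖ = |τ n| * ‖coeff x n‖ := fun n => by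
    rw [norm_smul, norm_mul, Complex.norm_real, Real.norm_eq_abs, fourier_norm, mul_one]
  simpa only [e] using h

/-- The Fourier multiplier with a square summable symbol, with values in continuous functions. -/
def fourierMul (τ : ℤ → ℝ) (hτ : Summable fun n => τ n ^ 2) :
    CircleL2 L →L[ℂ] C(AddCircle L, ℂ) :=
  LinearMap.mkContinuous
    { toFun := fun x => ∑' n, ((τ n : ℂ) * coeff x n) • fourier (T := L) n
      map_add' := fun x y => by
        rw [← (summable_mul_coeff hτ x).1.of_norm.tsum_add (summable_mul_coeff hτ y).1.of_norm]
        refine tsum_congr fun n => ?_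
        rw [coeff, inner_add_right, mul_add, add_smul]
      map_smul' := fun c x => by
        rw [RingHom.id_apply, ← tsum_const_smul'']
        refine tsum_congr fun n => ?_
        rw [coeff, inner_smul_right, smul_smul, mul_left_comm] }
    (√(∑' n, τ n ^ 2)) fun x =>
      (norm_tsum_le_tsum_norm (summable_mul_coeff hτ x).1).trans (summable_mul_coeff hτ x).2

variable {τ : ℤ → ℝ} (hτ : Summable fun n => τ n ^ 2)

theorem hasSum_fourierMul (x : CircleL2 L) :
    HasSum (fun n => ((τ n : ℂ) * coeff x n) • fourier (T := L) n) (fourierMul τ hτ x) :=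
  (summable_mul_coeff hτ x).1.of_norm.hasSum

theorem norm_fourierMul_le : ‖fourierMul (L := L) τ hτ‖ ≤ √(∑' n, τ n ^ 2) :=
  LinearMap.mkContinuous_norm_le _ (Real.sqrt_nonneg _) _

/-- The Fourier multiplier with a square summable symbol. -/
def fourierOp (τ : ℤ → ℝ) (hτ : Summable fun n => τ n ^ 2) : CircleL2 L →L[ℂ] CircleL2 L :=
  (ContinuousMap.toLp 2 AddCircle.haarAddCircle ℂ).comp (fourierMul τ hτ)

theorem coeFn_fourierOp (x : CircleL2 L) :
    fourierOp τ hτ x =ᵐ[AddCircle.haarAddCircle] fourierMul τ hτ x :=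
  ContinuousMap.coeFn_toLp _ _

theorem hasSum_fourierOp (x : CircleL2 L) :
    HasSum (fun n => ((τ n : ℂ) * coeff x n) • fourierLp (T := L) 2 n) (fourierOp τ hτ x) := by
  have h := (hasSum_fourierMul hτ x).mapL (ContinuousMap.toLp 2 AddCircle.haarAddCircle ℂ)
  simp only [map_smul] at h
  exact h

theorem coeff_fourierOp (x : CircleL2 L) (n : ℤ) :
    coeff (fourierOp τ hτ x) n = (τ n : ℂ) * coeff x n := by
  have h := (hasSum_fourierOp hτ x).mapL (innerSL ℂ (fourierLp (T := L) 2 n))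
  refine h.unique ?_
  simp only [innerSL_apply_apply, inner_smul_right]
  refine (hasSum_ite_eq n ((τ n : ℂ) * coeff x n)).congr_fun fun m => ?_
  rw [orthonormal_iff_ite.1 orthonormal_fourier]
  split_ifs with h1 h2 h2
  · rw [h1, mul_one]
  · exact absurd h1.symm h2
  · exact absurd h2.symm h1
  · rw [mul_zero]

theorem fourierOp_eq_zero (h0 : ∀ n, τ n ≠ 0) {x : CircleL2 L} (h : fourierOp τ hτ x = 0) :
    x = 0 := by
  refine eq_zero_of_coeff_eq_zero fun n => ?_
  have h1 := coeff_fourierOp hτ x n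
  rw [h, coeff, inner_zero_right] at h1
  exact (mul_eq_zero.1 h1.symm).resolve_left (Complex.ofReal_ne_zero.2 (h0 n))

theorem inner_fourierOp_left (x y : CircleL2 L) :
    inner ℂ (fourierOp τ hτ x) y = inner ℂ x (fourierOp τ hτ y) := by
  have h1 := (fourierBasis (T := L)).hasSum_inner_mul_inner (fourierOp τ hτ x) y
  have h2 := (fourierBasis (T := L)).hasSum_inner_mul_inner x (fourierOp τ hτ y)
  simp only [coe_fourierBasis] at h1 h2
  refine h1.unique (h2.congr_fun fun n => ?_)
  rw [← inner_conj_symm, ← inner_conj_symm x]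
  have e1 := coeff_fourierOp hτ x n
  have e2 := coeff_fourierOp hτ y n
  rw [coeff] at e1 e2
  rw [e1, e2, map_mul, Complex.conj_ofReal]
  ring

/-- The operator is the norm limit of its finite-rank truncations: the error is the multiplier with
the symbol cut off, whose norm is controlled by a tail of the sum of squares. -/
theorem isCompactOperator_fourierOp : IsCompactOperator (fourierOp (L := L) τ hτ) := by
  have hs : ∀ s : Finset ℤ, Summable fun n => (if n ∈ s then 0 else τ n) ^ 2 := fun s =>
    hτ.of_nonneg_of_le (fun _ => sq_nonneg _) fun n => by
      split_ifs
      · rw [zero_pow two_ne_zero]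
        exact sq_nonneg _
      · exact le_rfl
  let F : Finset ℤ → CircleL2 L →L[ℂ] CircleL2 L := fun s =>
    ∑ n ∈ s, ((innerSL ℂ (fourierLp (T := L) 2 n)).smulRight ((τ n : ℂ) • fourierLp (T := L) 2 n))
  have hF : ∀ s, fourierOp τ hτ - F s = fourierOp _ (hs s) := fun s => by
    ext1 x
    rw [← sub_eq_zero]
    refine eq_zero_of_coeff_eq_zero fun n => ?_
    have e1 := coeff_fourierOp hτ x n
    have e2 := coeff_fourierOp (hs s) x n
    rw [coeff] at e1 e2 ⊢
    rw [inner_sub_right, e2, sub_apply, inner_sub_right, e1,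
      sum_apply, inner_sum]
    simp only [ContinuousLinearMap.smulRight_apply, innerSL_apply_apply, inner_smul_right,
      orthonormal_iff_ite.1 orthonormal_fourier, mul_ite, mul_one, mul_zero,
      Finset.sum_ite_eq]
    split_ifs <;> simp [mul_comm]
  have hlim : Tendsto F atTop (𝓝 (fourierOp τ hτ)) := by
    rw [tendsto_iff_norm_sub_tendsto_zero]
    have h1 : Tendsto (fun s : Finset ℤ =>
        ‖(ContinuousMap.toLp 2 AddCircle.haarAddCircle ℂ : C(AddCircle L, ℂ) →L[ℂ] CircleL2 L)‖ *
          √(∑' n : {n // n ∉ s}, τ n ^ 2)) atTop (𝓝 0) := by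
      have := ((tendsto_tsum_compl_atTop_zero fun n => τ n ^ 2).sqrt).const_mul
        ‖(ContinuousMap.toLp 2 AddCircle.haarAddCircle ℂ : C(AddCircle L, ℂ) →L[ℂ] CircleL2 L)‖
      simpa using this
    refine squeeze_zero (fun _ => norm_nonneg _) (fun s => ?_) h1
    rw [norm_sub_rev, hF]
    refine (ContinuousLinearMap.opNorm_comp_le _ _).trans
      (mul_le_mul_of_nonneg_left ((norm_fourierMul_le _).trans (Real.sqrt_le_sqrt (le_of_eq ?_)))
        (norm_nonneg _))
    have e := tsum_subtype ({n | n ∉ s} : Set ℤ) fun n => τ n ^ 2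
    refine Eq.trans (tsum_congr fun n => ?_) e.symm
    by_cases h : n ∈ s <;> simp [h]
  refine isCompactOperator_of_tendsto hlim (Eventually.of_forall fun s => ?_)
  refine Finset.sum_induction _ (fun A : CircleL2 L →L[ℂ] CircleL2 L => IsCompactOperator A)
    (fun A B hA hB => hA.add hB) isCompactOperator_zero fun n _ => ?_
  exact (isCompactOperator_of_locallyCompactSpace_rng (ContinuousLinearMap.toSpanSingleton ℂ
    ((τ n : ℂ) • fourierLp (T := L) 2 n))).comp_clm (innerSL ℂ (fourierLp (T := L) 2 n))

end FourierMultiplier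

/-! ### Functions on the circle as periodic functions on the line -/

/-- The eigenvalues of the inverse of `-i d/dx + π / L` on periodic functions. -/
def invSymbol (L : ℝ) (n : ℤ) : ℝ := (2 * Real.pi * n / L + Real.pi / L)⁻¹

theorem summable_invSymbol_sq {L : ℝ} : Summable fun n => invSymbol L n ^ 2 := by
  have h := ((Real.summable_one_div_int_add_rpow (1 / 2) 2).2 one_lt_two).mul_left
    ((L / (2 * Real.pi)) ^ 2)
  refine h.congr fun n => ?_
  rw [Real.rpow_two, sq_abs, invSymbol, inv_pow, one_div, ← div_eq_mul_inv, ← div_pow, ← inv_pow]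
  congr 1
  rw [div_div, ← inv_div]
  congr 1
  ring

section Circle

variable {L : ℝ} [hL : Fact (0 < L)]

theorem ae_haarAddCircle_eq :
    ae (AddCircle.haarAddCircle (T := L)) = ae (volume : Measure (AddCircle L)) := by
  rw [AddCircle.volume_eq_smul_haarAddCircle]
  refine (Measure.ae_ennreal_smul_measure_eq ?_ _).symm
  simpa using hL.out

theorem ae_real_of_ae_circle {P : AddCircle L → Prop}
    (h : ∀ᵐ q ∂AddCircle.haarAddCircle, P q) : ∀ᵐ t : ℝ, P (t : AddCircle L) := by
  rw [ae_haarAddCircle_eq] at h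
  rw [← Measure.restrict_univ (μ := (volume : Measure ℝ)), ← iUnion_Ioc_add_zsmul hL.out 0,
    ae_restrict_iUnion_iff]
  intro n
  have h1 := (AddCircle.measurePreserving_mk L (0 + n • L)).quasiMeasurePreserving.ae h
  rwa [add_assoc, ← add_one_zsmul] at h1

theorem ae_circle_of_ae_real {P : AddCircle L → Prop} (h : ∀ᵐ t : ℝ, P (t : AddCircle L)) :
    ∀ᵐ q ∂AddCircle.haarAddCircle, P q := by
  rw [ae_haarAddCircle_eq]
  have h1 : ∀ᵐ y : ↥(Ioc (0 : ℝ) (0 + L)) ∂(Measure.comap Subtype.val volume),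
      P ((y : ℝ) : AddCircle L) := by
    refine (MeasurableEmbedding.subtype_coe measurableSet_Ioc).ae_map_iff
      (p := fun t : ℝ => P (t : AddCircle L)) |>.1 ?_
    rw [map_comap_subtype_coe measurableSet_Ioc]
    exact ae_restrict_of_ae h
  have h2 := (AddCircle.measurePreserving_equivIoc L (a := 0)).quasiMeasurePreserving.ae h1
  filter_upwards [h2] with q hq
  rwa [AddCircle.coe_equivIoc] at hq

theorem integrable_circle (x : CircleL2 L) : Integrable x (volume : Measure (AddCircle L)) := by
  rw [AddCircle.volume_eq_smul_haarAddCircle]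
  exact ((Lp.memLp x).integrable one_le_two).smul_measure ENNReal.ofReal_ne_top

theorem intervalIntegrable_circle (x : CircleL2 L) (a b : ℝ) :
    IntervalIntegrable (fun t : ℝ => x (t : AddCircle L)) volume a b := by
  have hp : Function.Periodic (fun t : ℝ => x (t : AddCircle L)) L := fun t => by
    simp only [AddCircle.coe_add_period]
  refine hp.intervalIntegrable₀ hL.out.ne' ?_ a b
  rw [intervalIntegrable_iff_integrableOn_Ioc_of_le hL.out.le]
  have := (AddCircle.measurePreserving_mk L 0).integrable_comp_of_integrable (integrable_circle x)
  rwa [zero_add] at this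

theorem integral_norm_circle_le (x : CircleL2 L) :
    ∫ q : AddCircle L, ‖x q‖ ≤ L * ‖x‖ := by
  have h1 : ∫ q, ‖x q‖ ∂(AddCircle.haarAddCircle (T := L)) ≤ ‖x‖ := by
    rw [integral_norm_eq_lintegral_enorm (Lp.aestronglyMeasurable x), Lp.norm_def,
      ← eLpNorm_one_eq_lintegral_enorm]
    exact ENNReal.toReal_mono (Lp.eLpNorm_ne_top x)
      (eLpNorm_le_eLpNorm_of_exponent_le one_le_two (Lp.aestronglyMeasurable x))
  rw [AddCircle.integral_haarAddCircle, smul_eq_mul] at h1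
  have := mul_le_mul_of_nonneg_left h1 hL.out.le
  rwa [mul_inv_cancel_left₀ hL.out.ne'] at this

theorem norm_integral_circle_le (a b : ℝ) :
    ∃ C, ∀ x : CircleL2 L, ‖∫ t in a..b, x (t : AddCircle L)‖ ≤ C * ‖x‖ := by
  obtain ⟨n, hn⟩ := exists_nat_ge (|b - a| / L)
  rw [div_le_iff₀ hL.out] at hn
  refine ⟨n * L, fun x => ?_⟩
  have hp : Function.Periodic (fun t : ℝ => ‖x (t : AddCircle L)‖) L := fun t => by
    simp only [AddCircle.coe_add_period]
  have hi : ∀ a b : ℝ, IntervalIntegrable (fun t : ℝ => ‖x (t : AddCircle L)‖) volume a b :=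
    fun a b => (intervalIntegrable_circle x a b).norm
  have h1 := hp.intervalIntegral_add_zsmul_eq n (min a b) hi
  rw [AddCircle.intervalIntegral_preimage L (min a b) fun q => ‖x q‖] at h1
  have hsub : uIoc a b ⊆ Ioc (min a b) (min a b + (n : ℤ) • L) := by
    refine Ioc_subset_Ioc_right ?_
    rw [zsmul_eq_mul, Int.cast_natCast]
    rcases le_total a b with h | h
    · rw [max_eq_right h, min_eq_left h]
      linarith [le_abs_self (b - a)]
    · rw [max_eq_left h, min_eq_right h]
      linarith [neg_abs_le (b - a)]
  have hle : min a b ≤ min a b + (n : ℤ) • L := by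
    rw [zsmul_eq_mul, Int.cast_natCast]
    have := mul_nonneg (Nat.cast_nonneg (α := ℝ) n) hL.out.le
    linarith
  calc ‖∫ t in a..b, x (t : AddCircle L)‖
      ≤ ∫ t in uIoc a b, ‖x (t : AddCircle L)‖ := intervalIntegral.norm_integral_le_integral_norm_uIoc
    _ ≤ ∫ t in Ioc (min a b) (min a b + (n : ℤ) • L), ‖x (t : AddCircle L)‖ :=
        setIntegral_mono_set ((hi _ _).1) (Eventually.of_forall fun _ => norm_nonneg _)
          hsub.eventuallyLE
    _ = (n : ℤ) • ∫ q : AddCircle L, ‖x q‖ := by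
        rw [← h1, intervalIntegral.integral_of_le hle]
    _ ≤ n * L * ‖x‖ := by
        rw [zsmul_eq_mul, Int.cast_natCast, mul_assoc]
        exact mul_le_mul_of_nonneg_left (integral_norm_circle_le x) (Nat.cast_nonneg n)

theorem intervalIntegral_congr_of_ae {f g : ℝ → ℂ} (h : ∀ᵐ t : ℝ, f t = g t) (a b : ℝ) :
    ∫ t in a..b, f t = ∫ t in a..b, g t :=
  intervalIntegral.integral_congr_ae (h.mono fun _ ht _ => ht)

/-- Integration over an interval, as a functional on square integrable functions. -/
def integralCLM (a b : ℝ) : CircleL2 L →L[ℂ] ℂ :=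
  LinearMap.mkContinuousOfExistsBound
    { toFun := fun x => ∫ t in a..b, x (t : AddCircle L)
      map_add' := fun x y => by
        rw [← intervalIntegral.integral_add (intervalIntegrable_circle x a b)
          (intervalIntegrable_circle y a b)]
        exact intervalIntegral_congr_of_ae (ae_real_of_ae_circle (Lp.coeFn_add x y)) a b
      map_smul' := fun c x => by
        rw [RingHom.id_apply, ← intervalIntegral.integral_smul]
        exact intervalIntegral_congr_of_ae (ae_real_of_ae_circle (Lp.coeFn_smul c x)) a b }
    (norm_integral_circle_le a b)

theorem integralCLM_congr {x : CircleL2 L} {f : ℝ → ℂ} (h : ∀ᵐ t : ℝ, x (t : AddCircle L) = f t)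
    (a b : ℝ) : integralCLM a b x = ∫ t in a..b, f t :=
  intervalIntegral_congr_of_ae h a b

/-! ### The inverse of `-i d/dx + π / L` on periodic functions -/

theorem invSymbol_ne_zero (n : ℤ) : invSymbol L n ≠ 0 := by
  have hL := hL.out
  refine inv_ne_zero ?_
  rw [← add_div]
  refine div_ne_zero ?_ hL.ne'
  have : 2 * Real.pi * n + Real.pi = Real.pi * ((2 * n + 1 : ℤ) : ℝ) := by
    push_cast
    ring
  rw [this]
  exact mul_ne_zero Real.pi_ne_zero (Int.cast_ne_zero.2 (by omega))

/-- The inverse of `-i d/dx + π / L`, in `L²`. -/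
def invD : CircleL2 L →L[ℂ] CircleL2 L := fourierOp (invSymbol L) summable_invSymbol_sq

/-- The continuous representative of `invD x`. -/
def invDFun (x : CircleL2 L) (t : ℝ) : ℂ :=
  fourierMul (invSymbol L) summable_invSymbol_sq x (t : AddCircle L)

theorem continuous_invDFun (x : CircleL2 L) : Continuous (invDFun x) :=
  (ContinuousMap.continuous _).comp (AddCircle.continuous_mk' L)

theorem periodic_invDFun (x : CircleL2 L) : Function.Periodic (invDFun x) L := fun t => by
  simp only [invDFun, AddCircle.coe_add_period]

theorem invDFun_add (x y : CircleL2 L) : invDFun (x + y) = invDFun x + invDFun y := by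
  ext t
  simp only [invDFun, map_add, Pi.add_apply, ContinuousMap.add_apply]

theorem invDFun_smul (c : ℂ) (x : CircleL2 L) : invDFun (c • x) = c • invDFun x := by
  ext t
  simp only [invDFun, map_smul, Pi.smul_apply, ContinuousMap.smul_apply]

theorem ae_invD (x : CircleL2 L) : ∀ᵐ t : ℝ, invD x (t : AddCircle L) = invDFun x t :=
  ae_real_of_ae_circle (coeFn_fourierOp summable_invSymbol_sq x)

theorem isCompactOperator_invD : IsCompactOperator (invD (L := L)) :=
  isCompactOperator_fourierOp _

theorem inner_invD_left (x y : CircleL2 L) : inner ℂ (invD x) y = inner ℂ x (invD y) :=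
  inner_fourierOp_left _ x y

theorem invD_eq_zero {x : CircleL2 L} (h : invD x = 0) : x = 0 :=
  fourierOp_eq_zero _ invSymbol_ne_zero h

/-- This is the integrated equation for a single mode, where it reduces to (2πn/L) σ_n = 1 - (π/L)
σ_n for the symbol σ_n. -/
theorem integralCLM_fourier (a b : ℝ) (n : ℤ) :
    (invSymbol L n : ℂ) * (fourier n (b : AddCircle L) - fourier n (a : AddCircle L)) =
      Complex.I * (1 - (Real.pi / L : ℝ) * (invSymbol L n : ℂ)) *
        integralCLM a b (fourierLp (T := L) 2 n) := by
  have hd := intervalIntegral.integral_eq_sub_of_hasDerivAt (a := a) (b := b)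
    (fun t _ => hasDerivAt_fourier L n t) (by
      refine Continuous.intervalIntegrable ?_ _ _
      exact continuous_const.mul ((ContinuousMap.continuous _).comp (AddCircle.continuous_mk' L)))
  rw [intervalIntegral.integral_const_mul] at hd
  rw [integralCLM_congr (ae_real_of_ae_circle (coeFn_fourierLp 2 n)), ← hd, ← mul_assoc]
  congr 1
  have h0 : ((invSymbol L n : ℝ) : ℂ)⁻¹ * invSymbol L n = 1 :=
    inv_mul_cancel₀ (Complex.ofReal_ne_zero.2 (invSymbol_ne_zero n))
  have h1 : ((invSymbol L n : ℝ) : ℂ)⁻¹ = 2 * Real.pi * n / L + Real.pi / L := by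
    rw [← Complex.ofReal_inv, invSymbol, inv_inv]
    push_cast
    ring
  rw [h1] at h0
  push_cast
  linear_combination Complex.I * h0

/-- The function u = `invDFun x` satisfies -i u' + (π/L) u = x in integrated form. Both sides are
continuous in `x`, so it suffices to sum the identity over Fourier modes; no series is
differentiated termwise. -/
theorem invDFun_sub (x : CircleL2 L) (a b : ℝ) :
    invDFun x b - invDFun x a =
      Complex.I * (integralCLM a b x - (Real.pi / L : ℝ) * integralCLM a b (invD x)) := by
  have h1 := (hasSum_fourierMul (summable_invSymbol_sq (L := L)) x)
  have hb := h1.mapL (ContinuousMap.evalCLM ℂ (b : AddCircle L))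
  have ha := h1.mapL (ContinuousMap.evalCLM ℂ (a : AddCircle L))
  have h2 := (hasSum_fourierOp (summable_invSymbol_sq (L := L)) x).mapL (integralCLM a b)
  have h3 := (hasSum_coeff x).mapL (integralCLM a b)
  refine (hb.sub ha).unique ?_
  refine ((h3.sub (h2.mul_left ((Real.pi / L : ℝ) : ℂ))).mul_left Complex.I).congr_fun fun n => ?_
  simp only [ContinuousMap.evalCLM_apply, map_smul, smul_eq_mul]
  linear_combination coeff x n * integralCLM_fourier (L := L) a b n

theorem invDFun_sub_eq_integral (x : CircleL2 L) {g : ℝ → ℂ}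
    (hg : ∀ᵐ t : ℝ, x (t : AddCircle L) = g t) (a b : ℝ) :
    IntervalIntegrable g volume a b ∧
    invDFun x b - invDFun x a =
      ∫ t in a..b, Complex.I * (g t - (Real.pi / L : ℝ) * invDFun x t) := by
  have hgi : IntervalIntegrable g volume a b :=
    (intervalIntegrable_circle x a b).congr_ae (ae_restrict_of_ae hg)
  refine ⟨hgi, ?_⟩
  rw [invDFun_sub, integralCLM_congr hg, integralCLM_congr (ae_invD x),
    intervalIntegral.integral_const_mul, intervalIntegral.integral_sub hgi,
    intervalIntegral.integral_const_mul]
  exact (continuous_const.mul (continuous_invDFun x)).intervalIntegrable _ _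

theorem hasDerivAt_invDFun (x : CircleL2 L) {g : ℝ → ℂ} (hgm : Measurable g)
    (hg : ∀ᵐ t : ℝ, x (t : AddCircle L) = g t) {t : ℝ} (ht : ContinuousAt g t) :
    HasDerivAt (invDFun x) (Complex.I * (g t - (Real.pi / L : ℝ) * invDFun x t)) t := by
  have hc := continuous_invDFun x
  have h : HasDerivAt (fun u => ∫ y in t..u, Complex.I * (g y - (Real.pi / L : ℝ) * invDFun x y))
      (Complex.I * (g t - (Real.pi / L : ℝ) * invDFun x t)) t := by
    refine intervalIntegral.integral_hasDerivAt_right IntervalIntegrable.refl ?_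
      ((ht.sub (continuousAt_const.mul hc.continuousAt)).const_mul _)
    exact (((hgm.sub (hc.measurable.const_mul _)).const_mul
      _).stronglyMeasurable).stronglyMeasurableAtFilter
  refine (h.const_add (invDFun x t)).congr_of_eventuallyEq (Eventually.of_forall fun u => ?_)
  dsimp only
  rw [← (invDFun_sub_eq_integral x hg t u).2]
  ring

/-- The periodic solution of `-i u' + (π / L) u = x` is unique. -/
theorem invDFun_eq (x : CircleL2 L) {U g : ℝ → ℂ} (hU : Continuous U)
    (hUp : Function.Periodic U L) (hg : ∀ᵐ t : ℝ, x (t : AddCircle L) = g t) {S : Set ℝ}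
    (hS : S.Countable)
    (hd : ∀ t, t ∉ S → HasDerivAt U (Complex.I * (g t - (Real.pi / L : ℝ) * U t)) t) :
    invDFun x = U := by
  have hc := continuous_invDFun x
  set s : ℂ := ((Real.pi / L : ℝ) : ℂ) with hs
  have hint : ∀ b, U b - U 0 = ∫ t in (0 : ℝ)..b, Complex.I * (g t - s * U t) := fun b => by
    refine (integral_eq_of_hasDerivAt_off_countable U _ hS hU.continuousOn
      (fun t ht => hd t ht.2) ?_).symm
    exact ((invDFun_sub_eq_integral x hg 0 b).1.sub
      ((continuous_const.mul hU).intervalIntegrable _ _)).const_mul _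
  -- The difference of two solutions satisfies the homogeneous equation in integrated form. As `W`
  -- is continuous, this removes the exceptional set and makes `W` differentiable everywhere.
  set W : ℝ → ℂ := fun t => invDFun x t - U t with hW
  have hWc : Continuous W := hc.sub hU
  have hWi : ∀ b, W b = W 0 + ∫ t in (0 : ℝ)..b, Complex.I * (-s * W t) := fun b => by
    have h1 := (invDFun_sub_eq_integral x hg 0 b).2
    have h2 := hint b
    have hgi := (invDFun_sub_eq_integral x hg 0 b).1
    have e : ∫ t in (0 : ℝ)..b, Complex.I * (-s * W t) =
        (∫ t in (0 : ℝ)..b, Complex.I * (g t - s * invDFun x t)) -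
          ∫ t in (0 : ℝ)..b, Complex.I * (g t - s * U t) := by
      have i1 : IntervalIntegrable (fun t => Complex.I * (g t - s * invDFun x t)) volume 0 b :=
        (hgi.sub ((continuous_const.mul hc).intervalIntegrable _ _)).const_mul _
      have i2 : IntervalIntegrable (fun t => Complex.I * (g t - s * U t)) volume 0 b :=
        (hgi.sub ((continuous_const.mul hU).intervalIntegrable _ _)).const_mul _
      rw [← intervalIntegral.integral_sub i1 i2]
      refine intervalIntegral.integral_congr fun t _ => ?_
      simp only [hW]
      ring
    rw [e, ← h1, ← h2]
    simp only [hW]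
    ring
  have hWd : ∀ t, HasDerivAt W (Complex.I * (-s * W t)) t := fun t => by
    have hcc : Continuous fun t => Complex.I * (-s * W t) :=
      continuous_const.mul (continuous_const.mul hWc)
    have := (hcc.integral_hasStrictDerivAt 0 t).hasDerivAt.const_add (W 0)
    exact this.congr_of_eventuallyEq (Eventually.of_forall hWi)
  have hEd : ∀ t : ℝ, HasDerivAt (fun t : ℝ => Complex.exp (Complex.I * s * t) * W t) 0 t :=
    fun t => by
    have h1 : HasDerivAt (fun t : ℝ => Complex.exp (Complex.I * s * t))
        (Complex.exp (Complex.I * s * t) * (Complex.I * s)) t := by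
      have h2 : HasDerivAt (fun t : ℝ => Complex.I * s * (t : ℂ)) (Complex.I * s) t := by
        simpa using (Complex.ofRealCLM.hasDerivAt (x := t)).const_mul (Complex.I * s)
      exact h2.cexp
    refine (h1.mul (hWd t)).congr_deriv ?_
    ring
  have hconst := is_const_of_deriv_eq_zero (fun t => (hEd t).differentiableAt)
    fun t => (hEd t).deriv
  ext t
  -- The function e^{ist} W is constant, while s L = π makes the exponential change sign over a
  -- period. Periodicity of `W` then forces it to vanish.
  have h1 := hconst (t + L) t
  have hper : W (t + L) = W t := by
    simp only [hW]
    rw [periodic_invDFun x t, hUp t]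
  have hexp : Complex.exp (Complex.I * s * ((t + L : ℝ) : ℂ)) =
      -Complex.exp (Complex.I * s * t) := by
    have e : Complex.I * s * ((t + L : ℝ) : ℂ) = Complex.I * s * t + Real.pi * Complex.I := by
      have hL' : (L : ℂ) ≠ 0 := Complex.ofReal_ne_zero.2 hL.out.ne'
      rw [hs]
      push_cast
      field_simp
    rw [e, Complex.exp_add, Complex.exp_pi_mul_I]
    ring
  simp only [hper, hexp] at h1
  have h2 : Complex.exp (Complex.I * s * t) * W t = 0 := by linear_combination (-1 / 2) * h1
  exact sub_eq_zero.1 ((mul_eq_zero.1 h2).resolve_left (Complex.exp_ne_zero _))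

end Circle

/-! ### Pencils of Gram forms -/

section Gram

variable {X : Type} [NormedAddCommGroup X] [InnerProductSpace ℂ X]
  {Y : Type*} [NormedAddCommGroup Y] [InnerProductSpace ℂ Y]

/-- The form `⟨(S₀ + k S₁) x, (S₀ + k S₁) y⟩ + k² ⟨S₂ x, S₂ y⟩`. -/
def gramForm (S₀ S₁ S₂ : X →L[ℂ] Y) (k : ℝ) : X →ₗ⋆[ℂ] X →ₗ[ℂ] ℂ :=
  LinearMap.mk₂'ₛₗ (starRingEnd ℂ) (RingHom.id ℂ)
    (fun x y => inner ℂ (S₀ x + (k : ℂ) • S₁ x) (S₀ y + (k : ℂ) • S₁ y) +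
      (k : ℂ) ^ 2 * inner ℂ (S₂ x) (S₂ y))
    (fun x x' y => by
      simp only [map_add, smul_add, inner_add_left, inner_add_right]
      ring)
    (fun c x y => by
      simp only [map_smul, inner_add_left, inner_add_right, inner_smul_left, smul_eq_mul]
      ring)
    (fun x y y' => by
      simp only [map_add, smul_add, inner_add_left, inner_add_right]
      ring)
    (fun c x y => by
      simp only [map_smul, inner_add_left, inner_add_right, inner_smul_right, smul_eq_mul,
        RingHom.id_apply]
      ring)

theorem gramForm_apply (S₀ S₁ S₂ : X →L[ℂ] Y) (k : ℝ) (x y : X) :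
    gramForm S₀ S₁ S₂ k x y = inner ℂ (S₀ x + (k : ℂ) • S₁ x) (S₀ y + (k : ℂ) • S₁ y) +
      (k : ℂ) ^ 2 * inner ℂ (S₂ x) (S₂ y) := rfl

theorem re_gramForm_self (S₀ S₁ S₂ : X →L[ℂ] Y) (k : ℝ) (x : X) :
    (gramForm S₀ S₁ S₂ k x x).re = ‖S₀ x + (k : ℂ) • S₁ x‖ ^ 2 + k ^ 2 * ‖S₂ x‖ ^ 2 := by
  rw [gramForm_apply, inner_self_eq_ofReal_norm_sq, inner_self_eq_ofReal_norm_sq,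
    ← Complex.ofReal_pow, ← Complex.ofReal_mul, ← Complex.ofReal_add, Complex.ofReal_re]

/-- Here the form domain is a Hilbert space, and the hypothesis makes the operator `N` of the form Q
+ ⟨ι, ι⟩ coercive. By Lax-Milgram `N` is invertible, and ι N⁻¹ ι* is a solution operator that
inherits compactness from ι. -/
theorem isDiscreteForm_gramForm [CompleteSpace X] [CompleteSpace Y] {ι S₀ S₁ S₂ : X →L[ℂ] Y} (k : ℝ)
    (hι : Function.Injective ι) (hc : IsCompactOperator ι) {C : ℝ}
    (hC : ∀ x, ‖x‖ ≤ C * (‖S₀ x + (k : ℂ) • S₁ x‖ + ‖ι x‖)) :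
    IsDiscreteForm (ι : X →ₗ[ℂ] Y) (gramForm S₀ S₁ S₂ k) where
  injective := hι
  hermitian x y := by
    rw [gramForm_apply, gramForm_apply, map_add, map_mul, inner_conj_symm, inner_conj_symm,
      map_pow, Complex.conj_ofReal]
  nonneg x := by
    rw [re_gramForm_self]
    positivity
  solvable := by
    set S : X →L[ℂ] Y := S₀ + (k : ℂ) • S₁ with hS
    set N : X →L[ℂ] X := S.adjoint ∘L S + ((k : ℂ) ^ 2) • (S₂.adjoint ∘L S₂) + ι.adjoint ∘L ι
      with hN
    have hNin : ∀ x y, inner ℂ (N x) y =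
        gramForm S₀ S₁ S₂ k x y + inner ℂ (ι x) (ι y) := fun x y => by
      have e : N x = S.adjoint (S x) + ((k : ℂ) ^ 2) • S₂.adjoint (S₂ x) + ι.adjoint (ι x) := rfl
      rw [e, inner_add_left, inner_add_left, inner_smul_left,
        ContinuousLinearMap.adjoint_inner_left, ContinuousLinearMap.adjoint_inner_left,
        ContinuousLinearMap.adjoint_inner_left, map_pow, Complex.conj_ofReal]
      rfl
    have hNc : ∀ x, ‖x‖ ^ 2 ≤ 2 * C ^ 2 * (inner ℂ (N x) x).re := fun x => by
      rw [hNin, Complex.add_re, re_gramForm_self, inner_self_eq_ofReal_norm_sq, Complex.ofReal_re]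
      set p := ‖S₀ x + (k : ℂ) • S₁ x‖
      set q := ‖ι x‖
      calc ‖x‖ ^ 2 ≤ (C * (p + q)) ^ 2 := by gcongr; exact hC x
        _ = C ^ 2 * (p + q) ^ 2 := by ring
        _ ≤ C ^ 2 * (2 * (p ^ 2 + k ^ 2 * ‖S₂ x‖ ^ 2 + q ^ 2)) := by
            gcongr
            nlinarith [sq_nonneg (p - q), sq_nonneg (k * ‖S₂ x‖)]
        _ = _ := by ring
    have hunit : IsUnit N := by
      have hpos : 0 < 2 * C ^ 2 + 1 := by positivity
      refine ContinuousLinearMap.isUnit_of_forall_le_norm_inner_map N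
        (c := ⟨(2 * C ^ 2 + 1)⁻¹, (inv_pos.2 hpos).le⟩) (inv_pos.2 hpos) fun x => ?_
      change ‖x‖ ^ 2 * (2 * C ^ 2 + 1)⁻¹ ≤ _
      rw [← div_eq_mul_inv, div_le_iff₀ hpos, mul_comm]
      have h1 := Complex.re_le_norm (inner ℂ (N x) x)
      have h2 := norm_nonneg (inner ℂ (N x) x)
      calc ‖x‖ ^ 2 ≤ 2 * C ^ 2 * (inner ℂ (N x) x).re := hNc x
        _ ≤ 2 * C ^ 2 * ‖inner ℂ (N x) x‖ := by gcongr
        _ ≤ _ := by gcongr; linarith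
    obtain ⟨u, hu⟩ := hunit
    have hinv : ∀ z, N ((↑u⁻¹ : X →L[ℂ] X) z) = z := fun z => by
      have : (↑u * ↑u⁻¹ : X →L[ℂ] X) = 1 := u.mul_inv
      rw [← hu]
      exact congrArg (fun A : X →L[ℂ] X => A z) this
    refine ⟨ι ∘L (↑u⁻¹ : X →L[ℂ] X) ∘L ι.adjoint, fun h => (↑u⁻¹ : X →L[ℂ] X) (ι.adjoint h),
      hc.comp_clm _, fun h => rfl, fun h y => ?_⟩
    rw [ContinuousLinearMap.coe_coe, ← hNin, hinv, ContinuousLinearMap.adjoint_inner_left]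

/-- The polynomial part is ‖(S₀ + k S₁) x‖², visibly nonnegative. The bound of S₁ by S₂ is the
condition d ≤ C m. -/
theorem isQuadraticPencil_gramForm [CompleteSpace X] [CompleteSpace Y] {ι S₀ S₁ S₂ : X →L[ℂ] Y}
    {v₂ : ℝ} (hι : Function.Injective ι) (hc : IsCompactOperator ι)
    (h₀ : ∃ C, ∀ x, ‖x‖ ≤ C * (‖S₀ x‖ + ‖ι x‖)) (h₁ : ∃ C, ∀ x, ‖S₁ x‖ ≤ C * ‖S₂ x‖)
    (h₂ : ∃ C, ∀ x, ‖S₂ x‖ ≤ C * ‖ι x‖) (hS₂ : ∀ x, S₂ x = 0 → x = 0) (hv : 0 ≤ v₂)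
    (hS₂v : ∀ x, v₂ * ‖ι x‖ ^ 2 ≤ ‖S₂ x‖ ^ 2)
    (htrial : ∀ ε > 0, ∀ n : ℕ, ∃ C : ℝ, ∀ k > 0, ∃ J : (Fin (n + 1) → ℂ) →ₗ[ℂ] X,
      Function.Injective J ∧ ∀ c, ‖S₀ (J c) + ((k : ℝ) : ℂ) • S₁ (J c)‖ ^ 2 ≤ C * ‖ι (J c)‖ ^ 2 ∧
        ‖S₂ (J c)‖ ^ 2 ≤ (v₂ + ε) * ‖ι (J c)‖ ^ 2) :
    IsQuadraticPencil (ι : X →ₗ[ℂ] Y) (gramForm S₀ S₁ S₂) (fun x => ‖S₀ x‖ ^ 2)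
      (fun x => 2 * (inner ℂ (S₀ x) (S₁ x)).re) (fun x => ‖S₁ x‖ ^ 2) (fun x => ‖S₂ x‖ ^ 2) v₂ := by
  have hsq : ∀ (k : ℝ) x, ‖S₀ x + (k : ℂ) • S₁ x‖ ^ 2 =
      ‖S₀ x‖ ^ 2 + k * (2 * (inner ℂ (S₀ x) (S₁ x)).re) + k ^ 2 * ‖S₁ x‖ ^ 2 := fun k x => by
    have := norm_add_sq (𝕜 := ℂ) (S₀ x) ((k : ℂ) • S₁ x)
    rw [this, inner_smul_right, norm_smul, mul_pow, Complex.norm_real, Real.norm_eq_abs, sq_abs]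
    simp only [RCLike.re_to_complex, Complex.re_ofReal_mul]
    ring
  obtain ⟨C₀, hC₀⟩ := h₀
  obtain ⟨C₁, hC₁⟩ := h₁
  obtain ⟨C₂, hC₂⟩ := h₂
  have hC₁' : ∀ x, ‖S₁ x‖ ≤ |C₁| * ‖S₂ x‖ := fun x =>
    (hC₁ x).trans (mul_le_mul_of_nonneg_right (le_abs_self _) (norm_nonneg _))
  have hC₁₂ : ∀ x, ‖S₁ x‖ ≤ |C₁| * C₂ * ‖ι x‖ := fun x =>
    (hC₁' x).trans (by rw [mul_assoc]; exact mul_le_mul_of_nonneg_left (hC₂ x) (abs_nonneg _))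
  refine ⟨fun k => ?_, fun k x => ?_, fun k x => ?_, fun x => sq_nonneg _, ⟨C₁ ^ 2, sq_nonneg _,
    fun x => ?_⟩, hv, hS₂v, fun x hx => ?_, ⟨(|C₁| * C₂) ^ 2 + C₂ ^ 2, fun x => ?_⟩,
    fun ε hε n => ?_⟩
  -- Coercivity is assumed at k = 0 only; it extends to all k because S₁ is bounded by ι.
  · refine isDiscreteForm_gramForm k hι hc (C := |C₀| * (1 + |k| * |(|C₁| * C₂)|)) fun x => ?_
    have e : S₀ x = (S₀ x + (k : ℂ) • S₁ x) - (k : ℂ) • S₁ x := by abel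
    have h1 : ‖S₀ x‖ ≤ ‖S₀ x + (k : ℂ) • S₁ x‖ + |k| * (|(|C₁| * C₂)| * ‖ι x‖) := by
      have h2 := norm_sub_le (S₀ x + (k : ℂ) • S₁ x) ((k : ℂ) • S₁ x)
      rw [← e, norm_smul, Complex.norm_real, Real.norm_eq_abs] at h2
      refine h2.trans (add_le_add_right (mul_le_mul_of_nonneg_left ((hC₁₂ x).trans ?_)
        (abs_nonneg k)) _)
      exact mul_le_mul_of_nonneg_right (le_abs_self _) (norm_nonneg _)
    have p1 : 0 ≤ |k| * |(|C₁| * C₂)| := by positivity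
    set p := ‖S₀ x + (k : ℂ) • S₁ x‖ with hp
    have p2 : 0 ≤ p := norm_nonneg _
    calc ‖x‖ ≤ C₀ * (‖S₀ x‖ + ‖ι x‖) := hC₀ x
      _ ≤ |C₀| * (‖S₀ x‖ + ‖ι x‖) :=
          mul_le_mul_of_nonneg_right (le_abs_self _) (by positivity)
      _ ≤ |C₀| * ((1 + |k| * |(|C₁| * C₂)|) * (p + ‖ι x‖)) := by
          refine mul_le_mul_of_nonneg_left ?_ (abs_nonneg _)
          nlinarith [mul_nonneg p1 p2]
      _ = _ := by ring
  · rw [re_gramForm_self, hsq]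
  · rw [← hsq]
    exact sq_nonneg _
  · rw [← sq_abs C₁, ← mul_pow]
    exact pow_le_pow_left₀ (norm_nonneg _) (hC₁' x) 2
  · have : S₂ x ≠ 0 := fun h => hx (hS₂ x h)
    positivity
  · rw [add_mul, ← mul_pow, ← mul_pow]
    exact add_le_add (pow_le_pow_left₀ (norm_nonneg _) (hC₁₂ x) 2)
      (pow_le_pow_left₀ (norm_nonneg _) (hC₂ x) 2)
  · obtain ⟨C, hC⟩ := htrial ε hε n
    refine ⟨C, fun k hk => ?_⟩
    obtain ⟨J, hJ, hJC⟩ := hC k hk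
    refine ⟨J, hJ, fun c => ?_⟩
    rw [re_gramForm_self, add_mul, mul_assoc]
    exact add_le_add (hJC c).1 (mul_le_mul_of_nonneg_left (hJC c).2 (sq_nonneg k))

end Gram

/-! ### Periodic coefficients on the circle -/

section Represents

variable {L : ℝ} [hL : Fact (0 < L)]

/-- The function `f` on the line is the periodic extension of `x`, almost everywhere. -/
def Represents (x : CircleL2 L) (f : ℝ → ℂ) : Prop := ∀ᵐ t : ℝ, x (t : AddCircle L) = f t

theorem Represents.add {x y : CircleL2 L} {f g : ℝ → ℂ} (hx : Represents x f)
    (hy : Represents y g) : Represents (x + y) fun t => f t + g t := by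
  filter_upwards [hx, hy, ae_real_of_ae_circle (Lp.coeFn_add x y)] with t h1 h2 h3
  rw [h3, Pi.add_apply, h1, h2]

theorem Represents.smul {x : CircleL2 L} {f : ℝ → ℂ} (hx : Represents x f) (c : ℂ) :
    Represents (c • x) fun t => c * f t := by
  filter_upwards [hx, ae_real_of_ae_circle (Lp.coeFn_smul c x)] with t h1 h3
  rw [h3, Pi.smul_apply, h1, smul_eq_mul]

theorem represents_zero : Represents (0 : CircleL2 L) fun _ => 0 :=
  ae_real_of_ae_circle (Lp.coeFn_zero ℂ 2 _)

theorem Represents.sum {ι : Type*} {s : Finset ι} {x : ι → CircleL2 L} {f : ι → ℝ → ℂ}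
    (h : ∀ i, Represents (x i) (f i)) (c : ι → ℂ) :
    Represents (∑ i ∈ s, c i • x i) fun t => ∑ i ∈ s, c i * f i t := by
  classical
  induction s using Finset.induction_on with
  | empty => simpa using represents_zero
  | insert i s hi ih =>
    simp only [Finset.sum_insert hi]
    exact ((h i).smul (c i)).add ih

theorem Represents.congr {x : CircleL2 L} {f g : ℝ → ℂ} (hx : Represents x f)
    (h : ∀ᵐ t, f t = g t) : Represents x g := by
  filter_upwards [hx, h] with t h1 h2
  rw [h1, h2]

theorem Represents.eq {x y : CircleL2 L} {f : ℝ → ℂ} (hx : Represents x f)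
    (hy : Represents y f) : x = y := by
  refine Lp.ext (ae_circle_of_ae_real ?_)
  filter_upwards [hx, hy] with t h1 h2
  rw [h1, h2]

theorem Represents.norm_le {x y : CircleL2 L} {f g : ℝ → ℂ} (hx : Represents x f)
    (hy : Represents y g) {C : ℝ} (h : ∀ t, ‖f t‖ ≤ C * ‖g t‖) : ‖x‖ ≤ C * ‖y‖ := by
  refine Lp.norm_le_mul_norm_of_ae_le_mul (ae_circle_of_ae_real ?_)
  filter_upwards [hx, hy] with t h1 h2
  rw [h1, h2]
  exact h t

theorem represents_invD (x : CircleL2 L) : Represents (invD x) (invDFun x) := ae_invD x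

theorem exists_represents {g : ℝ → ℂ} (hm : Measurable g) (hb : ∃ C, ∀ t, ‖g t‖ ≤ C)
    (hp : Function.Periodic g L) : ∃ x : CircleL2 L, Represents x g := by
  obtain ⟨C, hC⟩ := hb
  have hmem : MemLp (fun q : AddCircle L => g (AddCircle.measurableEquivIoc L 0 q)) 2
      AddCircle.haarAddCircle :=
    MemLp.of_bound (hm.comp (measurable_subtype_coe.comp
      (AddCircle.measurableEquivIoc L 0).measurable)).aestronglyMeasurable C
      (Eventually.of_forall fun q => hC _)
  refine ⟨hmem.toLp, ?_⟩
  filter_upwards [ae_real_of_ae_circle hmem.coeFn_toLp] with t ht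
  rw [ht]
  change g (AddCircle.equivIoc L 0 (t : AddCircle L)) = g t
  have h1 : ((AddCircle.equivIoc L 0 (t : AddCircle L) : ℝ) : AddCircle L) = t :=
    AddCircle.coe_equivIoc
  rw [← hp.lift_coe, ← hp.lift_coe t]
  exact congrArg hp.lift h1

/-- A bounded coefficient on the line, restricted to a period, as a function on the circle. -/
def circleCoeff (L : ℝ) [Fact (0 < L)] (f : ℝ → ℝ) (hf : IsTame f) : BddMeas (AddCircle L) where
  toFun q := f (AddCircle.measurableEquivIoc L 0 q)
  measurable := hf.measurable.comp (measurable_subtype_coe.comp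
    (AddCircle.measurableEquivIoc L 0).measurable)
  bounded := hf.bounded.imp fun _ h _ => h _

/-- Multiplication by a periodic coefficient. -/
abbrev coeffOp (L : ℝ) [Fact (0 < L)] (f : ℝ → ℝ) (hf : IsTame f) :
    CircleL2 L →L[ℂ] CircleL2 L := mulOp AddCircle.haarAddCircle (circleCoeff L f hf)

theorem Represents.coeffOp {x : CircleL2 L} {g : ℝ → ℂ} (hx : Represents x g) {f : ℝ → ℝ}
    (hf : IsTame f) (hp : Function.Periodic f L) :
    Represents (coeffOp L f hf x) fun t => (f t : ℂ) * g t := by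
  filter_upwards [hx, ae_real_of_ae_circle (coeFn_mulOp (circleCoeff L f hf) x)] with t h1 h2
  rw [h2, h1]
  congr 2
  change f (AddCircle.equivIoc L 0 (t : AddCircle L)) = f t
  have h1 : ((AddCircle.equivIoc L 0 (t : AddCircle L) : ℝ) : AddCircle L) = t :=
    AddCircle.coe_equivIoc
  rw [← hp.lift_coe, ← hp.lift_coe t]
  exact congrArg hp.lift h1

theorem exists_norm_le_of_periodic {U : ℝ → ℂ} (hU : Continuous U) (hp : Function.Periodic U L) :
    ∃ C, ∀ t, ‖U t‖ ≤ C := by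
  obtain ⟨C, hC⟩ := (isCompact_Icc (a := (0 : ℝ)) (b := L)).exists_bound_of_continuousOn
    hU.continuousOn
  refine ⟨C, fun t => ?_⟩
  obtain ⟨y, hy, hty⟩ := hp.exists_mem_Ico₀ hL.out t
  rw [hty]
  exact hC y ⟨hy.1, hy.2.le⟩

end Represents

/-! ### The periodic pencil -/

/-- Coefficients of the pencil `D_k (a D_k u) + k² β u = μ r u`, where `D_k = -i d/dx + γ₀ + k γ`,
on `L`-periodic functions; `v₂` is the infimum of `β / r`. -/
structure IsPeriodicPencil (L : ℝ) (a γ β r : ℝ → ℝ) (v₂ : ℝ) : Prop where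
  tame_a : IsTame a
  tame_γ : IsTame γ
  tame_β : IsTame β
  tame_r : IsTame r
  periodic_a : Function.Periodic a L
  periodic_γ : Function.Periodic γ L
  periodic_β : Function.Periodic β L
  periodic_r : Function.Periodic r L
  a_pos : ∃ m, 0 < m ∧ ∀ t, m ≤ a t
  r_pos : ∃ m, 0 < m ∧ ∀ t, m ≤ r t
  β_pos : ∀ t, 0 < β t
  γ_le : ∃ C, ∀ t, a t * γ t ^ 2 ≤ C * β t
  v_nonneg : 0 ≤ v₂
  v_le : ∀ t, v₂ * r t ≤ β t
  approx : ∀ ε > 0, ∃ u v, u < v ∧ ∀ t ∈ Ioo u v, β t ≤ (v₂ + ε) * r t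

/-- `u` is a periodic solution of `D_k (a D_k u) + k² β u = μ r u`: the flux `W = a D_k u` is
continuous, and the equation holds off a countable set. -/
def IsPeriodicSolution (L : ℝ) (a γ β r : ℝ → ℝ) (γ₀ k μ : ℝ) (U : ℝ → ℂ) : Prop :=
  Continuous U ∧ Function.Periodic U L ∧ ∃ W : ℝ → ℂ, Continuous W ∧ Function.Periodic W L ∧
    ∃ S : Set ℝ, S.Countable ∧ ∀ t, t ∉ S →
      HasDerivAt U (Complex.I * (W t / a t - (γ₀ + k * γ t) * U t)) t ∧
      HasDerivAt W (-Complex.I * ((γ₀ + k * γ t) * W t + k ^ 2 * β t * U t - μ * r t * U t)) t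

namespace IsPeriodicPencil

variable {L : ℝ} [hL : Fact (0 < L)] {a γ β r : ℝ → ℝ} {v₂ : ℝ}

/-- The first order operator `√a (-i d/dx + γ₀)`. -/
def S₀ (hP : IsPeriodicPencil L a γ β r v₂) (γ₀ : ℝ) : CircleL2 L →L[ℂ] CircleL2 L :=
  coeffOp L (fun t => √(a t)) hP.tame_a.sqrt ∘L
    (ContinuousLinearMap.id ℂ _ + ((γ₀ - Real.pi / L : ℝ) : ℂ) • invD)

/-- Multiplication by `√a γ`. -/
def S₁ (hP : IsPeriodicPencil L a γ β r v₂) : CircleL2 L →L[ℂ] CircleL2 L :=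
  coeffOp L (fun t => √(a t)) hP.tame_a.sqrt ∘L coeffOp L γ hP.tame_γ ∘L invD

/-- Multiplication by `√β`. -/
def S₂ (hP : IsPeriodicPencil L a γ β r v₂) : CircleL2 L →L[ℂ] CircleL2 L :=
  coeffOp L (fun t => √(β t)) hP.tame_β.sqrt ∘L invD

/-- Multiplication by `√r`. -/
def emb (hP : IsPeriodicPencil L a γ β r v₂) : CircleL2 L →L[ℂ] CircleL2 L :=
  coeffOp L (fun t => √(r t)) hP.tame_r.sqrt ∘L invD

variable (hP : IsPeriodicPencil L a γ β r v₂) (γ₀ k : ℝ)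

/-- The unknown `x` stands for -i U' + (π/L) U with U = `invDFun x`. Hence (-i d/dx + γ₀) U is x +
(γ₀ - π/L) U, which explains the shift by π/L. -/
theorem represents_S₀_add {x : CircleL2 L} {g : ℝ → ℂ} (hg : Represents x g) :
    Represents (hP.S₀ γ₀ x + (k : ℂ) • hP.S₁ x) fun t =>
      (√(a t) : ℝ) * (g t + (γ₀ - Real.pi / L + k * γ t) * invDFun x t) := by
  have hsa : Function.Periodic (fun t => √(a t)) L := fun t => by simp only [hP.periodic_a t]
  have h1 := (hg.add ((represents_invD x).smul ((γ₀ - Real.pi / L : ℝ) : ℂ))).coeffOp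
    hP.tame_a.sqrt hsa
  have h2 := (((represents_invD x).coeffOp hP.tame_γ hP.periodic_γ).coeffOp
    hP.tame_a.sqrt hsa).smul (k : ℂ)
  refine (h1.add h2).congr (Eventually.of_forall fun t => ?_)
  push_cast
  ring

theorem represents_S₂ (x : CircleL2 L) :
    Represents (hP.S₂ x) fun t => (√(β t) : ℝ) * invDFun x t :=
  (represents_invD x).coeffOp hP.tame_β.sqrt fun t => by simp only [hP.periodic_β t]

theorem represents_emb (x : CircleL2 L) :
    Represents (hP.emb x) fun t => (√(r t) : ℝ) * invDFun x t :=
  (represents_invD x).coeffOp hP.tame_r.sqrt fun t => by simp only [hP.periodic_r t]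

/-- The form of the pencil minus `μ` times the inner product. -/
theorem gramForm_sub_eq (μ : ℝ) (x y : CircleL2 L) :
    gramForm (hP.S₀ γ₀) hP.S₁ hP.S₂ k x y - μ * inner ℂ (hP.emb x) (hP.emb y) =
      inner ℂ (coeffOp L a hP.tame_a (x + ((γ₀ - Real.pi / L : ℝ) : ℂ) • invD x +
        (k : ℂ) • coeffOp L γ hP.tame_γ (invD x)) +
        invD (((γ₀ - Real.pi / L : ℝ) : ℂ) • coeffOp L a hP.tame_a (x +
          ((γ₀ - Real.pi / L : ℝ) : ℂ) • invD x + (k : ℂ) • coeffOp L γ hP.tame_γ (invD x)) +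
          (k : ℂ) • coeffOp L γ hP.tame_γ (coeffOp L a hP.tame_a (x +
          ((γ₀ - Real.pi / L : ℝ) : ℂ) • invD x + (k : ℂ) • coeffOp L γ hP.tame_γ (invD x))) +
          ((k ^ 2 : ℝ) : ℂ) • coeffOp L β hP.tame_β (invD x) -
          (μ : ℂ) • coeffOp L r hP.tame_r (invD x))) y := by
  have hF : ∀ x, hP.S₀ γ₀ x + (k : ℂ) • hP.S₁ x = coeffOp L (fun t => √(a t)) hP.tame_a.sqrt
      (x + ((γ₀ - Real.pi / L : ℝ) : ℂ) • invD x + (k : ℂ) • coeffOp L γ hP.tame_γ (invD x)) :=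
    fun x => by
    rw [map_add _ (x + _), map_smul]
    rfl
  have hsq : ∀ {f : ℝ → ℝ} (hf : IsTame f) (_ : ∀ t, 0 ≤ f t) (x y : CircleL2 L),
      inner ℂ (coeffOp L (fun t => √(f t)) hf.sqrt x) (coeffOp L (fun t => √(f t)) hf.sqrt y) =
        inner ℂ (coeffOp L f hf x) y := fun hf h0 x y =>
    inner_mulOp_sqrt (a := circleCoeff L _ hf) (fun q => h0 _) x y
  obtain ⟨ma, hma, ha⟩ := hP.a_pos
  obtain ⟨mr, hmr, hr⟩ := hP.r_pos
  have e2 : ∀ x, hP.S₂ x = coeffOp L (fun t => √(β t)) hP.tame_β.sqrt (invD x) := fun _ => rfl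
  have e3 : ∀ x, hP.emb x = coeffOp L (fun t => √(r t)) hP.tame_r.sqrt (invD x) := fun _ => rfl
  rw [gramForm_apply, hF, hF, e2, e2, e3, e3, hsq hP.tame_a fun t => hma.le.trans (ha t),
    hsq hP.tame_β fun t => (hP.β_pos t).le, hsq hP.tame_r fun t => hmr.le.trans (hr t)]
  generalize coeffOp L a hP.tame_a (x + ((γ₀ - Real.pi / L : ℝ) : ℂ) • invD x +
        (k : ℂ) • coeffOp L γ hP.tame_γ (invD x)) = f
  rw [inner_add_left f, inner_invD_left, inner_sub_left, inner_add_left, inner_add_left,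
    inner_add_right, inner_add_right, inner_smul_right, inner_smul_right, inner_smul_left,
    inner_smul_left, inner_smul_left, inner_smul_left, inner_mulOp_left _ f]
  simp only [Complex.conj_ofReal]
  push_cast
  ring

end IsPeriodicPencil

namespace IsPeriodicPencil

theorem exists_continuousAt {L : ℝ} {a γ β r : ℝ → ℝ} {v₂ : ℝ}
    (hP : IsPeriodicPencil L a γ β r v₂) : ∃ S : Set ℝ, S.Countable ∧ ∀ t, t ∉ S →
    ContinuousAt (fun t => (a t : ℂ)) t ∧ ContinuousAt (fun t => (γ t : ℂ)) t ∧
    ContinuousAt (fun t => (β t : ℂ)) t ∧ ContinuousAt (fun t => (r t : ℂ)) t := by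
  obtain ⟨-, Sa, hSa, ha⟩ := hP.tame_a
  obtain ⟨-, Sγ, hSγ, hγ⟩ := hP.tame_γ
  obtain ⟨-, Sβ, hSβ, hβ⟩ := hP.tame_β
  obtain ⟨-, Sr, hSr, hr⟩ := hP.tame_r
  have hc := Complex.continuous_ofReal
  refine ⟨Sa ∪ Sγ ∪ Sβ ∪ Sr, ((hSa.union hSγ).union hSβ).union hSr, fun t ht => ?_⟩
  simp only [mem_union, not_or] at ht
  exact ⟨hc.continuousAt.comp (ha t ht.1.1.1), hc.continuousAt.comp (hγ t ht.1.1.2),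
    hc.continuousAt.comp (hβ t ht.1.2), hc.continuousAt.comp (hr t ht.2)⟩

variable {L : ℝ} [hL : Fact (0 < L)] {a γ β r : ℝ → ℝ} {v₂ : ℝ}
  (hP : IsPeriodicPencil L a γ β r v₂) (γ₀ k : ℝ)

/-- The weak equation for all test vectors says f + invD w = 0, where f = a D_k U is the flux. The
flux is therefore in the range of `invD`, has a continuous representative, and is differentiable
wherever the coefficients are continuous. Solving f = a D_k U for x then gives the derivative of U.
-/
theorem isPeriodicSolution_of_mem {μ : ℝ} {x : CircleL2 L}
    (hx : x ∈ formEigenspace (hP.emb : CircleL2 L →ₗ[ℂ] CircleL2 L)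
      (gramForm (hP.S₀ γ₀) hP.S₁ hP.S₂ k) μ) :
    IsPeriodicSolution L a γ β r γ₀ k μ (invDFun x) := by
  obtain ⟨m, hm, ham⟩ := hP.a_pos
  have ha0 : ∀ t, (a t : ℂ) ≠ 0 := fun t => Complex.ofReal_ne_zero.2 (hm.trans_le (ham t)).ne'
  have hweak := fun y => (hP.gramForm_sub_eq γ₀ k μ x y).symm.trans (sub_eq_zero.2 (hx y))
  set f := coeffOp L a hP.tame_a (x + ((γ₀ - Real.pi / L : ℝ) : ℂ) • invD x +
    (k : ℂ) • coeffOp L γ hP.tame_γ (invD x)) with hf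
  set w := ((γ₀ - Real.pi / L : ℝ) : ℂ) • f + (k : ℂ) • coeffOp L γ hP.tame_γ f +
    ((k ^ 2 : ℝ) : ℂ) • coeffOp L β hP.tame_β (invD x) -
    (μ : ℂ) • coeffOp L r hP.tame_r (invD x) with hw
  have hfw : f = invD (-w) := by
    -- The test vector is the residual itself.
    have := inner_self_eq_zero.1 (hweak (f + invD w))
    rw [map_neg]
    exact eq_neg_of_add_eq_zero_left this
  set U := invDFun x with hU
  set W := invDFun (-w) with hW
  have hUc : Continuous U := continuous_invDFun x
  have hWc : Continuous W := continuous_invDFun (-w)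
  have hfW : Represents f W := by
    rw [hfw]
    exact represents_invD _
  have hUr : Represents (invD x) U := represents_invD x
  have hxg : Represents x fun t => W t / a t - (γ₀ - Real.pi / L + k * γ t) * U t := by
    have hx0 : Represents x fun t => x (t : AddCircle L) := Eventually.of_forall fun _ => rfl
    have h1 := ((hx0.add (hUr.smul ((γ₀ - Real.pi / L : ℝ) : ℂ))).add
      ((hUr.coeffOp hP.tame_γ hP.periodic_γ).smul (k : ℂ))).coeffOp hP.tame_a hP.periodic_a
    filter_upwards [h1, hfW] with t g1 g2
    rw [← hf, g2] at g1
    rw [eq_sub_iff_add_eq, eq_div_iff (ha0 t), g1]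
    push_cast
    ring
  have hzg : Represents (-w) fun t => -((γ₀ - Real.pi / L + k * γ t) * W t +
      k ^ 2 * β t * U t - μ * r t * U t) := by
    have h1 := ((((hfW.smul ((γ₀ - Real.pi / L : ℝ) : ℂ)).add
      ((hfW.coeffOp hP.tame_γ hP.periodic_γ).smul (k : ℂ))).add
      ((hUr.coeffOp hP.tame_β hP.periodic_β).smul ((k ^ 2 : ℝ) : ℂ))).add
      ((hUr.coeffOp hP.tame_r hP.periodic_r).smul (-μ : ℂ))).smul (-1)
    rw [neg_one_smul, neg_smul, ← sub_eq_add_neg] at h1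
    refine h1.congr (Eventually.of_forall fun t => ?_)
    push_cast
    ring
  obtain ⟨S, hS, hcont⟩ := hP.exists_continuousAt
  have c1 : ∀ t, t ∉ S →
      ContinuousAt (fun t => W t / a t - (γ₀ - Real.pi / L + k * γ t) * U t) t := fun t ht => by
    obtain ⟨ca, cγ, -, -⟩ := hcont t ht
    exact (hWc.continuousAt.div ca (ha0 t)).sub
      ((continuousAt_const.add (continuousAt_const.mul cγ)).mul hUc.continuousAt)
  have c2 : ∀ t, t ∉ S → ContinuousAt (fun t => -((γ₀ - Real.pi / L + k * γ t) * W t +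
      k ^ 2 * β t * U t - μ * r t * U t)) t := fun t ht => by
    obtain ⟨-, cγ, cβ, cr⟩ := hcont t ht
    exact ((((continuousAt_const.add (continuousAt_const.mul cγ)).mul hWc.continuousAt).add
      ((continuousAt_const.mul cβ).mul hUc.continuousAt)).sub
      ((continuousAt_const.mul cr).mul hUc.continuousAt)).neg
  refine ⟨hUc, periodic_invDFun x, W, hWc, periodic_invDFun _, S, hS, fun t ht => ⟨?_, ?_⟩⟩
  · refine (hasDerivAt_invDFun x (measurable_of_continuousAt_off_countable hS c1) hxg
      (c1 t ht)).congr_deriv ?_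
    push_cast
    ring
  · refine (hasDerivAt_invDFun (-w) (measurable_of_continuousAt_off_countable hS c2) hzg
      (c2 t ht)).congr_deriv ?_
    push_cast
    ring

/-- The vector `x` is read off from the flux as W/a - (γ₀ - π/L + k γ) U. Uniqueness of periodic
solutions identifies `invDFun x` with U, and in the same way W with the solution for -z; this is the
weak equation. -/
theorem exists_mem_of_isPeriodicSolution {μ : ℝ} {U : ℝ → ℂ}
    (hU : IsPeriodicSolution L a γ β r γ₀ k μ U) :
    ∃ x ∈ formEigenspace (hP.emb : CircleL2 L →ₗ[ℂ] CircleL2 L)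
      (gramForm (hP.S₀ γ₀) hP.S₁ hP.S₂ k) μ, invDFun x = U := by
  obtain ⟨hUc, hUp, W, hWc, hWp, S, hS, hd⟩ := hU
  obtain ⟨m, hm, ham⟩ := hP.a_pos
  have ha0 : ∀ t, (a t : ℂ) ≠ 0 := fun t => Complex.ofReal_ne_zero.2 (hm.trans_le (ham t)).ne'
  obtain ⟨u, hu⟩ := exists_represents hUc.measurable (exists_norm_le_of_periodic hUc hUp) hUp
  obtain ⟨w, hw⟩ := exists_represents hWc.measurable (exists_norm_le_of_periodic hWc hWp) hWp
  have hai : Function.Periodic (fun t => (a t)⁻¹) L := fun t => by simp only [hP.periodic_a t]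
  set x := coeffOp L _ (hP.tame_a.inv hm ham) w + (-(γ₀ - Real.pi / L : ℝ) : ℂ) • u +
    (-(k : ℂ)) • coeffOp L γ hP.tame_γ u with hxdef
  have hx : Represents x fun t => W t / a t - (γ₀ - Real.pi / L + k * γ t) * U t := by
    refine (((hw.coeffOp (hP.tame_a.inv hm ham) hai).add (hu.smul _)).add
      ((hu.coeffOp hP.tame_γ hP.periodic_γ).smul _)).congr (Eventually.of_forall fun t => ?_)
    push_cast
    ring
  have hxU : invDFun x = U := invDFun_eq x hUc hUp hx hS fun t ht =>
    (hd t ht).1.congr_deriv (by push_cast; ring)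
  have hTx : invD x = u := by
    have := represents_invD x
    rw [hxU] at this
    exact this.eq hu
  set z := ((γ₀ - Real.pi / L : ℝ) : ℂ) • w + (k : ℂ) • coeffOp L γ hP.tame_γ w +
    ((k ^ 2 : ℝ) : ℂ) • coeffOp L β hP.tame_β u - (μ : ℂ) • coeffOp L r hP.tame_r u with hzdef
  have hz : Represents (-z) fun t => -((γ₀ - Real.pi / L + k * γ t) * W t +
      k ^ 2 * β t * U t - μ * r t * U t) := by
    have h1 := ((((hw.smul ((γ₀ - Real.pi / L : ℝ) : ℂ)).add
      ((hw.coeffOp hP.tame_γ hP.periodic_γ).smul (k : ℂ))).add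
      ((hu.coeffOp hP.tame_β hP.periodic_β).smul ((k ^ 2 : ℝ) : ℂ))).add
      ((hu.coeffOp hP.tame_r hP.periodic_r).smul (-μ : ℂ))).smul (-1)
    rw [neg_one_smul, neg_smul, ← sub_eq_add_neg] at h1
    refine h1.congr (Eventually.of_forall fun t => ?_)
    push_cast
    ring
  have hzW : invDFun (-z) = W := invDFun_eq (-z) hWc hWp hz hS fun t ht =>
    (hd t ht).2.congr_deriv (by push_cast; ring)
  have hTz : invD z = -w := by
    have := represents_invD (-z)
    rw [hzW] at this
    rw [← this.eq hw, map_neg, neg_neg]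
  have hf : coeffOp L a hP.tame_a (x + ((γ₀ - Real.pi / L : ℝ) : ℂ) • invD x +
      (k : ℂ) • coeffOp L γ hP.tame_γ (invD x)) = w := by
    rw [hTx]
    refine Represents.eq (((hx.add (hu.smul _)).add
      ((hu.coeffOp hP.tame_γ hP.periodic_γ).smul _)).coeffOp hP.tame_a hP.periodic_a)
      (hw.congr (Eventually.of_forall fun t => ?_))
    have := ha0 t
    push_cast
    field_simp
    ring
  refine ⟨x, fun y => sub_eq_zero.1 ?_, hxU⟩
  refine (hP.gramForm_sub_eq γ₀ k μ x y).trans ?_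
  rw [hf, hTx, ← hzdef, hTz, add_neg_cancel, inner_zero_left]

end IsPeriodicPencil

theorem invDFun_injective {L : ℝ} [Fact (0 < L)] :
    Function.Injective (invDFun : CircleL2 L → ℝ → ℂ) := fun x y h => by
  have h1 := represents_invD x
  rw [h] at h1
  rw [← sub_eq_zero]
  refine invD_eq_zero ?_
  rw [map_sub, h1.eq (represents_invD y), sub_self]

/-! ### Trial functions -/

/-- A periodic bump `h` supported in the translates of a given interval, and a function `χ` that
vanishes on the support of `h`. -/
theorem exists_periodic_bump {L : ℝ} (hL : 0 < L) {u v : ℝ} (huv : u < v) :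
    ∃ h χ : ℝ → ℝ, ContDiff ℝ 1 h ∧ Function.Periodic h L ∧ Continuous χ ∧
      Function.Periodic χ L ∧ (∀ t, χ t * h t = 0) ∧ 0 < ∫ t in (0 : ℝ)..L, χ t ∧
      (∃ t, h t ≠ 0) ∧ ∀ t, h t ≠ 0 → ∃ n : ℤ, t - n * L ∈ Ioo u v := by
  -- The bound (v - u)/2 keeps the support inside the interval. The bound L/4 keeps the cosine
  -- decreasing and nonnegative up to the threshold c₀.
  set δ := min ((v - u) / 2) (L / 4) with hδ
  have hδ0 : 0 < δ := lt_min (by linarith) (by linarith)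
  have hδ1 : δ ≤ (v - u) / 2 := min_le_left _ _
  have hδ2 : δ ≤ L / 4 := min_le_right _ _
  have hpi := Real.pi_pos
  set t₀ := (u + v) / 2 with ht₀
  set c₀ := Real.cos (2 * Real.pi * δ / L) with hc₀
  set φ : ℝ → ℝ := fun t => Real.cos (2 * Real.pi * (t - t₀) / L) with hφ
  have hφs : ContDiff ℝ 1 φ := by
    refine Real.contDiff_cos.comp ?_
    exact (contDiff_const.mul (contDiff_id.sub contDiff_const)).div_const _
  have hφp : Function.Periodic φ L := fun t => by
    simp only [hφ]
    rw [← Real.cos_add_two_pi (2 * Real.pi * (t - t₀) / L)]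
    congr 1
    field_simp
    ring
  have hδL : 0 < 2 * Real.pi * δ / L := by positivity
  have hδL' : 2 * Real.pi * δ / L ≤ Real.pi / 2 := by
    rw [div_le_iff₀ hL]
    nlinarith
  have hc1 : c₀ < 1 := by
    rw [hc₀, ← Real.cos_zero]
    exact Real.cos_lt_cos_of_nonneg_of_le_pi_div_two le_rfl hδL' hδL
  have hc0 : 0 ≤ c₀ := Real.cos_nonneg_of_neg_pi_div_two_le_of_le (by linarith) hδL'
  -- The bump is positive exactly where φ > c₀, and χ exactly where φ < c₀.
  refine ⟨fun t => expNegInvGlue (φ t - c₀), fun t => max 0 (c₀ - φ t),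
    expNegInvGlue.contDiff.comp (hφs.sub contDiff_const), fun t => by simp only [hφp t],
    continuous_const.max (continuous_const.sub hφs.continuous), fun t => by simp only [hφp t],
    fun t => ?_, ?_, ⟨t₀, ?_⟩, fun t ht => ?_⟩
  · dsimp only
    rcases le_total (φ t - c₀) 0 with h | h
    · rw [expNegInvGlue.zero_of_nonpos h, mul_zero]
    · rw [max_eq_left (by linarith), zero_mul]
  · have hχp : Function.Periodic (fun t => max 0 (c₀ - φ t)) L := fun t => by simp only [hφp t]
    obtain ⟨y, hy, hty⟩ := hχp.exists_mem_Ico₀ hL (t₀ + L / 2)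
    refine intervalIntegral.integral_pos hL
      (continuous_const.max (continuous_const.sub hφs.continuous)).continuousOn
      (fun _ _ => le_max_left _ _) ⟨y, ⟨hy.1, hy.2.le⟩, ?_⟩
    rw [← hty]
    refine lt_max_of_lt_right ?_
    have : φ (t₀ + L / 2) = -1 := by
      simp only [hφ]
      rw [← Real.cos_pi]
      congr 1
      field_simp
      ring
    linarith
  · refine (expNegInvGlue.pos_of_pos ?_).ne'
    simp only [hφ, sub_self, mul_zero, zero_div, Real.cos_zero]
    linarith
  · have hlt : c₀ < φ t := by
      by_contra hle
      exact ht (expNegInvGlue.zero_of_nonpos (by linarith))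
    -- Rounding selects the translate of t₀ within half a period of t, where the cosine is monotone
    -- in the distance.
    set n := round ((t - t₀) / L) with hn
    have hr := abs_sub_round ((t - t₀) / L)
    rw [← hn] at hr
    set τ := t - t₀ - n * L with hτ
    have hτL : |τ| ≤ L / 2 := by
      have : τ = ((t - t₀) / L - n) * L := by
        rw [hτ]
        field_simp
      rw [this, abs_mul, abs_of_pos hL]
      nlinarith
    have hφτ : φ t = Real.cos (2 * Real.pi * |τ| / L) := by
      have e1 : Real.cos (2 * Real.pi * |τ| / L) = Real.cos (2 * Real.pi * τ / L) := by
        rcases abs_choice τ with h | h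
        · rw [h]
        · rw [h, mul_neg, neg_div, Real.cos_neg]
      rw [e1]
      refine (Real.cos_sub_int_mul_two_pi (2 * Real.pi * (t - t₀) / L) n).symm.trans ?_
      congr 1
      rw [hτ]
      field_simp
    have hlt' : |τ| < δ := by
      by_contra hle
      rw [not_lt] at hle
      refine absurd hlt (not_lt.2 ?_)
      rw [hφτ, hc₀]
      refine Real.cos_le_cos_of_nonneg_of_le_pi hδL.le ?_ ?_
      · rw [div_le_iff₀ hL]
        nlinarith
      · gcongr
    refine ⟨n, ?_⟩
    rw [abs_lt] at hlt'
    constructor <;> linarith [hlt'.1, hlt'.2]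

/-- By the intermediate value theorem `h` takes a whole interval of values, so the corresponding
polynomial has infinitely many roots. -/
theorem eq_zero_of_sum_mul_pow_eq_zero {h : ℝ → ℝ} (hc : Continuous h) {t₁ t₂ : ℝ}
    (h₁ : h t₁ ≠ 0) (h₂ : h t₂ = 0) {n : ℕ} {c : Fin (n + 1) → ℂ}
    (hsum : ∀ t, ∑ j, c j * (h t : ℂ) ^ ((j : ℕ) + 1) = 0) : c = 0 := by
  set p : Polynomial ℂ := ∑ j : Fin (n + 1), Polynomial.C (c j) * Polynomial.X ^ ((j : ℕ) + 1)
    with hp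
  have hroot : ∀ y ∈ uIcc (h t₂) (h t₁), p.IsRoot (y : ℂ) := fun y hy => by
    obtain ⟨t, -, rfl⟩ := intermediate_value_uIcc hc.continuousOn hy
    rw [Polynomial.IsRoot, hp, Polynomial.eval_finsetSum]
    simpa using hsum t
  have hinf : {z : ℂ | p.IsRoot z}.Infinite := by
    have h3 : (uIcc (h t₂) (h t₁)).Infinite := by
      rw [h₂, uIcc]
      refine Icc_infinite ?_
      rcases lt_or_gt_of_ne h₁ with h | h
      · simpa [min_eq_right h.le, max_eq_left h.le] using h
      · simpa [min_eq_left h.le, max_eq_right h.le] using h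
    refine (h3.image (Complex.ofReal_injective.injOn)).mono ?_
    rintro _ ⟨y, hy, rfl⟩
    exact hroot y hy
  have hp0 := Polynomial.eq_zero_of_infinite_isRoot p hinf
  ext i
  have h4 := congrArg (fun q : Polynomial ℂ => q.coeff ((i : ℕ) + 1)) hp0
  simp only [hp, Polynomial.finsetSum_coeff, Polynomial.coeff_C_mul, Polynomial.coeff_X_pow,
    Polynomial.coeff_zero, add_left_inj, mul_ite, mul_one, mul_zero, Fin.val_inj,
    Finset.sum_ite_eq, Finset.mem_univ, if_true] at h4
  exact h4

/-- On a finite-dimensional space an injective linear map is bounded below. This later bounds the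
derivatives of the trial functions by the functions themselves, with a constant free of k. -/
theorem exists_norm_le_of_injective {E F G : Type*} [NormedAddCommGroup E] [NormedSpace ℂ E]
    [FiniteDimensional ℂ E] [NormedAddCommGroup F] [NormedSpace ℂ F] [NormedAddCommGroup G]
    [NormedSpace ℂ G] (A : E →ₗ[ℂ] F) (B : E →ₗ[ℂ] G) (hA : Function.Injective A) :
    ∃ C, 0 ≤ C ∧ ∀ x, ‖B x‖ ≤ C * ‖A x‖ := by
  obtain ⟨K, -, hK⟩ := A.exists_antilipschitzWith (LinearMap.ker_eq_bot.2 hA)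
  set B' := LinearMap.toContinuousLinearMap B
  refine ⟨‖B'‖ * K, by positivity, fun x => ?_⟩
  rw [mul_assoc]
  refine (B'.le_opNorm x).trans (mul_le_mul_of_nonneg_left ?_ (norm_nonneg _))
  have := hK.le_mul_dist x 0
  rwa [map_zero, dist_zero_right, dist_zero_right] at this

/-- The continuous representative of `invD x`, as a linear map. -/
def invDLin {L : ℝ} [Fact (0 < L)] : CircleL2 L →ₗ[ℂ] (ℝ → ℂ) where
  toFun := invDFun
  map_add' := invDFun_add
  map_smul' := invDFun_smul

theorem invDFun_sum {L : ℝ} [Fact (0 < L)] {n : ℕ} (x : Fin n → CircleL2 L) (c : Fin n → ℂ)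
    (t : ℝ) : invDFun (∑ j, c j • x j) t = ∑ j, c j * invDFun (x j) t := by
  have h : invDLin (∑ j, c j • x j) = ∑ j, c j • invDLin (x j) := by
    rw [map_sum]
    exact Finset.sum_congr rfl fun j _ => map_smul _ _ _
  have h2 := congrFun h t
  rw [Finset.sum_apply] at h2
  exact h2

/-- Periodic solutions of `e' = -i q e`, where `q` has mean zero. -/
theorem exists_phase {L : ℝ} {q : ℝ → ℝ} (hq : IsTame q)
    (hqp : Function.Periodic q L) (h0 : ∫ t in (0 : ℝ)..L, q t = 0) :
    ∃ e : ℝ → ℂ, Continuous e ∧ Function.Periodic e L ∧ (∀ t, ‖e t‖ = 1) ∧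
      ∀ t, ContinuousAt q t → HasDerivAt e (e t * (-Complex.I * q t)) t := by
  obtain ⟨C, hC⟩ := hq.bounded
  have hi : ∀ a b : ℝ, IntervalIntegrable q volume a b := fun a b =>
    (intervalIntegrable_const (c := C)).mono_fun hq.measurable.aestronglyMeasurable
      (Eventually.of_forall fun t => (hC t).trans (le_abs_self C))
  set θ : ℝ → ℝ := fun t => ∫ y in (0 : ℝ)..t, q y with hθ
  have hθc : Continuous θ := intervalIntegral.continuous_primitive hi 0
  have hθp : Function.Periodic θ L := fun t => by
    simp only [hθ]
    rw [← intervalIntegral.integral_add_adjacent_intervals (hi 0 t) (hi t (t + L)),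
      hqp.intervalIntegral_add_eq t 0, zero_add, h0, add_zero]
  refine ⟨fun t => Complex.exp (-Complex.I * θ t), ?_, fun t => by simp only [hθp t],
    fun t => ?_, fun t ht => ?_⟩
  · exact Complex.continuous_exp.comp
      (continuous_const.mul (Complex.continuous_ofReal.comp hθc))
  · dsimp only
    rw [show -Complex.I * (θ t : ℂ) = ((-θ t : ℝ) : ℂ) * Complex.I by push_cast; ring]
    exact Complex.norm_exp_ofReal_mul_I _
  · have h1 : HasDerivAt θ (q t) t := intervalIntegral.integral_hasDerivAt_right (hi 0 t)
      hq.measurable.stronglyMeasurable.stronglyMeasurableAtFilter ht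
    exact (h1.ofReal_comp.const_mul (-Complex.I)).cexp

theorem periodic_deriv {h : ℝ → ℝ} {L : ℝ} (hp : Function.Periodic h L) :
    Function.Periodic (deriv h) L := fun t => by
  rw [← deriv_comp_add_const, hp.funext]

namespace IsPeriodicPencil

variable {L : ℝ} [hL : Fact (0 < L)] {a γ β r : ℝ → ℝ} {v₂ : ℝ}
  (hP : IsPeriodicPencil L a γ β r v₂) (γ₀ : ℝ)

/-- The trial functions are e h^{j+1}, with a bump h supported where β ≤ (v₂ + ε) r and a unimodular
phase with e' = -i (γ₀ + k γ - M χ) e. Because χ h = 0, the phase removes γ₀ + k γ entirely: D_k (e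
h^{j+1}) = -i e (h^{j+1})'. Hence the energy bound does not depend on k. The term M χ only serves to
give the exponent mean zero, so that e is periodic. -/
theorem exists_trial {ε : ℝ} (hε : 0 < ε) (n : ℕ) : ∃ C : ℝ, ∀ k > 0,
    ∃ J : (Fin (n + 1) → ℂ) →ₗ[ℂ] CircleL2 L, Function.Injective J ∧ ∀ c,
      ‖hP.S₀ γ₀ (J c) + ((k : ℝ) : ℂ) • hP.S₁ (J c)‖ ^ 2 ≤ C * ‖hP.emb (J c)‖ ^ 2 ∧
        ‖hP.S₂ (J c)‖ ^ 2 ≤ (v₂ + ε) * ‖hP.emb (J c)‖ ^ 2 := by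
  obtain ⟨u, v, huv, hI⟩ := hP.approx ε hε
  obtain ⟨h, χ, hh, hhp, hχ, hχp, hχh, hχi, ⟨t₁, ht₁⟩, hsupp⟩ := exists_periodic_bump hL.out huv
  -- If h had no zero, χ would vanish identically, against its positive integral. Together with ht₁
  -- this makes h nonconstant.
  obtain ⟨t₂, ht₂⟩ : ∃ t, h t = 0 := by
    by_contra hne
    push Not at hne
    have : ∀ t, χ t = 0 := fun t => (mul_eq_zero.1 (hχh t)).resolve_right (hne t)
    simp [this] at hχi
  have hhc := hh.continuous
  have hdc : Continuous (deriv h) := hh.continuous_deriv le_rfl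
  have hdp := periodic_deriv hhp
  have hder : ∀ t, HasDerivAt h (deriv h t) t := fun t =>
    (hh.differentiable one_ne_zero t).hasDerivAt
  have hof := Complex.continuous_ofReal
  have hrep : ∀ {f : ℝ → ℂ}, Continuous f → Function.Periodic f L →
      ∃ x : CircleL2 L, Represents x f := fun hf hp =>
    exists_represents hf.measurable (exists_norm_le_of_periodic hf hp) hp
  set p : Fin (n + 1) → ℝ → ℂ := fun j t => (h t : ℂ) ^ ((j : ℕ) + 1) with hpdef
  set p' : Fin (n + 1) → ℝ → ℂ := fun j t =>
    ((j : ℕ) + 1 : ℂ) * (h t : ℂ) ^ (j : ℕ) * ((deriv h t : ℝ) : ℂ) with hp'def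
  have hpc : ∀ j, Continuous (p j) := fun j => (hof.comp hhc).pow _
  have hp'c : ∀ j, Continuous (p' j) := fun j =>
    (continuous_const.mul ((hof.comp hhc).pow _)).mul (hof.comp hdc)
  have hpp : ∀ j, Function.Periodic (p j) L := fun j t => by simp only [hpdef, hhp t]
  have hp'p : ∀ j, Function.Periodic (p' j) L := fun j t => by
    simp only [hp'def, hhp t, hdp t]
  have hpd : ∀ j t, HasDerivAt (p j) (p' j t) t := fun j t => by
    refine ((hder t).ofReal_comp.pow ((j : ℕ) + 1)).congr_deriv ?_
    simp only [hp'def]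
    push_cast
    rfl
  choose α hα using fun j => hrep (hpc j) (hpp j)
  choose α' hα' using fun j => hrep (hp'c j) (hp'p j)
  set A := Fintype.linearCombination ℂ α with hA
  set B := Fintype.linearCombination ℂ α' with hB
  have hArep : ∀ c, Represents (A c) fun t => ∑ j, c j * p j t := fun c => by
    rw [hA, Fintype.linearCombination_apply]
    exact Represents.sum hα c
  have hBrep : ∀ c, Represents (B c) fun t => ∑ j, c j * p' j t := fun c => by
    rw [hB, Fintype.linearCombination_apply]
    exact Represents.sum hα' c
  have hsumc : ∀ c : Fin (n + 1) → ℂ, Continuous fun t => ∑ j, c j * p j t := fun c =>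
    continuous_finsetSum _ fun j _ => continuous_const.mul (hpc j)
  have hAinj : Function.Injective A := by
    rw [← LinearMap.ker_eq_bot, LinearMap.ker_eq_bot']
    intro c hc
    have h1 := hArep c
    rw [hc] at h1
    have h2 : (fun t => ∑ j, c j * p j t) =ᵐ[volume] fun _ => 0 := by
      filter_upwards [h1, represents_zero (L := L)] with t g1 g2
      rw [← g1, g2]
    have h3 := (hsumc c).ae_eq_iff_eq volume continuous_const |>.1 h2
    exact eq_zero_of_sum_mul_pow_eq_zero hhc ht₁ ht₂ fun t => congrFun h3 t
  -- The constant is fixed before k. It concerns the real powers of h without phase, which suffices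
  -- because |e| = 1.
  obtain ⟨K, hK, hBA⟩ := exists_norm_le_of_injective A B hAinj
  obtain ⟨Ca, hCa⟩ := hP.tame_a.bounded
  obtain ⟨mr, hmr, hrm⟩ := hP.r_pos
  refine ⟨(√Ca * (K * (√mr)⁻¹)) ^ 2, fun k _ => ?_⟩
  set M := (∫ t in (0 : ℝ)..L, (γ₀ + k * γ t)) / ∫ t in (0 : ℝ)..L, χ t with hM
  have hχt : IsTame χ := by
    refine ⟨?_, ∅, countable_empty, fun t _ => hχ.continuousAt⟩
    obtain ⟨C, hC⟩ := exists_norm_le_of_periodic (L := L) (hof.comp hχ) fun t => by simp [hχp t]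
    exact ⟨C, fun t => by simpa using hC t⟩
  have hγt : IsTame fun t => γ₀ + k * γ t := by
    have := (IsTame.const γ₀).sub ((IsTame.const (-k)).mul hP.tame_γ)
    simpa using this
  have hqt := hγt.sub ((IsTame.const M).mul hχt)
  have hγi : ∀ a b : ℝ, IntervalIntegrable (fun t => γ₀ + k * γ t) volume a b := fun a b => by
    obtain ⟨C, hC⟩ := hγt.bounded
    exact (intervalIntegrable_const (c := C)).mono_fun hγt.measurable.aestronglyMeasurable
      (Eventually.of_forall fun t => (hC t).trans (le_abs_self C))
  obtain ⟨e, hec, hep, hen, hed⟩ := exists_phase (L := L) hqt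
    (fun t => by simp only [hP.periodic_γ t, hχp t]) (by
      have hMi : IntervalIntegrable (fun t => M * χ t) volume 0 L :=
        (continuous_const.mul hχ).intervalIntegrable _ _
      rw [intervalIntegral.integral_sub (hγi _ _) hMi, intervalIntegral.integral_const_mul,
        hM, div_mul_cancel₀ _ hχi.ne', sub_self])
  choose y hy using fun j => hrep (hec.mul (hpc j))
    (fun t => by simp only [Pi.mul_apply, hep t, hpp j t])
  choose z hz using fun j => hrep (hec.mul (hp'c j))
    (fun t => by simp only [Pi.mul_apply, hep t, hp'p j t])
  set x : Fin (n + 1) → CircleL2 L := fun j => ((Real.pi / L - γ₀ : ℝ) : ℂ) • y j +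
    (-(k : ℂ)) • coeffOp L γ hP.tame_γ (y j) + (-Complex.I) • z j with hx
  have hxrep : ∀ j, Represents (x j) fun t =>
      e t * ((Real.pi / L - γ₀ - k * γ t) * p j t - Complex.I * p' j t) := fun j => by
    refine ((((hy j).smul _).add (((hy j).coeffOp hP.tame_γ hP.periodic_γ).smul _)).add
      ((hz j).smul _)).congr (Eventually.of_forall fun t => ?_)
    simp only [Pi.mul_apply]
    push_cast
    ring
  obtain ⟨-, S, hS, hcont⟩ := hqt
  have hxu : ∀ j, invDFun (x j) = fun t => e t * p j t := fun j => by
    refine invDFun_eq (x j) (hec.mul (hpc j)) (fun t => by simp only [hep t, hpp j t])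
      (hxrep j) hS fun t ht => ?_
    refine ((hed t (hcont t ht)).mul (hpd j t)).congr_deriv ?_
    -- The powers start at exponent one, so every trial function contains a factor h that cancels χ.
    have h1 : (χ t : ℂ) * p j t = 0 := by
      have : (χ t : ℂ) * h t = 0 := by
        rw [← Complex.ofReal_mul, hχh, Complex.ofReal_zero]
      simp only [hpdef]
      rw [pow_succ', ← mul_assoc, this, zero_mul]
    push_cast
    linear_combination (Complex.I * M * e t) * h1 + (e t * p' j t) * Complex.I_mul_I
  set J := Fintype.linearCombination ℂ x with hJ
  have hJrep : ∀ c, Represents (J c) fun t =>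
      ∑ j, c j * (e t * ((Real.pi / L - γ₀ - k * γ t) * p j t - Complex.I * p' j t)) := fun c => by
    rw [hJ, Fintype.linearCombination_apply]
    exact Represents.sum hxrep c
  have hJu : ∀ c t, invDFun (J c) t = e t * ∑ j, c j * p j t := fun c t => by
    rw [hJ, Fintype.linearCombination_apply, invDFun_sum, Finset.mul_sum]
    refine Finset.sum_congr rfl fun j _ => ?_
    rw [hxu]
    ring
  have he0 : ∀ t, e t ≠ 0 := fun t h0 => by
    have := hen t
    rw [h0, norm_zero] at this
    exact zero_ne_one this
  refine ⟨J, ?_, fun c => ?_⟩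
  · rw [← LinearMap.ker_eq_bot, LinearMap.ker_eq_bot']
    intro c hc
    refine eq_zero_of_sum_mul_pow_eq_zero hhc ht₁ ht₂ fun t => ?_
    have h1 := hJu c t
    rw [hc, show invDFun (0 : CircleL2 L) = 0 from map_zero invDLin, Pi.zero_apply] at h1
    exact (mul_eq_zero.1 h1.symm).resolve_left (he0 t)
  have hemb := hP.represents_emb (J c)
  have hS₂ := hP.represents_S₂ (J c)
  have hSS := hP.represents_S₀_add γ₀ k (hJrep c)
  have hAe : ‖A c‖ ≤ (√mr)⁻¹ * ‖hP.emb (J c)‖ := by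
    refine (hArep c).norm_le hemb fun t => ?_
    have hs : 0 < √mr := Real.sqrt_pos.2 hmr
    rw [hJu, norm_mul, norm_mul, hen, one_mul, Complex.norm_real,
      Real.norm_of_nonneg (Real.sqrt_nonneg _), ← mul_assoc]
    refine le_mul_of_one_le_left (norm_nonneg _) ?_
    rw [inv_mul_eq_div, one_le_div hs]
    exact Real.sqrt_le_sqrt (hrm t)
  have hSB : ‖hP.S₀ γ₀ (J c) + ((k : ℝ) : ℂ) • hP.S₁ (J c)‖ ≤ √Ca * ‖B c‖ := by
    refine hSS.norm_le (hBrep c) fun t => ?_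
    have h1 : (∑ j, c j * (e t * ((Real.pi / L - γ₀ - k * γ t) * p j t - Complex.I * p' j t))) +
        (γ₀ - Real.pi / L + k * γ t) * invDFun (J c) t =
          e t * (-Complex.I * ∑ j, c j * p' j t) := by
      rw [hJu]
      simp only [Finset.mul_sum]
      rw [← Finset.sum_add_distrib]
      refine Finset.sum_congr rfl fun j _ => ?_
      ring
    rw [h1, norm_mul, norm_mul, hen, one_mul, norm_mul, norm_neg, Complex.norm_I, one_mul,
      Complex.norm_real, Real.norm_of_nonneg (Real.sqrt_nonneg _)]
    exact mul_le_mul_of_nonneg_right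
      (Real.sqrt_le_sqrt ((le_abs_self _).trans (hCa t))) (norm_nonneg _)
  have hvε : 0 ≤ v₂ + ε := add_nonneg hP.v_nonneg hε.le
  have hS₂e : ‖hP.S₂ (J c)‖ ≤ √(v₂ + ε) * ‖hP.emb (J c)‖ := by
    refine hS₂.norm_le hemb fun t => ?_
    rw [hJu]
    by_cases h0 : h t = 0
    · have : ∑ j, c j * p j t = 0 := Finset.sum_eq_zero fun j _ => by
        simp only [hpdef, h0, Complex.ofReal_zero, zero_pow (Nat.succ_ne_zero _), mul_zero]
      rw [this]
      simp
    · obtain ⟨m, hm⟩ := hsupp t h0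
      have h1 := hI _ hm
      rw [hP.periodic_β.sub_int_mul_eq m, hP.periodic_r.sub_int_mul_eq m] at h1
      rw [norm_mul _ (e t * _), norm_mul _ (e t * _), Complex.norm_real, Complex.norm_real,
        Real.norm_of_nonneg (Real.sqrt_nonneg _), Real.norm_of_nonneg (Real.sqrt_nonneg _),
        ← mul_assoc, ← Real.sqrt_mul hvε]
      exact mul_le_mul_of_nonneg_right (Real.sqrt_le_sqrt h1) (norm_nonneg _)
  constructor
  · rw [← mul_pow]
    refine pow_le_pow_left₀ (norm_nonneg _) ?_ 2
    calc _ ≤ √Ca * ‖B c‖ := hSB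
      _ ≤ √Ca * (K * ((√mr)⁻¹ * ‖hP.emb (J c)‖)) := by
          refine mul_le_mul_of_nonneg_left ((hBA c).trans ?_) (Real.sqrt_nonneg _)
          exact mul_le_mul_of_nonneg_left hAe hK
      _ = _ := by ring
  · calc ‖hP.S₂ (J c)‖ ^ 2 ≤ (√(v₂ + ε) * ‖hP.emb (J c)‖) ^ 2 :=
          pow_le_pow_left₀ (norm_nonneg _) hS₂e 2
      _ = _ := by rw [mul_pow, Real.sq_sqrt hvε]

end IsPeriodicPencil

/-! ### Bands of the periodic pencil -/

namespace IsPeriodicPencil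

variable {L : ℝ} [hL : Fact (0 < L)] {a γ β r : ℝ → ℝ} {v₂ : ℝ}
  (hP : IsPeriodicPencil L a γ β r v₂) (γ₀ : ℝ)

theorem emb_injective : Function.Injective hP.emb := by
  obtain ⟨m, hm, hr⟩ := hP.r_pos
  rw [injective_iff_map_eq_zero]
  intro x hx
  exact invD_eq_zero (mulOp_eq_zero (fun _ => (Real.sqrt_pos.2 (hm.trans_le (hr _))).ne') hx)

theorem isCompactOperator_emb : IsCompactOperator hP.emb :=
  isCompactOperator_invD.clm_comp (coeffOp L (fun t => √(r t)) hP.tame_r.sqrt)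

theorem represents_self (x : CircleL2 L) : Represents x fun t => x (t : AddCircle L) :=
  Eventually.of_forall fun _ => rfl

theorem norm_le_coeffOp {f : ℝ → ℝ} (hf : IsTame f) (hp : Function.Periodic f L) {m : ℝ}
    (hm : 0 < m) (h : ∀ t, m ≤ f t) (x : CircleL2 L) : ‖x‖ ≤ m⁻¹ * ‖coeffOp L f hf x‖ := by
  refine (represents_self x).norm_le ((represents_self x).coeffOp hf hp) fun t => ?_
  rw [norm_mul, Complex.norm_real, Real.norm_of_nonneg (hm.le.trans (h t)), ← mul_assoc]
  refine le_mul_of_one_le_left (norm_nonneg _) ?_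
  rw [inv_mul_eq_div, one_le_div hm]
  exact h t

theorem exists_norm_le : ∃ C, ∀ x, ‖x‖ ≤ C * (‖hP.S₀ γ₀ x‖ + ‖hP.emb x‖) := by
  obtain ⟨ma, hma, ha⟩ := hP.a_pos
  obtain ⟨mr, hmr, hr⟩ := hP.r_pos
  set s : ℂ := ((γ₀ - Real.pi / L : ℝ) : ℂ) with hs
  refine ⟨(√ma)⁻¹ + ‖s‖ * (√mr)⁻¹, fun x => ?_⟩
  have h1 := norm_le_coeffOp (L := L) hP.tame_a.sqrt
    (fun t => by simp only [hP.periodic_a t]) (Real.sqrt_pos.2 hma)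
    (fun t => Real.sqrt_le_sqrt (ha t)) (x + s • invD x)
  have h2 := norm_le_coeffOp (L := L) hP.tame_r.sqrt
    (fun t => by simp only [hP.periodic_r t]) (Real.sqrt_pos.2 hmr)
    (fun t => Real.sqrt_le_sqrt (hr t)) (invD x)
  have h3 : ‖x‖ ≤ ‖x + s • invD x‖ + ‖s‖ * ‖invD x‖ := by
    have := norm_sub_le (x + s • invD x) (s • invD x)
    rwa [add_sub_cancel_right, norm_smul] at this
  have p1 : 0 ≤ (√ma)⁻¹ := inv_nonneg.2 (Real.sqrt_nonneg _)
  have p2 : 0 ≤ ‖s‖ * (√mr)⁻¹ := mul_nonneg (norm_nonneg _) (inv_nonneg.2 (Real.sqrt_nonneg _))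
  change ‖x + s • invD x‖ ≤ (√ma)⁻¹ * ‖hP.S₀ γ₀ x‖ at h1
  change ‖invD x‖ ≤ (√mr)⁻¹ * ‖hP.emb x‖ at h2
  calc ‖x‖ ≤ (√ma)⁻¹ * ‖hP.S₀ γ₀ x‖ + ‖s‖ * ((√mr)⁻¹ * ‖hP.emb x‖) :=
        h3.trans (add_le_add h1 (mul_le_mul_of_nonneg_left h2 (norm_nonneg _)))
    _ ≤ _ := by
        nlinarith [mul_nonneg p1 (norm_nonneg (hP.emb x)),
          mul_nonneg p2 (norm_nonneg (hP.S₀ γ₀ x))]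

theorem exists_norm_S₁_le : ∃ C, ∀ x, ‖hP.S₁ x‖ ≤ C * ‖hP.S₂ x‖ := by
  obtain ⟨C, hC⟩ := hP.γ_le
  obtain ⟨ma, hma, ha⟩ := hP.a_pos
  refine ⟨√C, fun x => ?_⟩
  have h1 : Represents (hP.S₁ x) fun t => (√(a t) : ℝ) * ((γ t : ℂ) * invDFun x t) :=
    ((represents_invD x).coeffOp hP.tame_γ hP.periodic_γ).coeffOp hP.tame_a.sqrt
      fun t => by simp only [hP.periodic_a t]
  refine h1.norm_le (hP.represents_S₂ x) fun t => ?_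
  rw [norm_mul, norm_mul, norm_mul, Complex.norm_real, Complex.norm_real, Complex.norm_real,
    Real.norm_of_nonneg (Real.sqrt_nonneg _), Real.norm_of_nonneg (Real.sqrt_nonneg _),
    Real.norm_eq_abs, ← mul_assoc, ← mul_assoc, ← Real.sqrt_sq_eq_abs,
    ← Real.sqrt_mul (hma.le.trans (ha t)), ← Real.sqrt_mul' _ (hP.β_pos t).le]
  exact mul_le_mul_of_nonneg_right (Real.sqrt_le_sqrt (hC t)) (norm_nonneg _)

theorem exists_norm_S₂_le : ∃ C, ∀ x, ‖hP.S₂ x‖ ≤ C * ‖hP.emb x‖ := by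
  obtain ⟨C, hC⟩ := hP.tame_β.bounded
  obtain ⟨m, hm, hr⟩ := hP.r_pos
  refine ⟨√(C / m), fun x => (hP.represents_S₂ x).norm_le (hP.represents_emb x) fun t => ?_⟩
  have hr0 := hm.le.trans (hr t)
  rw [norm_mul, norm_mul, Complex.norm_real, Complex.norm_real,
    Real.norm_of_nonneg (Real.sqrt_nonneg _), Real.norm_of_nonneg (Real.sqrt_nonneg _),
    ← mul_assoc, ← Real.sqrt_mul' _ hr0]
  refine mul_le_mul_of_nonneg_right (Real.sqrt_le_sqrt ?_) (norm_nonneg _)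
  have hC0 : 0 ≤ C := (abs_nonneg _).trans (hC t)
  calc β t ≤ C := (le_abs_self _).trans (hC t)
    _ = C / m * m := by field_simp
    _ ≤ C / m * r t := mul_le_mul_of_nonneg_left (hr t) (by positivity)

theorem le_norm_S₂ (x : CircleL2 L) : v₂ * ‖hP.emb x‖ ^ 2 ≤ ‖hP.S₂ x‖ ^ 2 := by
  obtain ⟨m, hm, hr⟩ := hP.r_pos
  have h := ((hP.represents_emb x).smul ((√v₂ : ℝ) : ℂ)).norm_le (hP.represents_S₂ x) (C := 1)
    fun t => by
      rw [one_mul, norm_mul, norm_mul, norm_mul, Complex.norm_real, Complex.norm_real,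
        Complex.norm_real, Real.norm_of_nonneg (Real.sqrt_nonneg _),
        Real.norm_of_nonneg (Real.sqrt_nonneg _), Real.norm_of_nonneg (Real.sqrt_nonneg _),
        ← mul_assoc, ← Real.sqrt_mul hP.v_nonneg]
      exact mul_le_mul_of_nonneg_right (Real.sqrt_le_sqrt (hP.v_le t)) (norm_nonneg _)
  rw [one_mul, norm_smul, Complex.norm_real, Real.norm_of_nonneg (Real.sqrt_nonneg _)] at h
  calc v₂ * ‖hP.emb x‖ ^ 2 = (√v₂ * ‖hP.emb x‖) ^ 2 := by rw [mul_pow, Real.sq_sqrt hP.v_nonneg]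
    _ ≤ _ := by gcongr

theorem S₂_eq_zero {x : CircleL2 L} (h : hP.S₂ x = 0) : x = 0 :=
  invD_eq_zero (mulOp_eq_zero (fun _ => (Real.sqrt_pos.2 (hP.β_pos _)).ne') h)

/-- All bands of the periodic pencil have asymptotic slope `c √v₂`, for any eigenproblem whose
solutions correspond to those of the pencil by a multiplication. -/
theorem allBandsHaveSlope (hP : IsPeriodicPencil L a γ β r v₂) {γ₀ c : ℝ} (hc : 0 < c)
    {E : ℝ → ℝ → Submodule ℂ (ℝ → ℂ)} {τ : ℝ → ℂ}
    (hτ : ∀ t, τ t ≠ 0) (hE : ∀ k μ ψ, ψ ∈ E k μ ↔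
      IsPeriodicSolution L a γ β r γ₀ k μ fun t => τ t * ψ t) :
    AllBandsHaveSlope c E (c * √v₂) := by
  refine (isQuadraticPencil_gramForm hP.emb_injective hP.isCompactOperator_emb
    (hP.exists_norm_le γ₀) hP.exists_norm_S₁_le hP.exists_norm_S₂_le (fun x => hP.S₂_eq_zero)
    hP.v_nonneg hP.le_norm_S₂ fun ε hε n => hP.exists_trial γ₀ hε n).allBandsHaveSlope hc
    fun k μ => ?_
  let Φ : CircleL2 L →ₗ[ℂ] (ℝ → ℂ) :=
    { toFun := fun x t => (τ t)⁻¹ * invDFun x t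
      map_add' := fun x y => by
        ext t
        simp only [invDFun_add, Pi.add_apply, mul_add]
      map_smul' := fun z x => by
        ext t
        simp only [invDFun_smul, Pi.smul_apply, smul_eq_mul, RingHom.id_apply]
        ring }
  have hΦ : ∀ x, (fun t => τ t * Φ x t) = invDFun x := fun x => by
    ext t
    exact mul_inv_cancel_left₀ (hτ t) _
  have hinj : Function.Injective Φ := fun x y hxy => by
    refine invDFun_injective ?_
    rw [← hΦ x, hxy, hΦ y]
  have hmap : E k μ = (formEigenspace (hP.emb : CircleL2 L →ₗ[ℂ] CircleL2 L)
      (gramForm (hP.S₀ γ₀) hP.S₁ hP.S₂ k) μ).map Φ := by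
    ext ψ
    rw [hE, Submodule.mem_map]
    constructor
    · intro h
      obtain ⟨x, hx, hxU⟩ := hP.exists_mem_of_isPeriodicSolution γ₀ k h
      refine ⟨x, hx, ?_⟩
      ext t
      change (τ t)⁻¹ * invDFun x t = ψ t
      rw [hxU]
      exact inv_mul_cancel_left₀ (hτ t) _
    · rintro ⟨x, hx, rfl⟩
      rw [hΦ]
      exact hP.isPeriodicSolution_of_mem γ₀ k hx
  rw [hmap]
  exact LinearEquiv.rank_eq (Submodule.equivMapOfInjective _ hinj _).symm

end IsPeriodicPencil

/-! ### Bloch solutions -/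

theorem hasDerivAt_cexp_I_mul (q t : ℝ) :
    HasDerivAt (fun t : ℝ => Complex.exp (Complex.I * q * t))
      (Complex.exp (Complex.I * q * t) * (Complex.I * q)) t := by
  have h : HasDerivAt (fun t : ℝ => Complex.I * q * (t : ℂ)) (Complex.I * q) t := by
    simpa using (Complex.ofRealCLM.hasDerivAt (x := t)).const_mul (Complex.I * q)
  exact h.cexp

theorem isBloch_iff {L kx : ℝ} {f : ℝ → ℂ} :
    IsBloch L kx f ↔ Function.Periodic (fun t : ℝ => Complex.exp (Complex.I * kx * t) * f t) L := by
  refine forall_congr' fun t => ?_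
  have h : Complex.exp (Complex.I * kx * ((t + L : ℝ) : ℂ)) =
      Complex.exp (Complex.I * kx * t) * Complex.exp (Complex.I * kx * L) := by
    rw [← Complex.exp_add]
    congr 1
    push_cast
    ring
  dsimp only
  rw [h, mul_assoc (Complex.exp (Complex.I * kx * t)), mul_right_inj' (Complex.exp_ne_zero _)]
  exact eq_comm

theorem continuous_cexp_mul_iff {kx : ℝ} {f : ℝ → ℂ} :
    Continuous (fun t : ℝ => Complex.exp (Complex.I * kx * t) * f t) ↔ Continuous f := by
  have he : ∀ q : ℝ, Continuous fun t : ℝ => Complex.exp (Complex.I * q * t) := fun q =>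
    continuous_iff_continuousAt.2 fun t => (hasDerivAt_cexp_I_mul q t).continuousAt
  refine ⟨fun h => ?_, fun h => (he kx).mul h⟩
  refine ((he (-kx)).mul h).congr fun t => ?_
  simp only [Pi.mul_apply]
  rw [← mul_assoc, ← Complex.exp_add]
  simp

theorem hasDerivAt_cexp_mul_iff {kx : ℝ} {f : ℝ → ℂ} {d : ℂ} {t : ℝ} :
    HasDerivAt (fun t : ℝ => Complex.exp (Complex.I * kx * t) * f t)
      (Complex.exp (Complex.I * kx * t) * (Complex.I * kx * f t + d)) t ↔ HasDerivAt f d t := by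
  constructor
  · intro h
    have h' := (hasDerivAt_cexp_I_mul (-kx) t).mul h
    refine HasDerivAt.congr_of_eventuallyEq (h'.congr_deriv ?_)
      (Eventually.of_forall fun y => ?_)
    · have e : Complex.exp (Complex.I * ((-kx : ℝ) : ℂ) * t) * Complex.exp (Complex.I * kx * t) =
          1 := by
        rw [← Complex.exp_add]
        simp
      push_cast at e ⊢
      linear_combination d * e
    · simp only [Pi.mul_apply]
      rw [← mul_assoc, ← Complex.exp_add]
      simp
  · intro h
    exact ((hasDerivAt_cexp_I_mul kx t).mul h).congr_deriv (by ring)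

/-- Periodic solutions `exp(i kx t) H` of the pencil with `γ₀ = -kx`, in terms of the Bloch functions
`H` and the flux `v`. -/
theorem isPeriodicSolution_cexp_mul_iff {L : ℝ} {a γ β r : ℝ → ℝ} {kx k μ : ℝ} {H : ℝ → ℂ} :
    IsPeriodicSolution L a γ β r (-kx) k μ (fun t => Complex.exp (Complex.I * kx * t) * H t) ↔
      IsBloch L kx H ∧ Continuous H ∧ ∃ v : ℝ → ℂ, IsBloch L kx v ∧ Continuous v ∧
        ∃ S : Set ℝ, S.Countable ∧ ∀ t, t ∉ S →
          HasDerivAt H (Complex.I * (v t / a t - k * γ t * H t)) t ∧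
          HasDerivAt v (-Complex.I * (k * γ t * v t + k ^ 2 * β t * H t - μ * r t * H t)) t := by
  have key : ∀ (v : ℝ → ℂ) (t : ℝ),
      (HasDerivAt (fun t : ℝ => Complex.exp (Complex.I * kx * t) * H t)
        (Complex.I * (Complex.exp (Complex.I * kx * t) * v t / a t - (((-kx : ℝ) : ℂ) + k * γ t) *
          (Complex.exp (Complex.I * kx * t) * H t))) t ↔
        HasDerivAt H (Complex.I * (v t / a t - k * γ t * H t)) t) ∧
      (HasDerivAt (fun t : ℝ => Complex.exp (Complex.I * kx * t) * v t)
        (-Complex.I * ((((-kx : ℝ) : ℂ) + k * γ t) * (Complex.exp (Complex.I * kx * t) * v t) +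
          k ^ 2 * β t * (Complex.exp (Complex.I * kx * t) * H t) -
          μ * r t * (Complex.exp (Complex.I * kx * t) * H t))) t ↔
        HasDerivAt v (-Complex.I * (k * γ t * v t + k ^ 2 * β t * H t - μ * r t * H t)) t) :=
    fun v t => by
    rw [← hasDerivAt_cexp_mul_iff (kx := kx) (f := H), ← hasDerivAt_cexp_mul_iff (kx := kx) (f := v)]
    constructor
    · refine iff_of_eq (congrArg (fun z => HasDerivAt _ z t) ?_)
      push_cast
      ring
    · refine iff_of_eq (congrArg (fun z => HasDerivAt _ z t) ?_)
      push_cast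
      ring
  rw [isBloch_iff]
  constructor
  · rintro ⟨h1, h2, W, h3, h4, S, hS, hd⟩
    refine ⟨h2, continuous_cexp_mul_iff.1 h1, fun t => Complex.exp (Complex.I * (-kx : ℝ) * t) * W t,
      ?_⟩
    have e : ∀ t : ℝ, Complex.exp (Complex.I * kx * t) *
        (Complex.exp (Complex.I * (-kx : ℝ) * t) * W t) = W t := fun t => by
      rw [← mul_assoc, ← Complex.exp_add]
      simp
    have e' := funext e
    refine ⟨isBloch_iff.2 ?_, continuous_cexp_mul_iff.2 h3, S, hS, fun t ht => ?_⟩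
    · rwa [e']
    · have h5 := key (fun t => Complex.exp (Complex.I * (-kx : ℝ) * t) * W t) t
      simp only [e] at h5
      exact ⟨h5.1.1 (hd t ht).1, h5.2.1 (hd t ht).2⟩
  · rintro ⟨h1, h2, v, h3, h4, S, hS, hd⟩
    exact ⟨continuous_cexp_mul_iff.2 h2, h1, _, continuous_cexp_mul_iff.2 h4, isBloch_iff.1 h3,
      S, hS, fun t ht => ⟨(key v t).1.2 (hd t ht).1, (key v t).2.2 (hd t ht).2⟩⟩

/-! ### Sturm-Liouville operators with Bloch boundary conditions -/

/-- For u = w ψ, division of the equation by w gives -(p u')' + k² (V/w²) u = μ u/w², so that β/r is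
again V. The factor e^{i kx t} makes u periodic at the price of γ₀ = -kx, and the flux is -i times
the one in the Bloch problem. -/
theorem mem_blochEigenspace_iff {L kx : ℝ} {w p V : ℝ → ℝ} (hwp : Function.Periodic w L)
    (hw : ∀ t, 0 < w t) (hp : ∀ t, 0 < p t) (k μ : ℝ) (ψ : ℝ → ℂ) :
    ψ ∈ blochEigenspace L kx w p V k μ ↔
      IsPeriodicSolution L p (fun _ => 0) (fun t => V t * ((w t)⁻¹ * (w t)⁻¹))
        (fun t => (w t)⁻¹ * (w t)⁻¹) (-kx) k μ
        fun t => (Complex.exp (Complex.I * kx * t) * w t) * ψ t := by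
  have hw0 : ∀ t, (w t : ℂ) ≠ 0 := fun t => Complex.ofReal_ne_zero.2 (hw t).ne'
  have hp0 : ∀ t, (p t : ℂ) ≠ 0 := fun t => Complex.ofReal_ne_zero.2 (hp t).ne'
  have hII := Complex.I_mul_I
  have hbl : IsBloch L kx ψ ↔ IsBloch L kx fun t => (w t : ℂ) * ψ t := by
    refine forall_congr' fun t => ?_
    dsimp only
    rw [hwp t, mul_left_comm, mul_right_inj' (hw0 t)]
  have hneg : ∀ (z : ℂ) {v : ℝ → ℂ}, IsBloch L kx v → IsBloch L kx fun t => z * v t :=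
    fun z v hv t => by
    dsimp only
    rw [hv t]
    ring
  simp only [mul_assoc (Complex.exp _) (w _ : ℂ)]
  rw [isPeriodicSolution_cexp_mul_iff, ← hbl]
  refine and_congr_right fun _ => and_congr_right fun _ => ?_
  constructor
  · rintro ⟨v, hv, hvc, S, hS, hd⟩
    refine ⟨fun t => -Complex.I * v t, hneg _ hv, continuous_const.mul hvc, S, hS, fun t ht => ?_⟩
    obtain ⟨d₁, d₂, h1, h2, h3, h4⟩ := hd t ht
    have hwt := hw0 t
    have hpt := hp0 t
    refine ⟨h1.congr_deriv ?_, (h2.const_mul (-Complex.I)).congr_deriv ?_⟩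
    · dsimp only
      rw [h3]
      push_cast
      field_simp
      linear_combination d₁ * hII
    · have h5 : d₂ = ((k : ℂ) ^ 2 * V t - μ) * ψ t * (w t : ℂ)⁻¹ := by
        rw [← div_eq_mul_inv, eq_div_iff hwt]
        linear_combination -h4
      rw [h5]
      push_cast
      field_simp
      ring
  · rintro ⟨v, hv, hvc, S, hS, hd⟩
    refine ⟨fun t => Complex.I * v t, hneg _ hv, continuous_const.mul hvc, S, hS, fun t ht => ?_⟩
    obtain ⟨h1, h2⟩ := hd t ht
    have hwt := hw0 t
    have hpt := hp0 t
    refine ⟨_, _, h1, h2.const_mul Complex.I, ?_, ?_⟩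
    · push_cast
      field_simp
      ring
    · push_cast
      field_simp
      linear_combination (((k : ℂ) ^ 2 * V t - μ) * ψ t) * hII

/-- Only tameness of the coefficients and the approach to v₂ on intervals are used. In this form the
result also covers the odd modes, whose coefficients are reciprocals and roots of a piecewise smooth
function. -/
theorem allBandsHaveSlope_blochEigenspace_of_isTame {c L kx : ℝ} (hc : 0 < c) (hL : 0 < L)
    {w p V : ℝ → ℝ} {v₂ : ℝ} (hw : IsTame w) (hwp : Function.Periodic w L)
    (hw0 : ∃ m, 0 < m ∧ ∀ t, m ≤ w t) (hp : IsTame p) (hpp : Function.Periodic p L)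
    (hp0 : ∃ m, 0 < m ∧ ∀ t, m ≤ p t) (hV : IsTame V) (hVp : Function.Periodic V L)
    (hV0 : ∀ t, 0 < V t) (hv : 0 ≤ v₂) (hvV : ∀ t, v₂ ≤ V t)
    (happ : ∀ ε > 0, ∃ a b, a < b ∧ ∀ t ∈ Ioo a b, V t < v₂ + ε) :
    AllBandsHaveSlope c (blochEigenspace L kx w p V) (c * √v₂) := by
  have : Fact (0 < L) := ⟨hL⟩
  obtain ⟨m, hm, hmw⟩ := hw0
  obtain ⟨C, hC⟩ := hw.bounded
  have hwpos : ∀ t, 0 < w t := fun t => hm.trans_le (hmw t)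
  have hppos : ∀ t, 0 < p t := fun t => by
    obtain ⟨m, hm, h⟩ := hp0
    exact hm.trans_le (h t)
  have hC0 : 0 < C := (hwpos 0).trans_le ((le_abs_self _).trans (hC 0))
  have hr := (hw.inv hm hmw).mul (hw.inv hm hmw)
  have hrpos : ∀ t, 0 < (w t)⁻¹ * (w t)⁻¹ := fun t =>
    mul_pos (inv_pos.2 (hwpos t)) (inv_pos.2 (hwpos t))
  have hP : IsPeriodicPencil L p (fun _ => 0) (fun t => V t * ((w t)⁻¹ * (w t)⁻¹))
      (fun t => (w t)⁻¹ * (w t)⁻¹) v₂ :=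
    { tame_a := hp
      tame_γ := IsTame.const 0
      tame_β := hV.mul hr
      tame_r := hr
      periodic_a := hpp
      periodic_γ := fun _ => rfl
      periodic_β := fun t => by simp only [hVp t, hwp t]
      periodic_r := fun t => by simp only [hwp t]
      a_pos := hp0
      r_pos := ⟨C⁻¹ * C⁻¹, by positivity, fun t => by
        have h1 : C⁻¹ ≤ (w t)⁻¹ :=
          (inv_le_inv₀ hC0 (hwpos t)).2 ((le_abs_self _).trans (hC t))
        exact mul_le_mul h1 h1 (inv_pos.2 hC0).le (inv_pos.2 (hwpos t)).le⟩
      β_pos := fun t => mul_pos (hV0 t) (hrpos t)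
      γ_le := ⟨0, fun t => by simp⟩
      v_nonneg := hv
      v_le := fun t => mul_le_mul_of_nonneg_right (hvV t) (hrpos t).le
      approx := fun ε hε => by
        obtain ⟨a, b, hab, h⟩ := happ ε hε
        exact ⟨a, b, hab, fun t ht => mul_le_mul_of_nonneg_right (h t ht).le (hrpos t).le⟩ }
  exact hP.allBandsHaveSlope hc
    (fun t => mul_ne_zero (Complex.exp_ne_zero _) (Complex.ofReal_ne_zero.2 (hwpos t).ne'))
    (mem_blochEigenspace_iff hwp hwpos hppos)

theorem allBandsHaveSlope_blochEigenspace {c L kx : ℝ} (hc : 0 < c) (hL : 0 < L)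
    {w p V : ℝ → ℝ} (hw : IsPositiveCoefficient L w) (hp : IsPositiveCoefficient L p)
    (hV : PiecewiseSmooth V) (hVp : Function.Periodic V L) (hV0 : ∀ x, 0 < V x) :
    AllBandsHaveSlope c (blochEigenspace L kx w p V) (c * √(⨅ x, V x)) := by
  have hbdd : BddBelow (range V) := ⟨0, by rintro _ ⟨x, rfl⟩; exact (hV0 x).le⟩
  refine allBandsHaveSlope_blochEigenspace_of_isTame hc hL
    (hw.piecewiseSmooth.isTame hL hw.periodic) hw.periodic hw.bounded_below
    (hp.piecewiseSmooth.isTame hL hp.periodic) hp.periodic hp.bounded_below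
    (hV.isTame hL hVp) hVp hV0 (Real.iInf_nonneg fun x => (hV0 x).le) (fun t => ciInf_le hbdd t)
    fun ε hε => ?_
  obtain ⟨a, ha⟩ := exists_lt_of_ciInf_lt (lt_add_of_pos_right (⨅ x, V x) hε)
  exact hV.exists_Ioo_lt ha

/-! ### Odd and even modes -/

/-- The reciprocal of a piecewise smooth function comes close to its infimum on intervals. -/
theorem PiecewiseSmooth.exists_Ioo_inv_lt {f : ℝ → ℝ} (hf : PiecewiseSmooth f) {m : ℝ}
    (hm : 0 < m) (hmf : ∀ t, m ≤ f t) (hb : BddAbove (range f)) {ε : ℝ} (hε : 0 < ε) :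
    ∃ a b, a < b ∧ ∀ t ∈ Ioo a b, (f t)⁻¹ < (⨆ x, f x)⁻¹ + ε := by
  have hs : 0 < ⨆ x, f x := (hm.trans_le (hmf 0)).trans_le (le_ciSup hb 0)
  have hq : ((⨆ x, f x)⁻¹ + ε)⁻¹ < ⨆ x, f x := by
    rw [inv_lt_comm₀ (by positivity) hs]
    linarith
  obtain ⟨x, hx⟩ := exists_lt_of_lt_ciSup hq
  obtain ⟨a, b, hab, h⟩ := hf.neg.exists_Ioo_lt (neg_lt_neg hx)
  refine ⟨a, b, hab, fun t ht => ?_⟩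
  rw [inv_lt_comm₀ (hm.trans_le (hmf t)) (by positivity)]
  exact neg_lt_neg_iff.1 (h t ht)

theorem IsTame.bddAbove {f : ℝ → ℝ} (hf : IsTame f) : BddAbove (range f) := by
  obtain ⟨C, hC⟩ := hf.bounded
  exact ⟨C, by rintro _ ⟨x, rfl⟩; exact (le_abs_self _).trans (hC x)⟩

namespace IsLayeredDielectric

variable {L : ℝ} {εxx εyy εzz εxz : ℝ → ℝ}

theorem periodic_entries (h : IsLayeredDielectric L εxx εyy εzz εxz) :
    Function.Periodic εxx L ∧ Function.Periodic εyy L ∧ Function.Periodic εzz L ∧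
      Function.Periodic εxz L :=
  ⟨fun x => congrFun (congrFun (h.periodic x) 0) 0, fun x => congrFun (congrFun (h.periodic x) 1) 1,
    fun x => congrFun (congrFun (h.periodic x) 2) 2, fun x => congrFun (congrFun (h.periodic x) 0) 2⟩

/-- The diagonal entries of ε - m and its minor in the variables x and z are nonnegative. The minor
gives Δ ≥ m (εxx + εzz) - m², which is at least m² since both entries are at least m. -/
theorem exists_le (h : IsLayeredDielectric L εxx εyy εzz εxz) :
    ∃ m, 0 < m ∧ ∀ x, m ≤ εxx x ∧ m ≤ εyy x ∧ m ≤ εzz x ∧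
      m ^ 2 ≤ εxx x * εzz x - εxz x * εxz x := by
  obtain ⟨m, hm, hpos⟩ := h.posDef
  refine ⟨m, hm, fun x => ?_⟩
  have h0 := (hpos x).diag_nonneg (i := 0)
  have h1 := (hpos x).diag_nonneg (i := 1)
  have h2 := (hpos x).diag_nonneg (i := 2)
  have hdet := ((hpos x).submatrix ![0, 2]).det_nonneg
  rw [Matrix.det_fin_two] at hdet
  simp [permittivity] at h0 h1 h2 hdet
  refine ⟨h0, h1, h2, ?_⟩
  nlinarith

theorem allBandsHaveSlope_odd (h : IsLayeredDielectric L εxx εyy εzz εxz) {c kx : ℝ} (hc : 0 < c)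
    (hL : 0 < L) : AllBandsHaveSlope c (oddEigenspace L kx εyy) (c / √(⨆ x, εyy x)) := by
  obtain ⟨m, hm, hle⟩ := h.exists_le
  have hmy : ∀ x, m ≤ εyy x := fun x => (hle x).2.1
  have hy0 : ∀ x, 0 < εyy x := fun x => hm.trans_le (hmy x)
  have hyp := h.periodic_entries.2.1
  have ht := h.smooth_yy.isTame hL hyp
  have hs : 0 < ⨆ x, εyy x := (hy0 0).trans_le (le_ciSup ht.bddAbove 0)
  obtain ⟨C, hC⟩ := ht.bounded
  have hC0 : 0 < C := (hy0 0).trans_le ((le_abs_self _).trans (hC 0))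
  rw [div_eq_mul_inv, ← Real.sqrt_inv]
  refine allBandsHaveSlope_blochEigenspace_of_isTame hc hL
    (ht.sqrt.inv (Real.sqrt_pos.2 hm) fun x => Real.sqrt_le_sqrt (hmy x))
    (fun x => by simp only [hyp x]) ⟨(√C)⁻¹, by positivity, fun x => ?_⟩ (IsTame.const 1)
    (fun _ => rfl) ⟨1, one_pos, fun _ => le_rfl⟩ (ht.inv hm hmy) (fun x => by simp only [hyp x])
    (fun x => inv_pos.2 (hy0 x)) (inv_pos.2 hs).le
    (fun x => (inv_le_inv₀ hs (hy0 x)).2 (le_ciSup ht.bddAbove x))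
    fun ε hε => h.smooth_yy.exists_Ioo_inv_lt hm hmy ht.bddAbove hε
  rw [inv_le_inv₀ (Real.sqrt_pos.2 hC0) (Real.sqrt_pos.2 (hy0 x))]
  exact Real.sqrt_le_sqrt ((le_abs_self _).trans (hC x))

/-- The square is completed with εzz/Δ = 1/εxx + εxz²/(εxx Δ). The operator becomes D_k (εxx/Δ) D_k
+ k²/εxx, where D_k contains k εxz/εxx, and the flux is unchanged. This is why the slope involves
εxx. -/
theorem mem_evenEigenspace_iff (hxx : ∀ t, 0 < εxx t)
    (hΔ : ∀ t, 0 < εxx t * εzz t - εxz t * εxz t) {kx : ℝ} (k μ : ℝ) (ψ : ℝ → ℂ) :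
    ψ ∈ evenEigenspace L kx εxx εzz εxz k μ ↔
      IsPeriodicSolution L (fun t => εxx t * (εxx t * εzz t - εxz t * εxz t)⁻¹)
        (fun t => εxz t * (εxx t)⁻¹) (fun t => (εxx t)⁻¹) (fun _ => 1) (-kx) k μ
        fun t => Complex.exp (Complex.I * kx * t) * ψ t := by
  rw [isPeriodicSolution_cexp_mul_iff]
  refine and_congr_right fun _ => and_congr_right fun _ => exists_congr fun v =>
    and_congr_right fun _ => and_congr_right fun _ => exists_congr fun S =>
    and_congr_right fun _ => forall_congr' fun t => forall_congr' fun _ => ?_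
  have hx : (εxx t : ℂ) ≠ 0 := Complex.ofReal_ne_zero.2 (hxx t).ne'
  have hd : ((εxx t * εzz t - εxz t ^ 2 : ℝ) : ℂ) ≠ 0 := by
    rw [pow_two]
    exact Complex.ofReal_ne_zero.2 (hΔ t).ne'
  have hII := Complex.I_mul_I
  rw [← pow_two]
  simp only [Complex.ofReal_div, Complex.ofReal_mul (εxx t) _⁻¹, Complex.ofReal_mul (εxz t),
    Complex.ofReal_inv, Complex.ofReal_one, mul_one]
  have hΔe : ((εxx t * εzz t - εxz t ^ 2 : ℝ) : ℂ) = (εxx t : ℂ) * εzz t - (εxz t : ℂ) ^ 2 := by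
    push_cast
    ring
  generalize ((εxx t * εzz t - εxz t ^ 2 : ℝ) : ℂ) = Δ at hd hΔe ⊢
  generalize (εxx t : ℂ) = x at hx hΔe ⊢
  generalize (εzz t : ℂ) = y at hΔe ⊢
  generalize (εxz t : ℂ) = z at hΔe ⊢
  -- The derivative of H is eliminated in favour of the flux; the coefficient of k ψ then collapses
  -- from y/Δ to 1/x because x y - z² = Δ.
  have hflux : ∀ e : ℂ, v t = x / Δ * e + k * (z / Δ) * ψ t →
      z / Δ * e + k * (y / Δ) * ψ t = z * x⁻¹ * v t + k * x⁻¹ * ψ t := fun e he => by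
    rw [he]
    field_simp
    rw [hΔe]
    ring
  constructor
  · rintro ⟨d₁, d₂, h1, h2, h3, h4⟩
    refine ⟨h1.congr_deriv ?_, h2.congr_deriv ?_⟩
    · rw [h3]
      field_simp
      linear_combination d₁ * x * hII
    · rw [hflux _ h3] at h4
      linear_combination Complex.I * h4 + d₂ * hII
  · rintro ⟨h1, h2⟩
    have h3 : v t = x / Δ * (-Complex.I * (Complex.I * (v t / (x * Δ⁻¹) - k * (z * x⁻¹) * ψ t))) +
        k * (z / Δ) * ψ t := by
      rw [← mul_assoc (-Complex.I), neg_mul, hII]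
      field_simp
      ring
    refine ⟨_, _, h1, h2, h3, ?_⟩
    rw [hflux _ h3]
    linear_combination (k * (z * x⁻¹) * v t + k ^ 2 * x⁻¹ * ψ t - μ * ψ t) * hII

theorem allBandsHaveSlope_even (h : IsLayeredDielectric L εxx εyy εzz εxz) {c kx : ℝ} (hc : 0 < c)
    (hL : 0 < L) :
    AllBandsHaveSlope c (evenEigenspace L kx εxx εzz εxz) (c / √(⨆ x, εxx x)) := by
  have : Fact (0 < L) := ⟨hL⟩
  obtain ⟨m, hm, hle⟩ := h.exists_le
  have hmx : ∀ x, m ≤ εxx x := fun x => (hle x).1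
  have hmΔ : ∀ x, m ^ 2 ≤ εxx x * εzz x - εxz x * εxz x := fun x => (hle x).2.2.2
  have hm2 : 0 < m ^ 2 := by positivity
  have hx0 : ∀ x, 0 < εxx x := fun x => hm.trans_le (hmx x)
  have hz0 : ∀ x, 0 < εzz x := fun x => hm.trans_le (hle x).2.2.1
  have hΔ0 : ∀ x, 0 < εxx x * εzz x - εxz x * εxz x := fun x => hm2.trans_le (hmΔ x)
  obtain ⟨pxx, -, pzz, pxz⟩ := h.periodic_entries
  have txx := h.smooth_xx.isTame hL pxx
  have tzz := h.smooth_zz.isTame hL pzz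
  have txz := h.smooth_xz.isTame hL pxz
  have ta := txx.mul (((txx.mul tzz).sub (txz.mul txz)).inv hm2 hmΔ)
  have tγ := txz.mul (txx.inv hm hmx)
  have hs : 0 < ⨆ x, εxx x := (hx0 0).trans_le (le_ciSup txx.bddAbove 0)
  obtain ⟨Cz, hCz⟩ := tzz.bounded
  have hCz' : ∀ t, εzz t ≤ Cz := fun t => (le_abs_self _).trans (hCz t)
  have hCz0 : 0 < Cz := (hz0 0).trans_le (hCz' 0)
  obtain ⟨Cx, hCx⟩ := txx.bounded
  have hCx' : ∀ t, εxx t ≤ Cx := fun t => (le_abs_self _).trans (hCx t)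
  have hCx0 : 0 < Cx := (hx0 0).trans_le (hCx' 0)
  obtain ⟨C, hC⟩ := (ta.mul (tγ.mul tγ)).bounded
  have hP : IsPeriodicPencil L (fun t => εxx t * (εxx t * εzz t - εxz t * εxz t)⁻¹)
      (fun t => εxz t * (εxx t)⁻¹) (fun t => (εxx t)⁻¹) (fun _ => 1) (⨆ x, εxx x)⁻¹ :=
    { tame_a := ta
      tame_γ := tγ
      tame_β := txx.inv hm hmx
      tame_r := IsTame.const 1
      periodic_a := fun t => by simp only [pxx t, pzz t, pxz t]
      periodic_γ := fun t => by simp only [pxx t, pxz t]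
      periodic_β := fun t => by simp only [pxx t]
      periodic_r := fun _ => rfl
      -- The bound follows from Δ ≤ εxx εzz ≤ εxx Cz.
      a_pos := ⟨Cz⁻¹, inv_pos.2 hCz0, fun t => by
        rw [← div_eq_mul_inv, inv_eq_one_div, div_le_div_iff₀ hCz0 (hΔ0 t)]
        nlinarith [mul_self_nonneg (εxz t), mul_le_mul_of_nonneg_left (hCz' t) (hx0 t).le]⟩
      r_pos := ⟨1, one_pos, fun _ => le_rfl⟩
      β_pos := fun t => inv_pos.2 (hx0 t)
      -- The product a γ² is at most C, while β = 1/εxx is at least 1/Cx.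
      γ_le := ⟨C * Cx, fun t => by
        have h1 := (le_abs_self _).trans (hC t)
        have h2 : 0 ≤ C := (abs_nonneg _).trans (hC t)
        rw [pow_two]
        refine h1.trans ?_
        rw [mul_assoc]
        refine le_mul_of_one_le_right h2 ?_
        rw [← div_eq_mul_inv, one_le_div (hx0 t)]
        exact hCx' t⟩
      v_nonneg := (inv_pos.2 hs).le
      v_le := fun t => by
        rw [mul_one]
        exact (inv_le_inv₀ hs (hx0 t)).2 (le_ciSup txx.bddAbove t)
      approx := fun ε hε => by
        obtain ⟨a, b, hab, h'⟩ := h.smooth_xx.exists_Ioo_inv_lt hm hmx txx.bddAbove hε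
        refine ⟨a, b, hab, fun t ht => ?_⟩
        rw [mul_one]
        exact (h' t ht).le }
  rw [div_eq_mul_inv, ← Real.sqrt_inv]
  exact hP.allBandsHaveSlope hc (fun t => Complex.exp_ne_zero _) (mem_evenEigenspace_iff hx0 hΔ0)

end IsLayeredDielectric

end PhotonicBands

end

theorem mainTheorem1 (c L : ℝ) (hc : 0 < c) (hL : 0 < L) :
    -- every positive semidefinite self-adjoint `K` with discrete spectrum in `L²(0, L)`
    (∀ (K : L2 L →ₗ.[ℂ] L2 L) (V : ℝ → ℝ), IsPosSemidefDiscrete K →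
      PiecewiseSmooth V → Function.Periodic V L → (∀ x, 0 < V x) →
      AllBandsHaveSlope c (operatorEigenspace K V) (c * √(⨅ x, V x))) ∧
    -- `K = - w d/dx p d/dx w` with Bloch boundary conditions
    (∀ (kx : ℝ) (w p V : ℝ → ℝ), IsPositiveCoefficient L w → IsPositiveCoefficient L p →
      PiecewiseSmooth V → Function.Periodic V L → (∀ x, 0 < V x) →
      AllBandsHaveSlope c (blochEigenspace L kx w p V) (c * √(⨅ x, V x))) ∧
    -- odd and even bands of a layered dielectric
    (∀ (kx : ℝ) (εxx εyy εzz εxz : ℝ → ℝ), IsLayeredDielectric L εxx εyy εzz εxz →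
      AllBandsHaveSlope c (oddEigenspace L kx εyy) (c / √(⨆ x, εyy x)) ∧
      AllBandsHaveSlope c (evenEigenspace L kx εxx εzz εxz) (c / √(⨆ x, εxx x))) := by
  refine ⟨fun K V hK hV hVp hV0 => allBandsHaveSlope_operatorEigenspace hc hL hK hV hVp hV0,
    fun kx w p V hw hp hV hVp hV0 => allBandsHaveSlope_blochEigenspace hc hL hw hp hV hVp hV0,
    fun kx εxx εyy εzz εxz h => ⟨h.allBandsHaveSlope_odd hc hL, h.allBandsHaveSlope_even hc hL⟩⟩
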